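/- \textbf{Setting.} Let $(m_x)_{x\ge1}$ be i.i.d. random variables on a probability space, whose law has a smooth density supported in $[m_{\min},m_{\max}]$ with $m_{\min}>0$, and let $\bar m=\mathbb E(m_1)$. Let $\bar p,\bar r\in C^1([0,1])$ with $\bar r(0)=\bar r(1)=0$ and $\int_0^1\bar p(y)\,dy=0$, and let $\beta\in C^0([0,1])$ with $\beta>0$ on $[0,1]$. For $n\ge1$ consider on $L^2(\mathbb R^{n-1};\mathbb C)$, with variables $\xi_1,\dots,\xi_{n-1}$, the closures of the following operators, initially defined on the Schwartz space: the elongations $r_x=$ multiplication by $\xi_x$ ($1\le x\le n-1$), with $r_0=r_n=0$, and the momenta $p_x=-i\big(\tfrac{\partial}{\partial\xi_{x-1}}-\tfrac{\partial}{\partial\xi_x}\big)$ ($1\le x\le n$), with $\tfrac{\partial}{\partial\xi_0}=\tfrac{\partial}{\partial\xi_n}=0$. Let $$H_n=\frac12\sum_{x=1}^n\Big(\frac{p_x^2}{m_x}+r_x^2\Big),\qquad p_x(t)=e^{itH_n}p_xe^{-itH_n},\qquad r_x(t)=e^{itH_n}r_xe^{-itH_n},$$ and let $\rho^n$ be the locally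 Gibbs state $$\rho^n=\frac1{Z_n}\exp\Big(-\frac12\sum_{x=1}^n\Big[\frac{\beta(\frac xn)}{m_x}\Big(p_x-\frac{m_x}{\bar m}\,\bar p(\tfrac xn)\Big)^2+\beta(\tfrac xn)\big(r_x-\bar r(\tfrac xn)\big)^2\Big]\Big),\qquad \mathrm{Tr}\,\rho^n=1,$$ where $H_n$ and the operator in the exponent are also closed from the Schwartz space. Write $\langle a\rangle_{\rho^n}=\mathrm{Tr}(\rho^na)$, which is well defined when $a\rho^n$ is an everywhere defined trace-class operator, and is then computed as $\mathrm{Tr}(a\rho^n)$. Fix $T>0$ and let $(\mathrm r,\mathrm p)$ be the continuous solution on $[0,1]\times[0,T]$ of $$\partial_t\mathrm r=\frac1{\bar m}\,\partial_y\mathrm p,\qquad \partial_t\mathrm p=\partial_y\mathrm r,\qquad \mathrm r(0,t)=\mathrm r(1,t)=0,\qquad \mathrm r(y,0)=\bar r(y),\quad \mathrm p(y,0)=\bar p(y),$$ the two conservation laws being understood in integrated form: for all $0\le a\le b\le1$ and $t\in[0,T]$, $$\int_a^b\big(\mathrm r(y,t)-\mathrm r(y,0)\big)dy=\frac1{\bar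 m}\int_0^t\big(\mathrm p(b,s)-\mathrm p(a,s)\big)ds,\qquad \int_a^b\big(\mathrm p(y,t)-\mathrm p(y,0)\big)dy=\int_0^t\big(\mathrm r(b,s)-\mathrm r(a,s)\big)ds .$$ (Every classical solution in $C^1([0,1]\times[0,T])$ is a solution in this sense.) \textbf{Lemma.} For every $g\in C^0([0,1])$ and every $t\in[0,T]$, almost surely with respect to the masses: the averages $\langle p_x(nt)\rangle_{\rho^n}$ and $\langle r_x(nt)\rangle_{\rho^n}$ are well defined for all $n\ge1$ and $1\le x\le n$, and $$\lim_{n\to\infty}\frac1n\sum_{x=1}^n g\Big(\frac xn\Big)\Big(\frac{\langle p_x(nt)\rangle_{\rho^n}^2}{2m_x}+\frac{\langle r_x(nt)\rangle_{\rho^n}^2}{2}\Big)=\int_0^1 g(y)\Big(\frac{\mathrm p(y,t)^2}{2\bar m}+\frac{\mathrm r(y,t)^2}{2}\Big)dy .$$ That is, the microscopic mechanical energy converges to the macroscopic one. -/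

import Mathlib

open MeasureTheory ProbabilityTheory Filter Set
open scoped Topology SchwartzMap InnerProductSpace

noncomputable section

namespace QuantumChain

/-! ## Operators on a complex Hilbert space -/

section Hilbert

variable {H : Type} [NormedAddCommGroup H] [InnerProductSpace ℂ H] [CompleteSpace H]

/-- `S` (restricted to times `s ≥ 0`) is a strongly continuous one-parameter semigroup of bounded
operators whose infinitesimal generator is exactly the unbounded operator `A`. -/
structure IsSemigroupGeneratedBy (A : H →ₗ.[ℂ] H) (S : ℝ → H →L[ℂ] H) : Prop where
  zero : S 0 = 1
  add : ∀ s t : ℝ, 0 ≤ s → 0 ≤ t → S (s + t) = S s * S t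
  continuous : ∀ v : H, ContinuousOn (fun s => S s v) (Ici 0)
  generator : ∀ v w : H,
    Tendsto (fun s : ℝ => s⁻¹ • (S s v - v)) (𝓝[>] 0) (𝓝 w) ↔ (v, w) ∈ A.graph

open Classical in
/-- The exponential `e^A` of an unbounded operator `A`: the time-one operator of the strongly
continuous semigroup generated by `A` (a semigroup is determined by its generator).
The value is `0` if `A` generates no such semigroup. -/
def expOp (A : H →ₗ.[ℂ] H) : H →L[ℂ] H :=
  if h : ∃ S : ℝ → H →L[ℂ] H, IsSemigroupGeneratedBy A S then h.choose 1 else 0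

/-- Trace-class (nuclear) operators: `T v = ∑ₖ ⟨aₖ, v⟩ bₖ` with `∑ₖ ‖aₖ‖ ‖bₖ‖ < ∞`. -/
def IsTraceClass (T : H →L[ℂ] H) : Prop :=
  ∃ a b : ℕ → H, Summable (fun k => ‖a k‖ * ‖b k‖) ∧
    ∀ v : H, HasSum (fun k => ⟪a k, v⟫_ℂ • b k) (T v)

/-- The trace `∑ᵢ ⟨eᵢ, T eᵢ⟩` over a complete orthonormal system `e`; for a trace-class operator
it does not depend on the choice of `e`. -/
def trace (T : H →L[ℂ] H) : ℂ :=
  ∑' i : (exists_hilbertBasis ℂ H).choose, ⟪(i : H), T (i : H)⟫_ℂ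

/-- The density operator `e^{-K} / Tr e^{-K}`; the argument is the operator `-K`. -/
def gibbsState (negK : H →ₗ.[ℂ] H) : H →L[ℂ] H :=
  (trace (expOp negK))⁻¹ • expOp negK

/-- `T` is the bounded, everywhere defined, trace-class operator `a ρ`. -/
def IsTraceClassProduct (ρ : H →L[ℂ] H) (a : H →ₗ.[ℂ] H) (T : H →L[ℂ] H) : Prop :=
  IsTraceClass T ∧ ∀ v : H, (ρ v, T v) ∈ a.graph

/-- The average of the observable `a` in the state `ρ` is well defined: `a ρ` is an everywhere
defined trace-class operator. -/
def HasExpectation (ρ : H →L[ℂ] H) (a : H →ₗ.[ℂ] H) : Prop :=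
  ∃ T : H →L[ℂ] H, IsTraceClassProduct ρ a T

open Classical in
/-- The average `⟨a⟩_ρ` of an unbounded observable `a`, i.e. the trace of the product of `ρ`
and `a`. -/
def expectation (ρ : H →L[ℂ] H) (a : H →ₗ.[ℂ] H) : ℂ :=
  if h : HasExpectation ρ a then trace h.choose else 0

/-- `V a U` with its natural domain `{v | U v ∈ D(a)}`. -/
def conjOp (V : H →L[ℂ] H) (a : H →ₗ.[ℂ] H) (U : H →L[ℂ] H) : H →ₗ.[ℂ] H where
  domain := a.domain.comap (U : H →ₗ[ℂ] H)
  toFun := (V : H →ₗ[ℂ] H) ∘ₗ a.toFun ∘ₗ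
    ((U : H →ₗ[ℂ] H).restrict (p := a.domain.comap (U : H →ₗ[ℂ] H)) (q := a.domain)
      (fun _ hv => hv))

end Hilbert

/-! ## The chain of `n` particles, in the elongation variables `ξ₁, …, ξ_{n-1}` -/

/-- The configuration space `ℝ^{n-1}`. -/
abbrev Conf (n : ℕ) : Type := EuclideanSpace ℝ (Fin (n - 1))

/-- The Hilbert space `L²(ℝ^{n-1}; ℂ)`. -/
abbrev Hil (n : ℕ) : Type := Lp ℂ 2 (volume : Measure (Conf n))

/-- The inclusion of the Schwartz space into `L²`. -/
def incl (n : ℕ) : 𝓢(Conf n, ℂ) →ₗ[ℂ] Hil n :=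
  (SchwartzMap.toLpCLM ℂ ℂ 2 (volume : Measure (Conf n)) : 𝓢(Conf n, ℂ) →ₗ[ℂ] Hil n)

theorem incl_injective (n : ℕ) : Function.Injective (incl n) :=
  SchwartzMap.injective_toLp 2 volume

/-- The operator on `L²` with domain the Schwartz space given by `A`. -/
def schwartzOp (n : ℕ) (A : Module.End ℂ 𝓢(Conf n, ℂ)) : Hil n →ₗ.[ℂ] Hil n where
  domain := LinearMap.range (incl n)
  toFun := incl n ∘ₗ A ∘ₗ (LinearEquiv.ofInjective (incl n) (incl_injective n)).symm.toLinearMap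

/-- The closure on `L²` of the operator `A` defined on the Schwartz space. -/
def closedOp (n : ℕ) (A : Module.End ℂ 𝓢(Conf n, ℂ)) : Hil n →ₗ.[ℂ] Hil n :=
  (schwartzOp n A).closure

/-- The elongation operator `r_x`, multiplication by the coordinate `ξ_x`, for `1 ≤ x ≤ n - 1`;
the boundary condition is `r_0 = r_n = 0`. -/
def elong (n x : ℕ) : Module.End ℂ 𝓢(Conf n, ℂ) :=
  if h : 1 ≤ x ∧ x < n then
    (SchwartzMap.smulLeftCLM ℂ
      (fun ξ : Conf n => ((ξ ⟨x - 1, by omega⟩ : ℝ) : ℂ))).toLinearMap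
  else 0

/-- The partial derivative `∂/∂ξ_x` for `1 ≤ x ≤ n - 1`, and `0` for `x = 0` and `x = n`. -/
def partialDeriv (n x : ℕ) : Module.End ℂ 𝓢(Conf n, ℂ) :=
  if h : 1 ≤ x ∧ x < n then
    (LineDeriv.lineDerivOpCLM ℂ 𝓢(Conf n, ℂ)
      (EuclideanSpace.single (⟨x - 1, by omega⟩ : Fin (n - 1)) (1 : ℝ) : Conf n)).toLinearMap
  else 0

/-- The momentum operator `p_x = -i (∂/∂ξ_{x-1} - ∂/∂ξ_x)`, for `1 ≤ x ≤ n`. -/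
def momentum (n x : ℕ) : Module.End ℂ 𝓢(Conf n, ℂ) :=
  (-Complex.I) • (partialDeriv n (x - 1) - partialDeriv n x)

/-- The Hamiltonian `½ ∑_{x=1}^n (p_x² / m_x + r_x²)` of the chain with masses `m`. -/
def hamiltonian (n : ℕ) (m : ℕ → ℝ) : Module.End ℂ 𝓢(Conf n, ℂ) :=
  (1 / 2 : ℂ) • ∑ x ∈ Finset.Icc 1 n,
    ((1 / m x : ℂ) • momentum n x ^ 2 + elong n x ^ 2)

/-- The pseudo-Hamiltonian
`½ ∑_{x=1}^n (β(x/n)/m_x (p_x - (m_x/mbar) pbar(x/n))² + β(x/n) (r_x - rbar(x/n))²)`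
of the locally Gibbs state. -/
def pseudoHamiltonian (n : ℕ) (m : ℕ → ℝ) (mbar : ℝ) (β pbar rbar : ℝ → ℝ) :
    Module.End ℂ 𝓢(Conf n, ℂ) :=
  (1 / 2 : ℂ) • ∑ x ∈ Finset.Icc 1 n,
    (((β (x / n) / m x : ℝ) : ℂ) •
        (momentum n x - ((m x / mbar * pbar (x / n) : ℝ) : ℂ) • 1) ^ 2
      + ((β (x / n) : ℝ) : ℂ) • (elong n x - ((rbar (x / n) : ℝ) : ℂ) • 1) ^ 2)

/-- The locally Gibbs state: the normalized exponential of minus the (closed)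
pseudo-Hamiltonian. -/
def localGibbs (n : ℕ) (m : ℕ → ℝ) (mbar : ℝ) (β pbar rbar : ℝ → ℝ) : Hil n →L[ℂ] Hil n :=
  gibbsState (closedOp n (-pseudoHamiltonian n m mbar β pbar rbar))

/-- The Heisenberg evolution at time `t` of the (closed) operator `A`:
`e^{i t H} A e^{-i t H}`, where `H` is the closed Hamiltonian. -/
def heisenberg (n : ℕ) (m : ℕ → ℝ) (t : ℝ) (A : Module.End ℂ 𝓢(Conf n, ℂ)) :
    Hil n →ₗ.[ℂ] Hil n :=
  conjOp (expOp (closedOp n ((Complex.I * t) • hamiltonian n m)))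
    (closedOp n A)
    (expOp (closedOp n ((-(Complex.I * t)) • hamiltonian n m)))

/-! ## The macroscopic equations -/

/-- `(r, p)`, functions of `(y, t) ∈ [0,1] × [0,T]`, is the solution of
`∂ₜ r = (1/mbar) ∂_y p`, `∂ₜ p = ∂_y r` with `r(0,t) = r(1,t) = 0`, `r(·,0) = rbar`,
`p(·,0) = pbar`. The two conservation laws are in integrated form, since a solution that is continuously
differentiable up to the boundary exists only if the derivative of `pbar` vanishes at `0` and `1`.
Where such a solution exists, it is a solution in the present sense
(`IsMacroSolution.of_classical`). -/
structure IsMacroSolution (T mbar : ℝ) (pbar rbar : ℝ → ℝ) (p r : ℝ → ℝ → ℝ) : Prop where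
  continuousOn_p : ContinuousOn (fun z : ℝ × ℝ => p z.1 z.2) (Icc 0 1 ×ˢ Icc 0 T)
  continuousOn_r : ContinuousOn (fun z : ℝ × ℝ => r z.1 z.2) (Icc 0 1 ×ˢ Icc 0 T)
  boundary_left : ∀ t ∈ Icc 0 T, r 0 t = 0
  boundary_right : ∀ t ∈ Icc 0 T, r 1 t = 0
  initial_p : ∀ y ∈ Icc (0 : ℝ) 1, p y 0 = pbar y
  initial_r : ∀ y ∈ Icc (0 : ℝ) 1, r y 0 = rbar y
  conservation_r : ∀ a b t : ℝ, 0 ≤ a → a ≤ b → b ≤ 1 → t ∈ Icc 0 T →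
    (∫ y in a..b, r y t) - (∫ y in a..b, r y 0) = ∫ s in (0 : ℝ)..t, (p b s - p a s) / mbar
  conservation_p : ∀ a b t : ℝ, 0 ≤ a → a ≤ b → b ≤ 1 → t ∈ Icc 0 T →
    (∫ y in a..b, p y t) - (∫ y in a..b, p y 0) = ∫ s in (0 : ℝ)..t, (r b s - r a s)

/-- A function on `[0,1] × [0,T]` whose time derivative is the space derivative of another one
satisfies the integrated conservation law. -/
theorem integrated_conservation {T : ℝ} {u v w : ℝ → ℝ → ℝ}
    (hw : ContinuousOn (fun z : ℝ × ℝ => w z.1 z.2) (Icc 0 1 ×ˢ Icc 0 T))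
    (hu : ∀ y ∈ Icc (0 : ℝ) 1, ∀ t ∈ Icc 0 T,
      HasDerivWithinAt (fun s => u y s) (w y t) (Icc 0 T) t)
    (hv : ∀ y ∈ Icc (0 : ℝ) 1, ∀ t ∈ Icc 0 T,
      HasDerivWithinAt (fun z => v z t) (w y t) (Icc 0 1) y)
    (hu' : ContinuousOn (fun z : ℝ × ℝ => u z.1 z.2) (Icc 0 1 ×ˢ Icc 0 T))
    (a b t : ℝ) (ha : 0 ≤ a) (hab : a ≤ b) (hb : b ≤ 1) (ht : t ∈ Icc 0 T) :
    (∫ y in a..b, u y t) - (∫ y in a..b, u y 0) = ∫ s in (0 : ℝ)..t, (v b s - v a s) := by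
  obtain ⟨ht0, htT⟩ := ht
  have h0T : (0 : ℝ) ∈ Icc 0 T := ⟨le_rfl, ht0.trans htT⟩
  have hsub : Icc a b ⊆ Icc (0 : ℝ) 1 := Icc_subset_Icc ha hb
  have hsubt : Icc 0 t ⊆ Icc 0 T := Icc_subset_Icc le_rfl htT
  have hint : ∀ s ∈ Icc 0 T, IntervalIntegrable (fun y => u y s) volume a b := by
    intro s hs
    apply ContinuousOn.intervalIntegrable
    rw [uIcc_of_le hab]
    exact hu'.comp (f := fun y : ℝ => (y, s)) (by fun_prop) (fun y hy => ⟨hsub hy, hs⟩)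
  have hwt : ∀ y ∈ Icc (0 : ℝ) 1, ContinuousOn (fun s => w y s) (Icc 0 t) := fun y hy =>
    hw.comp (f := fun s : ℝ => (y, s)) (by fun_prop) (fun s hs => ⟨hy, hsubt hs⟩)
  have hwy : ∀ s ∈ Icc 0 T, ContinuousOn (fun y => w y s) (Icc a b) := fun s hs =>
    hw.comp (f := fun y : ℝ => (y, s)) (by fun_prop) (fun y hy => ⟨hsub hy, hs⟩)
  have e1 : ∀ y ∈ Icc (0 : ℝ) 1, ∫ s in (0 : ℝ)..t, w y s = u y t - u y 0 := by
    intro y hy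
    apply intervalIntegral.integral_eq_sub_of_hasDerivAt_of_le ht0
    · exact fun s hs => ((hu y hy s (hsubt hs)).continuousWithinAt).mono hsubt
    · intro s hs
      exact (hu y hy s (hsubt ⟨hs.1.le, hs.2.le⟩)).hasDerivAt
        (Icc_mem_nhds hs.1 (hs.2.trans_le htT))
    · exact ContinuousOn.intervalIntegrable (by rw [uIcc_of_le ht0]; exact hwt y hy)
  have e2 : ∀ s ∈ Icc 0 T, ∫ y in a..b, w y s = v b s - v a s := by
    intro s hs
    apply intervalIntegral.integral_eq_sub_of_hasDerivAt_of_le hab (f := fun y => v y s)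
    · exact fun y hy => ((hv y (hsub hy) s hs).continuousWithinAt).mono hsub
    · intro y hy
      exact (hv y (hsub ⟨hy.1.le, hy.2.le⟩) s hs).hasDerivAt
        (Icc_mem_nhds (ha.trans_lt hy.1) (hy.2.trans_le hb))
    · exact ContinuousOn.intervalIntegrable (by rw [uIcc_of_le hab]; exact hwy s hs)
  rw [← intervalIntegral.integral_sub (hint t ⟨ht0, htT⟩) (hint 0 h0T)]
  have l : ∫ y in a..b, (u y t - u y 0) = ∫ y in a..b, ∫ s in (0 : ℝ)..t, w y s := by
    apply intervalIntegral.integral_congr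
    intro y hy
    rw [uIcc_of_le hab] at hy
    exact (e1 y (hsub hy)).symm
  have r : ∫ s in (0 : ℝ)..t, (v b s - v a s) = ∫ s in (0 : ℝ)..t, ∫ y in a..b, w y s := by
    apply intervalIntegral.integral_congr
    intro s hs
    rw [uIcc_of_le ht0] at hs
    exact (e2 s (hsubt hs)).symm
  rw [l, r]
  simp only [intervalIntegral.integral_of_le hab, intervalIntegral.integral_of_le ht0]
  apply integral_integral_swap
  rw [Measure.prod_restrict]
  have hc : ContinuousOn (Function.uncurry w) (Icc a b ×ˢ Icc 0 t) :=
    hw.mono (prod_mono hsub hsubt)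
  exact ((hc.integrableOn_compact (isCompact_Icc.prod isCompact_Icc)).mono_set
    (prod_mono Ioc_subset_Icc_self Ioc_subset_Icc_self))

/-- A classical solution, continuously differentiable up to the boundary, is a solution. -/
theorem IsMacroSolution.of_classical {T mbar : ℝ} (hT : 0 < T) {pbar rbar : ℝ → ℝ}
    {p r : ℝ → ℝ → ℝ}
    (hp : ContDiffOn ℝ 1 (fun z : ℝ × ℝ => p z.1 z.2) (Icc 0 1 ×ˢ Icc 0 T))
    (hr : ContDiffOn ℝ 1 (fun z : ℝ × ℝ => r z.1 z.2) (Icc 0 1 ×ˢ Icc 0 T))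
    (pde_r : ∀ y ∈ Icc (0 : ℝ) 1, ∀ t ∈ Icc 0 T,
      derivWithin (fun s => r y s) (Icc 0 T) t = derivWithin (fun z => p z t) (Icc 0 1) y / mbar)
    (pde_p : ∀ y ∈ Icc (0 : ℝ) 1, ∀ t ∈ Icc 0 T,
      derivWithin (fun s => p y s) (Icc 0 T) t = derivWithin (fun z => r z t) (Icc 0 1) y)
    (bc0 : ∀ t ∈ Icc 0 T, r 0 t = 0) (bc1 : ∀ t ∈ Icc 0 T, r 1 t = 0)
    (ic_p : ∀ y ∈ Icc (0 : ℝ) 1, p y 0 = pbar y) (ic_r : ∀ y ∈ Icc (0 : ℝ) 1, r y 0 = rbar y) :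
    IsMacroSolution T mbar pbar rbar p r := by
  have key : ∀ f : ℝ → ℝ → ℝ,
      ContDiffOn ℝ 1 (fun z : ℝ × ℝ => f z.1 z.2) (Icc 0 1 ×ˢ Icc 0 T) →
      (∀ y ∈ Icc (0 : ℝ) 1, ∀ t ∈ Icc 0 T, HasDerivWithinAt (fun s => f y s)
        (derivWithin (fun s => f y s) (Icc 0 T) t) (Icc 0 T) t) ∧
      (∀ y ∈ Icc (0 : ℝ) 1, ∀ t ∈ Icc 0 T, HasDerivWithinAt (fun z => f z t)
        (derivWithin (fun z => f z t) (Icc 0 1) y) (Icc 0 1) y) ∧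
      ContinuousOn (fun z : ℝ × ℝ => derivWithin (fun s => f z.1 s) (Icc 0 T) z.2)
        (Icc 0 1 ×ˢ Icc 0 T) := by
    intro f hf
    have hS : UniqueDiffOn ℝ (Icc (0 : ℝ) 1 ×ˢ Icc 0 T) :=
      (uniqueDiffOn_Icc one_pos).prod (uniqueDiffOn_Icc hT)
    have hd : ∀ y ∈ Icc (0 : ℝ) 1, ∀ t ∈ Icc 0 T,
        HasFDerivWithinAt (fun z : ℝ × ℝ => f z.1 z.2)
          (fderivWithin ℝ (fun z : ℝ × ℝ => f z.1 z.2) (Icc 0 1 ×ˢ Icc 0 T) (y, t))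
          (Icc 0 1 ×ˢ Icc 0 T) (y, t) := fun y hy t ht =>
      (hf.differentiableOn one_ne_zero (y, t) ⟨hy, ht⟩).hasFDerivWithinAt
    have ht1 : ∀ y ∈ Icc (0 : ℝ) 1, ∀ t ∈ Icc 0 T, HasDerivWithinAt (fun s => f y s)
        (fderivWithin ℝ (fun z : ℝ × ℝ => f z.1 z.2) (Icc 0 1 ×ˢ Icc 0 T) (y, t) (0, 1))
        (Icc 0 T) t := fun y hy t ht =>
      (hd y hy t ht).comp_hasDerivWithinAt (f := fun s : ℝ => (y, s)) t
        ((hasDerivWithinAt_const t _ y).prodMk (hasDerivWithinAt_id t _)) (fun s hs => ⟨hy, hs⟩)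
    have hy1 : ∀ y ∈ Icc (0 : ℝ) 1, ∀ t ∈ Icc 0 T, HasDerivWithinAt (fun z => f z t)
        (fderivWithin ℝ (fun z : ℝ × ℝ => f z.1 z.2) (Icc 0 1 ×ˢ Icc 0 T) (y, t) (1, 0))
        (Icc 0 1) y := fun y hy t ht =>
      (hd y hy t ht).comp_hasDerivWithinAt (f := fun z : ℝ => (z, t)) y
        ((hasDerivWithinAt_id y _).prodMk (hasDerivWithinAt_const y _ t)) (fun z hz => ⟨hz, ht⟩)
    refine ⟨fun y hy t ht => (ht1 y hy t ht).differentiableWithinAt.hasDerivWithinAt,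
      fun y hy t ht => (hy1 y hy t ht).differentiableWithinAt.hasDerivWithinAt, ?_⟩
    have hc : ContinuousOn (fun z : ℝ × ℝ =>
        fderivWithin ℝ (fun z : ℝ × ℝ => f z.1 z.2) (Icc 0 1 ×ˢ Icc 0 T) z (0, 1))
        (Icc 0 1 ×ˢ Icc 0 T) :=
      (hf.continuousOn_fderivWithin hS le_rfl).clm_apply continuousOn_const
    refine hc.congr ?_
    rintro ⟨y, t⟩ ⟨hy, ht⟩
    exact (ht1 y hy t ht).derivWithin (uniqueDiffOn_Icc hT t ht)
  obtain ⟨p1, p2, p3⟩ := key p hp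
  obtain ⟨r1, r2, r3⟩ := key r hr
  refine ⟨hp.continuousOn, hr.continuousOn, bc0, bc1, ic_p, ic_r, ?_, ?_⟩
  · intro a b t ha hab hb ht
    have := integrated_conservation (v := fun y s => p y s / mbar) r3 r1
      (fun y hy t ht => by rw [pde_r y hy t ht]; exact (p2 y hy t ht).div_const mbar)
      hr.continuousOn a b t ha hab hb ht
    rw [this]
    congr 1
    ext s
    ring
  · intro a b t ha hab hb ht
    exact integrated_conservation p3 p1
      (fun y hy t ht => by rw [pde_p y hy t ht]; exact r2 y hy t ht)
      hp.continuousOn a b t ha hab hb ht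

end QuantumChain

end

/-! Quantum part. `hamiltonian` and `pseudoHamiltonian` are both quadratic, so everything reduces to
linear algebra once domains are under control. A linear symplectic change of variables
(`exists_normalModes`) turns each of them into a sum of independent oscillators plus a constant.
Ladder operators acting on a Gaussian vacuum give a Hilbert basis of Schwartz eigenfunctions
(`exists_isFockBasis`), in which the closed operators are diagonal on their maximal domain and their
exponentials are explicit (`expOp_eq_diagOp`). Heisenberg evolution multiplies each ladder operator
by a phase, so a linear observable remains linear. Written in the modes of the Gibbs state, it is a
constant plus a ladder part with vanishing diagonal, and its average is that constant
(`gibbs_heisenberg_expectation`). The averages therefore follow Newton's equations of the classical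
harmonic chain (`exists_mean_trajectory`). Since the total momentum operator is zero, the mean
initial momenta are not quite the prescribed ones: a multiple of `m x / β (x / n)` is subtracted,
with a factor that tends to zero (`tendsto_momentumShift`).

Classical part. Only two properties of the masses are used, both almost sure: uniform positive
bounds and the strong law for `massSum`. In energy coordinates and macroscopic time the chain is a
linear flow `u' = A u` with `A` skew on a Euclidean space. The macroscopic solution is sampled with
`p` at `x / n` and `r` at the fraction of mass carried by the first `x` particles. In this mass
coordinate the cell of particle `x` has length proportional to `m x`, which cancels the random
factor `1 / m x` in the velocity equation. The integrated conservation laws then show that the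
sample `U` satisfies `u 0 - U s + A (∫ U) ≈ 0` uniformly (`consistency_elong`,
`consistency_velocity`).

Skewness and a Gronwall argument make the time integral of `u - U` small
(`norm_integral_sub_sq_le`). A fixed time is reached by equicontinuity: the initial data are `C¹`,
so `u 0` is close to a vector `w` with `A w` bounded uniformly in `n`, and this controls the
increments of `u` (`norm_sub_sq_le_of_skew`). The squared norm is twice the mechanical energy per
particle, so the energy of the means is asymptotically that of the sample, which is a mass-weighted
Riemann sum (`tendsto_mechanical_energy`). -/

noncomputable section

namespace QuantumChain

/-! ### Operators diagonal in a Hilbert basis. -/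

section Diagonal

variable {E I : Type} [NormedAddCommGroup E] [InnerProductSpace ℂ E]

theorem hasSum_norm_inner_sq (u : HilbertBasis I ℂ E) (v : E) :
    HasSum (fun i => ‖⟪u i, v⟫_ℂ‖ ^ 2) (‖v‖ ^ 2) := by
  have h := u.hasSum_inner_mul_inner v v
  rw [inner_self_eq_norm_sq_to_K] at h
  have h2 := Complex.hasSum_re h
  convert h2 using 1
  · ext i
    rw [← inner_conj_symm v (u i), mul_comm, Complex.mul_conj, Complex.normSq_eq_norm_sq]
    exact (Complex.ofReal_re _).symm
  · simp [← Complex.ofReal_pow]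

theorem hilbertBasis_ext (u : HilbertBasis I ℂ E) {v w : E} (h : ∀ i, ⟪u i, v⟫_ℂ = ⟪u i, w⟫_ℂ) :
    v = w := by
  apply u.repr.injective
  ext i
  simpa [u.repr_apply_apply] using h i

theorem clm_ext_hilbertBasis (u : HilbertBasis I ℂ E) {A B : E →L[ℂ] E}
    (h : ∀ i, A (u i) = B (u i)) : A = B := by
  exact ContinuousLinearMap.ext_on
    (Submodule.dense_iff_topologicalClosure_eq_top.mpr u.dense_span) (by rintro _ ⟨i, rfl⟩; exact h i)

theorem memlp_mul (f : lp (fun _ : I => ℂ) 2) (c : I → ℂ) (hc : ∀ i, ‖c i‖ ≤ 1) :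
    Memℓp (fun i => c i * f i) 2 := by
  refine (lp.memℓp f).mono' ?_
  intro i
  rw [norm_mul]
  exact mul_le_of_le_one_left (norm_nonneg _) (hc i)

/-- The operator that is diagonal in a Hilbert basis, with eigenvalues in the unit disc. -/
def diagOp (u : HilbertBasis I ℂ E) (c : I → ℂ) (hc : ∀ i, ‖c i‖ ≤ 1) : E →L[ℂ] E :=
  LinearMap.mkContinuous
    { toFun := fun v => u.repr.symm ⟨fun i => c i * u.repr v i, memlp_mul _ c hc⟩
      map_add' := fun v w => by
        rw [← map_add]; congr 1; ext i; simp only [map_add, lp.coeFn_add, Pi.add_apply, mul_add]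
      map_smul' := fun a v => by
        rw [RingHom.id_apply, ← map_smul]; congr 1; ext i; simp only [map_smul, lp.coeFn_smul, Pi.smul_apply, smul_eq_mul]; ring } 1 (by
      intro v
      simp only [LinearMap.coe_mk, AddHom.coe_mk, LinearIsometryEquiv.norm_map, one_mul]
      rw [← u.repr.norm_map v]
      refine lp.norm_mono (by norm_num) ?_
      intro i
      simpa using mul_le_of_le_one_left (norm_nonneg _) (hc i))

theorem inner_diagOp (u : HilbertBasis I ℂ E) (c : I → ℂ) (hc : ∀ i, ‖c i‖ ≤ 1) (v : E) (i : I) :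
    ⟪u i, diagOp u c hc v⟫_ℂ = c i * ⟪u i, v⟫_ℂ := by
  rw [← u.repr_apply_apply, ← u.repr_apply_apply]
  simp [diagOp]

theorem diagOp_apply_basis (u : HilbertBasis I ℂ E) (c : I → ℂ) (hc : ∀ i, ‖c i‖ ≤ 1) (i : I) :
    diagOp u c hc (u i) = c i • u i := by
  classical
  apply hilbertBasis_ext u
  intro j
  rw [inner_diagOp, inner_smul_right]
  by_cases h : i = j
  · rw [h]
  · rw [u.orthonormal.inner_eq_zero (Ne.symm h)]; simp

theorem diagOp_hasSum (u : HilbertBasis I ℂ E) (c : I → ℂ) (hc : ∀ i, ‖c i‖ ≤ 1) (v : E) :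
    HasSum (fun i => (c i * ⟪u i, v⟫_ℂ) • u i) (diagOp u c hc v) := by
  have := u.hasSum_repr (diagOp u c hc v)
  simpa only [u.repr_apply_apply, inner_diagOp] using this

/-- Bounded pointwise convergence of the eigenvalues implies strong convergence. -/
theorem tendsto_diagOp (u : HilbertBasis I ℂ E) {l : Filter ℝ} (c : ℝ → I → ℂ)
    (hc : ∀ s i, ‖c s i‖ ≤ 1) (c0 : I → ℂ) (hc0 : ∀ i, ‖c0 i‖ ≤ 1)
    (h : ∀ i, Tendsto (fun s => c s i) l (𝓝 (c0 i))) (v : E) :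
    Tendsto (fun s => diagOp u (c s) (hc s) v) l (𝓝 (diagOp u c0 hc0 v)) := by
  rw [tendsto_iff_norm_sub_tendsto_zero]
  have key : Tendsto (fun s => ∑' i, ‖(c s i - c0 i) * ⟪u i, v⟫_ℂ‖ ^ 2) l
      (𝓝 (∑' _ : I, (0 : ℝ))) := by
    -- By Parseval the squared error is this series; two multipliers in the unit disc differ by at
    -- most 2, hence the factor 4 in the dominating series.
    refine tendsto_tsum_of_dominated_convergence
      (bound := fun i => 4 * ‖⟪u i, v⟫_ℂ‖ ^ 2) ((hasSum_norm_inner_sq u v).summable.mul_left 4) ?_ ?_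
    · intro i
      have : Tendsto (fun s => ‖(c s i - c0 i) * ⟪u i, v⟫_ℂ‖ ^ 2) l
          (𝓝 (‖(c0 i - c0 i) * ⟪u i, v⟫_ℂ‖ ^ 2)) :=
        ((((h i).sub_const _).mul_const _).norm).pow 2
      simpa using this
    · refine Eventually.of_forall fun s i => ?_
      rw [Real.norm_of_nonneg (sq_nonneg _), norm_mul, mul_pow]
      have : ‖c s i - c0 i‖ ≤ 2 := (norm_sub_le _ _).trans (by linarith [hc s i, hc0 i])
      gcongr
      nlinarith [norm_nonneg (c s i - c0 i)]
  rw [tsum_zero] at key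
  have h2 : (fun s => ‖diagOp u (c s) (hc s) v - diagOp u c0 hc0 v‖)
      = fun s => Real.sqrt (∑' i, ‖(c s i - c0 i) * ⟪u i, v⟫_ℂ‖ ^ 2) := by
    ext s
    rw [← Real.sqrt_sq (norm_nonneg (diagOp u (c s) (hc s) v - diagOp u c0 hc0 v)),
      ← (hasSum_norm_inner_sq u _).tsum_eq]
    congr 2
    ext i
    rw [inner_sub_right, inner_diagOp, inner_diagOp, sub_mul]
  rw [h2]
  simpa using key.sqrt

end Diagonal

/-! ### Semigroups acting on eigenvectors of their generator. -/

section Semigroup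

variable {H : Type} [NormedAddCommGroup H] [InnerProductSpace ℂ H]
  {B : H →ₗ.[ℂ] H} {S : ℝ → H →L[ℂ] H}

theorem isSemigroupGeneratedBy_of_complex (zero : S 0 = 1)
    (add : ∀ s t : ℝ, 0 ≤ s → 0 ≤ t → S (s + t) = S s * S t)
    (continuous : ∀ v : H, ContinuousOn (fun s => S s v) (Ici 0))
    (generator : ∀ v w : H, Tendsto (fun s : ℝ => (s : ℂ)⁻¹ • (S s v - v)) (𝓝[>] 0) (𝓝 w) ↔
      (v, w) ∈ B.graph) : IsSemigroupGeneratedBy B S := by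
  refine ⟨zero, add, continuous, fun v w => ?_⟩
  rw [← generator]
  simp only [← Complex.ofReal_inv, Complex.coe_smul]

/-- The function `exp (-s a) • S s v` has vanishing right derivative, hence is constant. Applied to
an eigenbasis, this determines whichever semigroup `expOp` has chosen, without a general uniqueness
theorem. -/
theorem IsSemigroupGeneratedBy.apply_one_of_eigenvector (hS : IsSemigroupGeneratedBy B S)
    {v : H} {a : ℂ} (hv : (v, a • v) ∈ B.graph) : S 1 v = Complex.exp a • v := by
  have hgen := (hS.generator v (a • v)).mpr hv
  have hder : ∀ s ∈ Ico (0 : ℝ) 1, HasDerivWithinAt (fun s => S s v) (S s (a • v)) (Ici s) s := by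
    intro s hs
    rw [hasDerivWithinAt_iff_tendsto_slope, Ici_sdiff_left]
    have h1 := ((S s).continuous.tendsto _).comp hgen
    have h2 : Tendsto (fun t => t - s) (𝓝[>] s) (𝓝[>] 0) := by
      refine tendsto_nhdsWithin_iff.mpr ⟨?_, ?_⟩
      · have : Tendsto (fun t => t - s) (𝓝 s) (𝓝 (s - s)) :=
          (continuous_id.sub continuous_const).tendsto s
        rw [sub_self] at this
        exact this.mono_left nhdsWithin_le_nhds
      · filter_upwards [self_mem_nhdsWithin] with t ht
        exact sub_pos.mpr (show s < t from ht)
    refine (h1.comp h2).congr' ?_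
    filter_upwards [self_mem_nhdsWithin] with t ht
    have hts : S t = S s * S (t - s) := by
      rw [← hS.add s (t - s) hs.1 (sub_nonneg.mpr (le_of_lt ht)), add_sub_cancel]
    simp only [Function.comp_apply, slope, vsub_eq_sub]
    rw [hts, ContinuousLinearMap.map_smul_of_tower, map_sub]
    rfl
  have hexp0 : ∀ s : ℝ, HasDerivAt (fun s : ℝ => Complex.exp (-(s * a)))
      (Complex.exp (-(s * a)) * (-(1 * a))) s := fun s =>
    ((Complex.ofRealCLM.hasDerivAt (x := s)).mul_const a).neg.cexp
  have hconst := constant_of_has_deriv_right_zero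
    (f := fun s : ℝ => Complex.exp (-(s * a)) • S s v) (a := 0) (b := 1) ?_ ?_ 1
    (right_mem_Icc.mpr zero_le_one)
  · simp only [hS.zero, Complex.ofReal_one, one_mul, Complex.ofReal_zero, zero_mul, neg_zero,
      Complex.exp_zero, one_smul, one_apply_eq_self] at hconst
    rw [← one_smul ℂ (S 1 v), ← Complex.exp_zero, ← add_neg_cancel a, Complex.exp_add, mul_smul,
      hconst]
  · exact ContinuousOn.smul (fun s _ => (hexp0 s).continuousAt.continuousWithinAt)
      ((hS.continuous v).mono Icc_subset_Ici_self)
  · intro s hs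
    have := (hexp0 s).hasDerivWithinAt.smul (hder s hs)
    refine this.congr_deriv ?_
    rw [map_smul, smul_smul, ← add_smul]
    simp

end Semigroup

/-! ### Closures and exponentials of operators with a Schwartz eigenbasis. -/

section Closure

/-- Mean value inequality in the left half plane, where the derivative of `exp` is bounded by 1. It
dominates the difference quotients of the semigroup. -/
theorem norm_exp_sub_one_le_of_re_nonpos {z : ℂ} (hz : z.re ≤ 0) : ‖Complex.exp z - 1‖ ≤ ‖z‖ := by
  have h := (convex_halfSpace_re_le 0).norm_image_sub_le_of_norm_hasDerivWithin_le
    (f := Complex.exp) (f' := Complex.exp) (C := 1) (x := 0) (y := z)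
    (fun x _ => (Complex.hasDerivAt_exp x).hasDerivWithinAt)
    (fun x hx => by rw [Complex.norm_exp, Real.exp_le_one_iff]; exact hx) (by simp) hz
  simpa using h

variable {n : ℕ}

theorem mem_graph_schwartzOp {A : Module.End ℂ 𝓢(Conf n, ℂ)} {x : Hil n × Hil n} :
    x ∈ (schwartzOp n A).graph ↔ ∃ φ, x = (incl n φ, incl n (A φ)) := by
  rw [LinearPMap.mem_graph_iff]
  constructor
  · rintro ⟨⟨y, φ, rfl⟩, h1, h2⟩
    refine ⟨φ, Prod.ext h1.symm ?_⟩
    rw [← h2]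
    change incl n (A ((LinearEquiv.ofInjective (incl n) (incl_injective n)).symm
      ((LinearEquiv.ofInjective (incl n) (incl_injective n)) φ))) = _
    rw [LinearEquiv.symm_apply_apply]
  · rintro ⟨φ, rfl⟩
    refine ⟨⟨incl n φ, φ, rfl⟩, rfl, ?_⟩
    change incl n (A ((LinearEquiv.ofInjective (incl n) (incl_injective n)).symm
      ((LinearEquiv.ofInjective (incl n) (incl_injective n)) φ))) = _
    rw [LinearEquiv.symm_apply_apply]

variable {I : Type} (u : HilbertBasis I ℂ (Hil n))

/-- An operator on the Schwartz space whose matrix elements against a Hilbert basis are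
continuous is closable. -/
theorem graph_closedOp {A : Module.End ℂ 𝓢(Conf n, ℂ)} (a : I → Hil n)
    (ha : ∀ i φ, ⟪u i, incl n (A φ)⟫_ℂ = ⟪a i, incl n φ⟫_ℂ) :
    (closedOp n A).graph = (schwartzOp n A).graph.topologicalClosure := by
  have hcl : ∀ x ∈ (schwartzOp n A).graph.topologicalClosure, ∀ i,
      ⟪u i, x.2⟫_ℂ = ⟪a i, x.1⟫_ℂ := by
    intro x hx i
    have hc : IsClosed {x : Hil n × Hil n | ⟪u i, x.2⟫_ℂ = ⟪a i, x.1⟫_ℂ} :=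
      isClosed_eq (by fun_prop) (by fun_prop)
    refine (closure_minimal ?_ hc) hx
    intro y hy
    obtain ⟨φ, rfl⟩ := mem_graph_schwartzOp.mp hy
    exact ha i φ
  have hclosable : (schwartzOp n A).IsClosable := by
    refine ⟨(schwartzOp n A).graph.topologicalClosure.toLinearPMap, ?_⟩
    rw [Submodule.toLinearPMap_graph_eq]
    intro x hx h0
    apply hilbertBasis_ext u
    intro i
    rw [hcl x hx i, h0, inner_zero_right, inner_zero_right]
  exact hclosable.graph_closure_eq_closure_graph.symm

variable {k : I → 𝓢(Conf n, ℂ)} (hk : ∀ i, u i = incl n (k i))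
  {lam : I → ℂ} {A : Module.End ℂ 𝓢(Conf n, ℂ)} (hA : ∀ i, A (k i) = lam i • k i)
  (hsymm : ∀ i φ, ⟪u i, incl n (A φ)⟫_ℂ = lam i * ⟪u i, incl n φ⟫_ℂ)

include hk hA hsymm

/-- The eigenvalue relation is closed and holds on Schwartz functions, so it holds on the closure.
Conversely, a pair satisfying it is the limit of its truncated expansions, which are pairs of
Schwartz functions. So the closure already has the maximal domain. -/
theorem mem_graph_closedOp_iff {x : Hil n × Hil n} :
    x ∈ (closedOp n A).graph ↔ ∀ i, ⟪u i, x.2⟫_ℂ = lam i * ⟪u i, x.1⟫_ℂ := by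
  rw [graph_closedOp u (fun i => (starRingEnd ℂ (lam i)) • u i)
    (fun i φ => by rw [hsymm, inner_smul_left, Complex.conj_conj])]
  constructor
  · intro hx i
    have hc : IsClosed {x : Hil n × Hil n | ⟪u i, x.2⟫_ℂ = lam i * ⟪u i, x.1⟫_ℂ} :=
      isClosed_eq (by fun_prop) (by fun_prop)
    refine (closure_minimal ?_ hc) hx
    intro y hy
    obtain ⟨φ, rfl⟩ := mem_graph_schwartzOp.mp hy
    exact hsymm i φ
  · intro hx
    have h1 := u.hasSum_repr x.1
    have h2 := u.hasSum_repr x.2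
    simp only [u.repr_apply_apply, hx] at h1 h2
    refine mem_closure_of_tendsto (h1.prodMk h2) (Eventually.of_forall fun s => ?_)
    refine SetLike.mem_coe.mpr (Submodule.sum_mem _ fun i _ => ?_)
    refine mem_graph_schwartzOp.mpr ⟨⟪u i, x.1⟫_ℂ • k i, ?_⟩
    rw [map_smul, map_smul, map_smul, hA, map_smul, ← hk, smul_smul, mul_comm]

/-- The value `max s 0` freezes the family at the identity for negative times, which keeps the
multipliers in the unit disc for every real `s`. -/
theorem isSemigroupGeneratedBy_diagOp (hre : ∀ i, (lam i).re ≤ 0)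
    (hc : ∀ (s : ℝ) (i : I), ‖Complex.exp ((max s 0 : ℝ) * lam i)‖ ≤ 1) :
    IsSemigroupGeneratedBy (closedOp n A)
      (fun s => diagOp u (fun i => Complex.exp ((max s 0 : ℝ) * lam i)) (hc s)) := by
  refine isSemigroupGeneratedBy_of_complex ?_ ?_ ?_ ?_
  · apply clm_ext_hilbertBasis u
    intro i
    rw [diagOp_apply_basis]
    simp
  · intro s t hs ht
    apply clm_ext_hilbertBasis u
    intro i
    change _ = diagOp u _ (hc s) (diagOp u _ (hc t) (u i))
    rw [diagOp_apply_basis, diagOp_apply_basis, map_smul, diagOp_apply_basis, smul_smul, ← Complex.exp_add, max_eq_left hs, max_eq_left ht,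
      max_eq_left (add_nonneg hs ht)]
    congr 2
    push_cast
    ring
  · intro v
    refine Continuous.continuousOn ?_
    rw [continuous_iff_continuousAt]
    intro s
    refine tendsto_diagOp u (fun s i => Complex.exp ((max s 0 : ℝ) * lam i)) hc _ (hc s) ?_ v
    intro i
    have : Continuous (fun s : ℝ => Complex.exp ((max s 0 : ℝ) * lam i)) := by fun_prop
    exact this.tendsto s
  · intro v w
    rw [mem_graph_closedOp_iff u hk hA hsymm]
    have hlim : ∀ a : ℂ, Tendsto (fun s : ℝ => (s : ℂ)⁻¹ * (Complex.exp ((max s 0 : ℝ) * a) - 1))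
        (𝓝[>] 0) (𝓝 a) := by
      intro a
      have hd : HasDerivAt (fun s : ℝ => Complex.exp (s * a)) a 0 := by
        have h1 : HasDerivAt (fun s : ℝ => (s : ℂ) * a) (1 * a) 0 :=
          (Complex.ofRealCLM.hasDerivAt).mul_const a
        simpa using h1.cexp
      have h2 := (hasDerivAt_iff_tendsto_slope_zero.mp hd).mono_left
        (nhdsWithin_mono 0 (fun x (hx : 0 < x) => hx.ne'))
      refine h2.congr' ?_
      filter_upwards [self_mem_nhdsWithin] with s hs
      rw [max_eq_left (le_of_lt hs)]
      simp
    constructor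
    · intro h i
      have h1 : Tendsto (fun s : ℝ => ⟪u i, (s : ℂ)⁻¹ • (diagOp u
          (fun i => Complex.exp ((max s 0 : ℝ) * lam i)) (hc s) v - v)⟫_ℂ) (𝓝[>] 0)
          (𝓝 ⟪u i, w⟫_ℂ) := 
        ((continuous_const.inner continuous_id).tendsto w).comp h
      have h2 := (hlim (lam i)).mul_const ⟪u i, v⟫_ℂ
      refine tendsto_nhds_unique h1 (h2.congr fun s => ?_)
      rw [inner_smul_right, inner_sub_right, inner_diagOp]
      ring
    · intro h
      -- The difference quotient at `v` is rewritten as a bounded multiplier applied to `w`, whose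
      -- coordinates are `lam i` times those of `v`. Where `lam i = 0` the coordinate of `w`
      -- vanishes, so the convention `x / 0 = 0` does no harm.
      have hc1 : ∀ (s : ℝ) i,
          ‖((s : ℂ)⁻¹ * (Complex.exp ((max s 0 : ℝ) * lam i) - 1)) / lam i‖ ≤ 1 := by
        intro s i
        rcases le_or_gt s 0 with hs | hs
        · simp [max_eq_right hs]
        · rw [max_eq_left hs.le]
          have h1 := norm_exp_sub_one_le_of_re_nonpos (z := s * lam i) (by
            simpa using mul_nonpos_of_nonneg_of_nonpos hs.le (hre i))
          rw [norm_div, norm_mul, norm_inv]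
          refine div_le_one_of_le₀ ?_ (norm_nonneg _)
          rw [norm_mul] at h1
          rwa [inv_mul_le_iff₀ (by simpa using hs.ne')]
      have hc0 : ∀ i, ‖lam i / lam i‖ ≤ 1 := by
        intro i
        rcases eq_or_ne (lam i) 0 with h0 | h0
        · simp [h0]
        · simp [div_self h0]
      have ht := tendsto_diagOp u (l := 𝓝[>] 0)
        (fun s i => ((s : ℂ)⁻¹ * (Complex.exp ((max s 0 : ℝ) * lam i) - 1)) / lam i) hc1
        (fun i => lam i / lam i) hc0 (fun i => (hlim (lam i)).div_const _) w
      have hw : diagOp u (fun i => lam i / lam i) hc0 w = w := by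
        apply hilbertBasis_ext u
        intro i
        rw [inner_diagOp, h i]
        rcases eq_or_ne (lam i) 0 with h0 | h0
        · simp [h0]
        · rw [div_self h0, one_mul]
      rw [hw] at ht
      refine ht.congr fun s => ?_
      apply hilbertBasis_ext u
      intro i
      rw [inner_smul_right, inner_sub_right, inner_diagOp, inner_diagOp, h i]
      rcases eq_or_ne (lam i) 0 with h0 | h0
      · simp [h0]
      · rw [← mul_assoc, div_mul_cancel₀ _ h0]
        ring

/-- The exponential of an operator with an eigenbasis of Schwartz functions. -/
theorem expOp_eq_diagOp (hre : ∀ i, (lam i).re ≤ 0)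
    (hc : ∀ i : I, ‖Complex.exp (lam i)‖ ≤ 1) :
    expOp (closedOp n A) = diagOp u (fun i => Complex.exp (lam i)) hc := by
  have hc' : ∀ (s : ℝ) (i : I), ‖Complex.exp ((max s 0 : ℝ) * lam i)‖ ≤ 1 := by
    intro s i
    rw [Complex.norm_exp, Real.exp_le_one_iff]
    simpa using mul_nonpos_of_nonneg_of_nonpos (le_max_right s 0) (hre i)
  have hex : ∃ S : ℝ → Hil n →L[ℂ] Hil n, IsSemigroupGeneratedBy (closedOp n A) S :=
    ⟨_, isSemigroupGeneratedBy_diagOp u hk hA hsymm hre hc'⟩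
  rw [expOp, dif_pos hex]
  have hS := hex.choose_spec
  generalize hex.choose = S at hS
  apply clm_ext_hilbertBasis u
  intro i
  rw [diagOp_apply_basis]
  refine hS.apply_one_of_eigenvector ?_
  rw [mem_graph_closedOp_iff u hk hA hsymm]
  intro j
  rw [inner_smul_right]
  by_cases h : j = i
  · rw [h]
  · rw [u.orthonormal.inner_eq_zero h, mul_zero, mul_zero]

end Closure

/-! ### Traces of nuclear operators. -/

section Trace

variable {E I J : Type} [NormedAddCommGroup E] [InnerProductSpace ℂ E]

theorem sum_norm_inner_mul_inner_le (e : HilbertBasis J ℂ E) (a b : E) (s : Finset J) :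
    ∑ j ∈ s, ‖⟪a, e j⟫_ℂ * ⟪e j, b⟫_ℂ‖ ≤ ‖a‖ * ‖b‖ := by
  have h1 : ∀ v : E, ∑ j ∈ s, ‖⟪e j, v⟫_ℂ‖ ^ 2 ≤ ‖v‖ ^ 2 := fun v =>
    sum_le_hasSum s (fun _ _ => sq_nonneg _) (hasSum_norm_inner_sq e v)
  calc ∑ j ∈ s, ‖⟪a, e j⟫_ℂ * ⟪e j, b⟫_ℂ‖ = ∑ j ∈ s, ‖⟪e j, a⟫_ℂ‖ * ‖⟪e j, b⟫_ℂ‖ := by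
        refine Finset.sum_congr rfl fun j _ => ?_
        rw [norm_mul, norm_inner_symm]
    _ ≤ √(∑ j ∈ s, ‖⟪e j, a⟫_ℂ‖ ^ 2) * √(∑ j ∈ s, ‖⟪e j, b⟫_ℂ‖ ^ 2) :=
        Real.sum_mul_le_sqrt_mul_sqrt s _ _
    _ ≤ ‖a‖ * ‖b‖ := by
        gcongr
        · exact Real.sqrt_le_iff.mpr ⟨norm_nonneg _, h1 a⟩
        · exact Real.sqrt_le_iff.mpr ⟨norm_nonneg _, h1 b⟩

/-- Fubini for the double family `⟪a i, e j⟫ * ⟪e j, b i⟫`, absolutely summable by Cauchy–Schwarz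
and Parseval. The right side does not involve `e`, so the unspecified basis in `trace` never has to
be known. -/
theorem hasSum_trace_of_nuclear (e : HilbertBasis J ℂ E) {T : E →L[ℂ] E} (a b : I → E)
    (hs : Summable fun i => ‖a i‖ * ‖b i‖) (hT : ∀ v, HasSum (fun i => ⟪a i, v⟫_ℂ • b i) (T v)) :
    ∑' j, ⟪e j, T (e j)⟫_ℂ = ∑' i, ⟪a i, b i⟫_ℂ := by
  have h1 : ∀ j, ⟪e j, T (e j)⟫_ℂ = ∑' i, ⟪a i, e j⟫_ℂ * ⟪e j, b i⟫_ℂ := by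
    intro j
    have := (hT (e j)).mapL (innerSL ℂ (e j))
    simp only [innerSL_apply_apply, inner_smul_right] at this
    exact this.tsum_eq.symm
  have h2 : ∀ i, Summable fun j => ‖⟪a i, e j⟫_ℂ * ⟪e j, b i⟫_ℂ‖ := fun i =>
    summable_of_sum_le (fun _ => norm_nonneg _) (sum_norm_inner_mul_inner_le e (a i) (b i))
  have h3 : Summable fun x : I × J => ‖⟪a x.1, e x.2⟫_ℂ * ⟪e x.2, b x.1⟫_ℂ‖ := by
    rw [summable_prod_of_nonneg (fun _ => norm_nonneg _)]
    refine ⟨h2, hs.of_nonneg_of_le (fun _ => tsum_nonneg fun _ => norm_nonneg _) fun i => ?_⟩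
    exact (h2 i).tsum_le_of_sum_le (sum_norm_inner_mul_inner_le e (a i) (b i))
  simp only [h1]
  rw [Summable.tsum_comm (f := fun i j => ⟪a i, e j⟫_ℂ * ⟪e j, b i⟫_ℂ) h3.of_norm]
  exact tsum_congr fun i => e.tsum_inner_mul_inner (a i) (b i)

theorem trace_of_nuclear [CompleteSpace E] {T : E →L[ℂ] E} (a b : I → E)
    (hs : Summable fun i => ‖a i‖ * ‖b i‖) (hT : ∀ v, HasSum (fun i => ⟪a i, v⟫_ℂ • b i) (T v)) :
    trace T = ∑' i, ⟪a i, b i⟫_ℂ := by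
  obtain ⟨e, he⟩ := (exists_hilbertBasis ℂ E).choose_spec
  rw [← hasSum_trace_of_nuclear e a b hs hT, trace]
  refine tsum_congr fun i => ?_
  rw [he]

/-- The definition asks for sequences indexed by `ℕ`; a countable family is transported along its
encoding and filled up with zeros. -/
theorem isTraceClass_of_nuclear [CompleteSpace E] [Encodable I] {T : E →L[ℂ] E} (a b : I → E)
    (hs : Summable fun i => ‖a i‖ * ‖b i‖) (hT : ∀ v, HasSum (fun i => ⟪a i, v⟫_ℂ • b i) (T v)) :
    IsTraceClass T := by
  have hinj := Encodable.encode_injective (α := I)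
  refine ⟨Function.extend Encodable.encode a 0, Function.extend Encodable.encode b 0, ?_, ?_⟩
  · rw [← hinj.summable_iff]
    · simpa [Function.comp_def, hinj.extend_apply] using hs
    · intro k hk
      simp [Function.extend_apply' _ _ _ (fun ⟨i, hi⟩ => hk ⟨i, hi⟩)]
  · intro v
    rw [← hinj.hasSum_iff]
    · simpa [Function.comp_def, hinj.extend_apply] using hT v
    · intro k hk
      simp [Function.extend_apply' _ _ _ (fun ⟨i, hi⟩ => hk ⟨i, hi⟩)]

theorem IsTraceClassProduct.unique [CompleteSpace E] {ρ : E →L[ℂ] E} {a : E →ₗ.[ℂ] E}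
    {T T' : E →L[ℂ] E} (h : IsTraceClassProduct ρ a T) (h' : IsTraceClassProduct ρ a T') :
    T = T' := by
  ext v
  exact a.mem_graph_snd_inj (h.2 v) (h'.2 v) rfl

theorem expectation_eq_trace [CompleteSpace E] {ρ : E →L[ℂ] E} {a : E →ₗ.[ℂ] E}
    {T : E →L[ℂ] E} (h : IsTraceClassProduct ρ a T) : expectation ρ a = trace T := by
  have hex : HasExpectation ρ a := ⟨T, h⟩
  rw [expectation, dif_pos hex, hex.choose_spec.unique h]

end Trace

/-! ### The number basis from the canonical commutation relations. -/

section Fock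

theorem pi_nat_induction {d : ℕ} {p : (Fin d → ℕ) → Prop} (zero : p 0)
    (succ : ∀ α k, p α → p (α + Pi.single k 1)) (α : Fin d → ℕ) : p α := by
  induction h : ∑ k, α k generalizing α with
  | zero =>
    have : α = 0 := by
      ext k
      simpa using (Finset.sum_eq_zero_iff.mp h) k (Finset.mem_univ k)
    rwa [this]
  | succ m ih =>
    obtain ⟨k, -, hk⟩ := Finset.exists_ne_zero_of_sum_ne_zero (by rw [h]; exact Nat.succ_ne_zero m)
    have hle : Pi.single k 1 ≤ α := by
      intro j
      rcases eq_or_ne j k with rfl | hj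
      · simpa using Nat.one_le_iff_ne_zero.mpr hk
      · simp [Pi.single_eq_of_ne hj]
    have he : α = (α - Pi.single k 1) + Pi.single k 1 := (tsub_add_cancel_of_le hle).symm
    rw [he]
    apply succ
    apply ih
    have h2 : ∑ j, α j = ∑ j, (α - Pi.single k 1 : Fin d → ℕ) j + ∑ j, (Pi.single k 1 : Fin d → ℕ) j := by
      rw [← Finset.sum_add_distrib]
      exact Finset.sum_congr rfl fun j _ => congrFun he j
    rw [Finset.sum_pi_single' k 1, if_pos (Finset.mem_univ k)] at h2
    omega

variable {E S : Type} [NormedAddCommGroup E] [InnerProductSpace ℂ E] [AddCommGroup S] [Module ℂ S]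
  {d : ℕ} {ι : S →ₗ[ℂ] E} {b bd : Fin d → Module.End ℂ S} {vac : S}

/-- Annihilation operators `b k` and creation operators `bd k` on a space `S` of nice vectors,
satisfying the canonical commutation relations, with a cyclic vacuum vector. -/
structure IsFock (ι : S →ₗ[ℂ] E) (b bd : Fin d → Module.End ℂ S) (vac : S) : Prop where
  injective : Function.Injective ι
  comm : ∀ j k, b j * bd k = bd k * b j + if j = k then 1 else 0
  comm_bd : ∀ j k, Commute (bd j) (bd k)
  adj : ∀ k f g, ⟪ι (b k f), ι g⟫_ℂ = ⟪ι f, ι (bd k g)⟫_ℂ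
  b_vac : ∀ k, b k vac = 0
  vac_ne_zero : vac ≠ 0
  total : ∀ V : Submodule ℂ S, vac ∈ V → (∀ k, ∀ f ∈ V, b k f ∈ V) → (∀ k, ∀ f ∈ V, bd k f ∈ V) →
    ∀ x : E, (∀ f ∈ V, ⟪ι f, x⟫_ℂ = 0) → x = 0

/-- A Hilbert basis of joint eigenvectors of the number operators. -/
structure IsFockBasis (ι : S →ₗ[ℂ] E) (b bd : Fin d → Module.End ℂ S) (kv : (Fin d → ℕ) → S)
    (u : HilbertBasis (Fin d → ℕ) ℂ E) : Prop where
  adj : ∀ k f g, ⟪ι (b k f), ι g⟫_ℂ = ⟪ι f, ι (bd k g)⟫_ℂ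
  comm_self : ∀ k f, b k (bd k f) = bd k (b k f) + f
  apply_eq : ∀ α, u α = ι (kv α)
  number : ∀ j α, bd j (b j (kv α)) = (α j : ℂ) • kv α
  raise : ∀ j α, ∃ c : ℂ, bd j (kv α) = c • kv (α + Pi.single j 1)
  lower : ∀ j α, ∃ c : ℂ, b j (kv (α + Pi.single j 1)) = c • kv α
  lower_zero : ∀ j α, α j = 0 → b j (kv α) = 0

/-- The family consists of the monomials in the commuting creation operators applied to the vacuum.
Packaging them as one homomorphism on exponents makes the raising rule an instance of
multiplicativity. -/
theorem exists_raising_family (hcomm : ∀ j k, Commute (bd j) (bd k)) (vac : S) :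
    ∃ e : (Fin d → ℕ) → S, e 0 = vac ∧ ∀ j α, bd j (e α) = e (α + Pi.single j 1) := by
  have hc : Pairwise fun i j => ∀ x y : Multiplicative ℕ,
      Commute (powersHom (Module.End ℂ S) (bd i) x) (powersHom (Module.End ℂ S) (bd j) y) := by
    intro i j _ x y
    exact (hcomm i j).pow_pow _ _
  let Φ := MonoidHom.noncommPiCoprod (fun k => powersHom (Module.End ℂ S) (bd k)) hc
  refine ⟨fun α => Φ (fun k => Multiplicative.ofAdd (α k)) vac, ?_, ?_⟩
  · have : (fun k : Fin d => Multiplicative.ofAdd ((0 : Fin d → ℕ) k)) = 1 := rfl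
    simp only [this, map_one]
    rfl
  · intro j α
    have h1 : (fun k => Multiplicative.ofAdd ((α + Pi.single j 1 : Fin d → ℕ) k))
        = Pi.mulSingle j (Multiplicative.ofAdd 1) * fun k => Multiplicative.ofAdd (α k) := by
      ext k
      rcases eq_or_ne k j with rfl | hk
      · simp [ofAdd_add, mul_comm]
      · simp [hk]
    simp only [h1, map_mul]
    have h2 : Φ (Pi.mulSingle j (Multiplicative.ofAdd 1)) = bd j := by
      rw [MonoidHom.noncommPiCoprod_mulSingle]
      simp
    rw [h2]
    rfl

namespace IsFock

variable (hF : IsFock ι b bd vac)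

include hF

theorem adj' (k : Fin d) (f g : S) : ⟪ι (bd k f), ι g⟫_ℂ = ⟪ι f, ι (b k g)⟫_ℂ := by
  rw [← inner_conj_symm, ← hF.adj, inner_conj_symm]

/-- Induction on the total degree: commuting the number operator of mode `j` past a creation
operator adds 1 exactly when the modes agree. -/
theorem number_eq {e : (Fin d → ℕ) → S} (h0 : e 0 = vac)
    (h1 : ∀ j α, bd j (e α) = e (α + Pi.single j 1)) (j : Fin d) (α : Fin d → ℕ) :
    bd j (b j (e α)) = (α j : ℂ) • e α := by
  induction α using pi_nat_induction with
  | zero => simp [h0, hF.b_vac]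
  | succ α k ih =>
    have h2 : b j (bd k (e α)) = bd k (b j (e α)) + if j = k then e α else 0 := by
      have := congrArg (fun A : Module.End ℂ S => A (e α)) (hF.comm j k)
      simp only [LinearMap.add_apply, Module.End.mul_apply] at this
      rw [this]
      split_ifs <;> rfl
    have h3 : bd j (bd k (b j (e α))) = bd k (bd j (b j (e α))) :=
      congrArg (fun A : Module.End ℂ S => A (b j (e α))) (hF.comm_bd j k).eq
    rw [← h1, h2, map_add, h3, ih, map_smul]
    rcases eq_or_ne j k with rfl | hk
    · simp [add_smul]
    · simp [hk]

/-- Orthogonality and nonvanishing are algebraic consequences of the commutation relations;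
completeness comes from `total`, because the span of the monomials is stable under all ladder
operators. -/
theorem exists_basis [CompleteSpace E] :
    ∃ (kv : (Fin d → ℕ) → S) (u : HilbertBasis (Fin d → ℕ) ℂ E), IsFockBasis ι b bd kv u := by
  obtain ⟨e, h0, h1⟩ := exists_raising_family hF.comm_bd vac
  have hN := hF.number_eq h0 h1
  have hcs : ∀ k f, b k (bd k f) = bd k (b k f) + f := by
    intro k f
    have := congrArg (fun A : Module.End ℂ S => A f) (hF.comm k k)
    simpa using this
  have hlow : ∀ j α, b j (e (α + Pi.single j 1)) = ((α j : ℂ) + 1) • e α := by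
    intro j α
    rw [← h1, hcs, hN, add_smul, one_smul]
  have hlow0 : ∀ j α, α j = 0 → b j (e α) = 0 := by
    intro j α h
    apply hF.injective
    rw [map_zero, ← inner_self_eq_zero (𝕜 := ℂ), hF.adj, hN, h]
    simp
  have hne : ∀ α, ι (e α) ≠ 0 := by
    intro α
    induction α using pi_nat_induction with
    | zero => rw [h0]; exact fun h => hF.vac_ne_zero (hF.injective (h.trans (map_zero ι).symm))
    | succ α k ih =>
      intro h
      have h2 : ⟪ι (e (α + Pi.single k 1)), ι (e (α + Pi.single k 1))⟫_ℂ = 0 := by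
        rw [h, inner_zero_left]
      -- The squared norm of a raised vector is `α k + 1` times that of the vector, so it cannot
      -- vanish.
      rw [← h1, hF.adj', hcs, hN, show (α k : ℂ) • e α + e α = ((α k : ℂ) + 1) • e α by rw [add_smul, one_smul],
        map_smul, inner_smul_right, mul_eq_zero] at h2
      rcases h2 with h2 | h2
      · exact Nat.cast_add_one_ne_zero (α k) h2
      · exact ih (inner_self_eq_zero.mp h2)
  have horth : ∀ α β, α ≠ β → ⟪ι (e α), ι (e β)⟫_ℂ = 0 := by
    intro α β hαβ
    -- The number operator of a mode `j` where the indices differ is symmetric and has distinct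
    -- eigenvalues on the two vectors.
    obtain ⟨j, hj⟩ := Function.ne_iff.mp hαβ
    have h2 : ⟪ι (bd j (b j (e α))), ι (e β)⟫_ℂ = ⟪ι (e α), ι (bd j (b j (e β)))⟫_ℂ := by
      rw [hF.adj', hF.adj]
    rw [hN, hN, map_smul, map_smul, inner_smul_left, inner_smul_right, ← sub_eq_zero,
      ← sub_mul, mul_eq_zero] at h2
    rcases h2 with h2 | h2
    · rw [Complex.conj_natCast, sub_eq_zero] at h2
      exact absurd (Nat.cast_injective h2) hj
    · exact h2
  let nr : (Fin d → ℕ) → ℂ := fun α => (‖ι (e α)‖ : ℂ)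
  have hnr : ∀ α, nr α ≠ 0 := fun α => by
    simpa [nr] using hne α
  let kv : (Fin d → ℕ) → S := fun α => (nr α)⁻¹ • e α
  have hek : ∀ α, e α = nr α • kv α := fun α => by
    simp only [kv]
    rw [smul_inv_smul₀ (hnr α)]
  have horthn : Orthonormal ℂ fun α => ι (kv α) := by
    constructor
    · intro α
      simp only [kv, map_smul, norm_smul, nr, norm_inv, Complex.norm_real, norm_norm]
      exact inv_mul_cancel₀ (norm_ne_zero_iff.mpr (hne α))
    · intro α β h
      simp only [kv, map_smul, inner_smul_left, inner_smul_right, horth α β h, mul_zero]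
  have hspan : (Submodule.span ℂ (Set.range fun α => ι (kv α)))ᗮ = ⊥ := by
    rw [Submodule.eq_bot_iff]
    intro x hx
    have hsp : ∀ (A : Module.End ℂ S), (∀ α, A (e α) ∈ Submodule.span ℂ (Set.range e)) →
        ∀ f ∈ Submodule.span ℂ (Set.range e), A f ∈ Submodule.span ℂ (Set.range e) := by
      intro A hA f hf
      have : Submodule.span ℂ (Set.range e) ≤ (Submodule.span ℂ (Set.range e)).comap A := by
        rw [Submodule.span_le]
        rintro _ ⟨α, rfl⟩
        exact hA α
      exact this hf
    refine hF.total (Submodule.span ℂ (Set.range e)) (Submodule.subset_span ⟨0, h0⟩) ?_ ?_ x ?_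
    · intro k
      refine hsp _ fun α => ?_
      by_cases h : α k = 0
      · rw [hlow0 k α h]
        exact Submodule.zero_mem _
      · have hle : Pi.single k 1 ≤ α := by
          intro j
          rcases eq_or_ne j k with rfl | hj
          · simpa using Nat.one_le_iff_ne_zero.mpr h
          · simp [Pi.single_eq_of_ne hj]
        rw [← tsub_add_cancel_of_le hle, hlow]
        exact Submodule.smul_mem _ _ (Submodule.subset_span ⟨_, rfl⟩)
    · intro k
      refine hsp _ fun α => ?_
      rw [h1]
      exact Submodule.subset_span ⟨_, rfl⟩
    · intro f hf
      induction hf using Submodule.span_induction with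
      | mem y hy =>
        obtain ⟨α, rfl⟩ := hy
        rw [hek, map_smul, inner_smul_left,
          (Submodule.mem_orthogonal _ _).mp hx _ (Submodule.subset_span ⟨α, rfl⟩), mul_zero]
      | zero => simp
      | add y z _ _ hy hz => rw [map_add, inner_add_left, hy, hz, add_zero]
      | smul a y _ hy => rw [map_smul, inner_smul_left, hy, mul_zero]
  refine ⟨kv, HilbertBasis.mkOfOrthogonalEqBot horthn hspan, hF.adj, hcs, ?_, ?_, ?_, ?_, ?_⟩
  · intro α
    rw [HilbertBasis.coe_mkOfOrthogonalEqBot]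
  · intro j α
    simp only [kv, map_smul, hN]
    rw [smul_comm]
  · intro j α
    refine ⟨(nr α)⁻¹ * nr (α + Pi.single j 1), ?_⟩
    rw [mul_smul, ← hek, ← h1, ← map_smul]
  · intro j α
    refine ⟨(nr (α + Pi.single j 1))⁻¹ * (((α j : ℂ) + 1) * nr α), ?_⟩
    rw [mul_smul, mul_smul, ← hek, ← hlow, ← map_smul]
  · intro j α h
    simp only [kv, map_smul, hlow0 j α h, smul_zero]

end IsFock

end Fock

/-! ### Linear combinations of ladder operators in the number basis. -/

section Ladder

variable {E S : Type} [NormedAddCommGroup E] [InnerProductSpace ℂ E] [AddCommGroup S] [Module ℂ S]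
  {d : ℕ} {ι : S →ₗ[ℂ] E} {b bd : Fin d → Module.End ℂ S} {kv : (Fin d → ℕ) → S}
  {u : HilbertBasis (Fin d → ℕ) ℂ E}

/-- A linear combination of annihilation and creation operators. -/
def ladderComb (b bd : Fin d → Module.End ℂ S) (γ δ : Fin d → ℂ) : Module.End ℂ S :=
  ∑ k, (γ k • b k + δ k • bd k)

/-- The Hamiltonian of independent oscillators with frequencies `ω`. -/
def oscillator (b bd : Fin d → Module.End ℂ S) (ω : Fin d → ℝ) (e₀ : ℝ) : Module.End ℂ S :=
  ∑ k, (ω k : ℂ) • (bd k * b k) + (e₀ : ℂ) • 1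

/-- The eigenvalues of `oscillator`. -/
def energyLevel (ω : Fin d → ℝ) (e₀ : ℝ) (α : Fin d → ℕ) : ℝ := ∑ k, ω k * α k + e₀

theorem energyLevel_nonneg {ω : Fin d → ℝ} {e₀ : ℝ} (hω : ∀ k, 0 ≤ ω k) (he : 0 ≤ e₀)
    (α : Fin d → ℕ) : 0 ≤ energyLevel ω e₀ α :=
  add_nonneg (Finset.sum_nonneg fun k _ => mul_nonneg (hω k) (Nat.cast_nonneg _)) he

theorem energyLevel_add_single (ω : Fin d → ℝ) (e₀ : ℝ) (α : Fin d → ℕ) (j : Fin d) :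
    energyLevel ω e₀ (α + Pi.single j 1) = energyLevel ω e₀ α + ω j := by
  simp only [energyLevel, Pi.add_apply, Nat.cast_add, mul_add, Finset.sum_add_distrib]
  have : ∑ k, ω k * ((Pi.single j 1 : Fin d → ℕ) k : ℝ) = ω j := by
    rw [Finset.sum_eq_single j]
    · simp
    · intro k _ hk
      simp [hk]
    · simp
  rw [this]
  ring

theorem ladderComb_apply (γ δ : Fin d → ℂ) (f : S) :
    ladderComb b bd γ δ f = ∑ k, (γ k • b k f + δ k • bd k f) := by
  simp [ladderComb, LinearMap.sum_apply]

namespace IsFockBasis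

variable (hB : IsFockBasis ι b bd kv u)

include hB

theorem adj' (k : Fin d) (f g : S) : ⟪ι (bd k f), ι g⟫_ℂ = ⟪ι f, ι (b k g)⟫_ℂ := by
  rw [← inner_conj_symm, ← hB.adj, inner_conj_symm]

theorem inner_number (k : Fin d) (α : Fin d → ℕ) (f : S) :
    ⟪u α, ι (bd k (b k f))⟫_ℂ = α k * ⟪u α, ι f⟫_ℂ := by
  rw [hB.apply_eq, ← hB.adj, ← hB.adj', hB.number, map_smul, inner_smul_left, Complex.conj_natCast]

theorem oscillator_apply (ω : Fin d → ℝ) (e₀ : ℝ) (α : Fin d → ℕ) :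
    oscillator b bd ω e₀ (kv α) = (energyLevel ω e₀ α : ℂ) • kv α := by
  simp only [oscillator, energyLevel, LinearMap.add_apply, LinearMap.sum_apply,
    LinearMap.smul_apply, Module.End.mul_apply, hB.number, Module.End.one_apply, smul_smul]
  push_cast
  rw [← Finset.sum_smul, ← add_smul]

theorem inner_oscillator (ω : Fin d → ℝ) (e₀ : ℝ) (α : Fin d → ℕ) (f : S) :
    ⟪u α, ι (oscillator b bd ω e₀ f)⟫_ℂ = (energyLevel ω e₀ α : ℂ) * ⟪u α, ι f⟫_ℂ := by
  simp only [oscillator, energyLevel, LinearMap.add_apply, LinearMap.sum_apply,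
    LinearMap.smul_apply, Module.End.mul_apply, Module.End.one_apply, map_add, map_sum, map_smul,
    inner_add_right, inner_sum, inner_smul_right, hB.inner_number]
  push_cast
  rw [add_mul, Finset.sum_mul]
  simp only [mul_assoc]

/-- Here `‖b f‖² = ⟪f, b† b f⟫`, so ladder operators are controlled by the number operator. Since
the latter is diagonal, convergence of expansions passes to ladder operators. -/
theorem norm_lower_sq (k : Fin d) (f : S) :
    ‖ι (b k f)‖ ^ 2 ≤ ‖ι f‖ * ‖ι (bd k (b k f))‖ := by
  have h := hB.adj k f (b k f)
  rw [inner_self_eq_norm_sq_to_K] at h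
  have h2 := norm_inner_le_norm (𝕜 := ℂ) (ι f) (ι (bd k (b k f)))
  rw [← h] at h2
  simpa using h2

theorem norm_raise_sq (k : Fin d) (f : S) :
    ‖ι (bd k f)‖ ^ 2 ≤ ‖ι f‖ * ‖ι (bd k (b k f))‖ + ‖ι f‖ ^ 2 := by
  have h := hB.adj' k f (bd k f)
  rw [inner_self_eq_norm_sq_to_K, hB.comm_self, map_add] at h
  have h2 := norm_inner_le_norm (𝕜 := ℂ) (ι f) (ι (bd k (b k f)) + ι f)
  rw [← h] at h2
  have h3 : ‖ι (bd k f)‖ ^ 2 ≤ ‖ι f‖ * ‖ι (bd k (b k f)) + ι f‖ := by simpa using h2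
  have h4 := norm_add_le (ι (bd k (b k f))) (ι f)
  nlinarith [norm_nonneg (ι f)]

theorem norm_basis (α : Fin d → ℕ) : ‖ι (kv α)‖ = 1 := by
  rw [← hB.apply_eq]
  exact u.orthonormal.1 α

/-- The true size is a square root; the linear bound is enough against exponentially decaying Gibbs
weights. -/
theorem norm_lower_basis (k : Fin d) (α : Fin d → ℕ) : ‖ι (b k (kv α))‖ ≤ α k + 1 := by
  have h := hB.norm_lower_sq k (kv α)
  rw [hB.number, map_smul, norm_smul, hB.norm_basis, one_mul, mul_one, Complex.norm_natCast] at h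
  nlinarith [norm_nonneg (ι (b k (kv α))), sq_nonneg (‖ι (b k (kv α))‖ - 1)]

theorem norm_raise_basis (k : Fin d) (α : Fin d → ℕ) : ‖ι (bd k (kv α))‖ ≤ α k + 1 := by
  have h := hB.norm_raise_sq k (kv α)
  rw [hB.number, map_smul, norm_smul, hB.norm_basis, one_mul, mul_one, Complex.norm_natCast] at h
  have h1 : (1 : ℝ) ≤ α k + 1 := by
    have : (0 : ℝ) ≤ α k := Nat.cast_nonneg _
    linarith
  refine le_of_sq_le_sq ?_ (by linarith)
  nlinarith

/-- Lowering lands on a different basis vector, or on zero. This is why the ladder part of an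
observable does not contribute to its Gibbs average. -/
theorem inner_lower_basis (k : Fin d) (α : Fin d → ℕ) : ⟪u α, ι (b k (kv α))⟫_ℂ = 0 := by
  have h1 := hB.inner_number k α (b k (kv α))
  by_cases h : α k = 0
  · rw [hB.lower_zero k α h, map_zero, inner_zero_right]
  · have hle : Pi.single k 1 ≤ α := by
      intro j
      rcases eq_or_ne j k with rfl | hj
      · simpa using Nat.one_le_iff_ne_zero.mpr h
      · simp [Pi.single_eq_of_ne hj]
    obtain ⟨c, hc⟩ := hB.lower k (α - Pi.single k 1)
    rw [tsub_add_cancel_of_le hle] at hc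
    rw [hc, map_smul, inner_smul_right, ← hB.apply_eq, u.orthonormal.inner_eq_zero, mul_zero]
    intro h2
    have := congrFun h2 k
    simp at this
    omega

theorem inner_raise_basis (k : Fin d) (α : Fin d → ℕ) : ⟪u α, ι (bd k (kv α))⟫_ℂ = 0 := by
  rw [hB.apply_eq, ← hB.adj, ← inner_conj_symm, ← hB.apply_eq, hB.inner_lower_basis, map_zero]

/-- Number operators map truncations of the expansion of a nice vector to truncations. -/
theorem tendsto_truncation (f : S) (k : Fin d) :
    Tendsto (fun s : Finset (Fin d → ℕ) => ι (∑ α ∈ s, ⟪u α, ι f⟫_ℂ • kv α)) atTop (𝓝 (ι f)) ∧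
    Tendsto (fun s : Finset (Fin d → ℕ) => ι (b k (∑ α ∈ s, ⟪u α, ι f⟫_ℂ • kv α)))
      atTop (𝓝 (ι (b k f))) ∧
    Tendsto (fun s : Finset (Fin d → ℕ) => ι (bd k (∑ α ∈ s, ⟪u α, ι f⟫_ℂ • kv α)))
      atTop (𝓝 (ι (bd k f))) := by
  set t : Finset (Fin d → ℕ) → S := fun s => ∑ α ∈ s, ⟪u α, ι f⟫_ℂ • kv α with ht
  have h0 : Tendsto (fun s => ι (t s)) atTop (𝓝 (ι f)) := by
    have := u.hasSum_repr (ι f)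
    simp only [u.repr_apply_apply] at this
    refine this.congr fun s => ?_
    simp only [ht, map_sum, map_smul, hB.apply_eq]
  have hN : Tendsto (fun s => ι (bd k (b k (t s)))) atTop (𝓝 (ι (bd k (b k f)))) := by
    have := u.hasSum_repr (ι (bd k (b k f)))
    simp only [u.repr_apply_apply, hB.inner_number] at this
    refine this.congr fun s => ?_
    simp only [ht, map_sum, map_smul, hB.apply_eq, hB.number, smul_smul]
    refine Finset.sum_congr rfl fun α _ => ?_
    rw [mul_comm]
  have h0' : Tendsto (fun s => ‖ι (t s - f)‖) atTop (𝓝 0) := by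
    simpa only [map_sub] using tendsto_iff_norm_sub_tendsto_zero.mp h0
  have hN' : Tendsto (fun s => ‖ι (bd k (b k (t s - f)))‖) atTop (𝓝 0) := by
    simpa only [map_sub] using tendsto_iff_norm_sub_tendsto_zero.mp hN
  have hsq : ∀ g : Finset (Fin d → ℕ) → ℝ, (∀ s, 0 ≤ g s) → Tendsto (fun s => g s ^ 2) atTop (𝓝 0) →
      Tendsto g atTop (𝓝 0) := by
    intro g hg h
    have := h.sqrt
    simpa only [Real.sqrt_sq (hg _), Real.sqrt_zero] using this
  refine ⟨h0, ?_, ?_⟩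
  · rw [tendsto_iff_norm_sub_tendsto_zero]
    refine hsq _ (fun _ => norm_nonneg _) ?_
    have h := h0'.mul hN'
    rw [zero_mul] at h
    refine squeeze_zero (fun _ => sq_nonneg _) (fun s => ?_) h
    rw [← map_sub, ← map_sub]
    exact hB.norm_lower_sq k _
  · rw [tendsto_iff_norm_sub_tendsto_zero]
    refine hsq _ (fun _ => norm_nonneg _) ?_
    have h := (h0'.mul hN').add (h0'.pow 2)
    rw [zero_mul, zero_pow two_ne_zero, zero_add] at h
    refine squeeze_zero (fun _ => sq_nonneg _) (fun s => ?_) h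
    rw [← map_sub, ← map_sub]
    exact hB.norm_raise_sq k _

theorem tendsto_ladderComb_truncation (γ δ : Fin d → ℂ) (f : S) :
    Tendsto (fun s : Finset (Fin d → ℕ) => ι (ladderComb b bd γ δ (∑ α ∈ s, ⟪u α, ι f⟫_ℂ • kv α)))
      atTop (𝓝 (ι (ladderComb b bd γ δ f))) := by
  have key : ∀ g, ι (ladderComb b bd γ δ g) = ∑ k, (γ k • ι (b k g) + δ k • ι (bd k g)) := by
    intro g
    rw [ladderComb_apply, map_sum]
    simp only [map_add, map_smul]
  simp only [key]
  apply tendsto_finsetSum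
  intro k _
  obtain ⟨-, h1, h2⟩ := hB.tendsto_truncation f k
  exact (h1.const_smul _).add (h2.const_smul _)

theorem tendsto_truncation_self (f : S) :
    Tendsto (fun s : Finset (Fin d → ℕ) => ι (∑ α ∈ s, ⟪u α, ι f⟫_ℂ • kv α)) atTop (𝓝 (ι f)) := by
  have := u.hasSum_repr (ι f)
  simp only [u.repr_apply_apply] at this
  refine this.congr fun s => ?_
  simp only [map_sum, map_smul, hB.apply_eq]

/-- The formal adjoint exchanges and conjugates the coefficients. Being defined on every basis
vector, it makes ladder combinations closable through `graph_closedOp`. -/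
theorem inner_ladderComb (γ δ : Fin d → ℂ) (α : Fin d → ℕ) (f : S) :
    ⟪u α, ι (ladderComb b bd γ δ f)⟫_ℂ = ⟪ι (ladderComb b bd (fun k => starRingEnd ℂ (δ k))
      (fun k => starRingEnd ℂ (γ k)) (kv α)), ι f⟫_ℂ := by
  simp only [ladderComb_apply, map_sum, map_add, map_smul, inner_sum, sum_inner, inner_add_left,
    inner_add_right, inner_smul_left, inner_smul_right, Complex.conj_conj, hB.apply_eq, hB.adj,
    hB.adj']
  exact Finset.sum_congr rfl fun k _ => add_comm _ _

theorem inner_ladderComb_basis (γ δ : Fin d → ℂ) (α : Fin d → ℕ) :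
    ⟪u α, ι (ladderComb b bd γ δ (kv α))⟫_ℂ = 0 := by
  simp [ladderComb_apply, hB.inner_lower_basis, hB.inner_raise_basis]

theorem norm_ladderComb_basis_le (γ δ : Fin d → ℂ) (α : Fin d → ℕ) :
    ‖ι (ladderComb b bd γ δ (kv α))‖ ≤ (∑ k, (‖γ k‖ + ‖δ k‖)) * ∏ k, ((α k : ℝ) + 1) := by
  have hp : ∀ k, (α k : ℝ) + 1 ≤ ∏ k, ((α k : ℝ) + 1) := by
    intro k
    rw [← Finset.mul_prod_erase _ _ (Finset.mem_univ k)]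
    refine le_mul_of_one_le_right (by positivity) ?_
    rw [← Finset.prod_const_one (s := Finset.univ.erase k)]
    exact Finset.prod_le_prod (fun _ _ => zero_le_one) (fun j _ => by simp)
  rw [ladderComb_apply, map_sum, Finset.sum_mul]
  refine norm_sum_le_of_le _ fun k _ => ?_
  rw [map_add, map_smul, map_smul, add_mul]
  refine (norm_add_le _ _).trans ?_
  rw [norm_smul, norm_smul]
  gcongr
  · exact (hB.norm_lower_basis k α).trans (hp k)
  · exact (hB.norm_raise_basis k α).trans (hp k)

/-- Diagonal phases `exp (-i τ λ)` intertwine a linear combination of ladder operators with its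
Heisenberg evolution. -/
theorem phase_ladderComb (ω : Fin d → ℝ) (e₀ τ : ℝ) {U : E →L[ℂ] E}
    (hU : ∀ α, U (u α) = Complex.exp (-(Complex.I * τ) * energyLevel ω e₀ α) • u α)
    (γ δ : Fin d → ℂ) (α : Fin d → ℕ) :
    U (ι (ladderComb b bd (fun k => γ k * Complex.exp (-(Complex.I * τ) * ω k))
      (fun k => δ k * Complex.exp (Complex.I * τ * ω k)) (kv α)))
    = Complex.exp (-(Complex.I * τ) * energyLevel ω e₀ α) • ι (ladderComb b bd γ δ (kv α)) := by
  -- Lowering mode `k` decreases the energy by `ω k`, which is compensated by the phase attached to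
  -- `b k`.
  have hlow : ∀ k, Complex.exp (-(Complex.I * τ) * ω k) • U (ι (b k (kv α)))
      = Complex.exp (-(Complex.I * τ) * energyLevel ω e₀ α) • ι (b k (kv α)) := by
    intro k
    by_cases h : α k = 0
    · simp [hB.lower_zero k α h]
    · have hle : Pi.single k 1 ≤ α := by
        intro j
        rcases eq_or_ne j k with rfl | hj
        · simpa using Nat.one_le_iff_ne_zero.mpr h
        · simp [Pi.single_eq_of_ne hj]
      obtain ⟨c, hc⟩ := hB.lower k (α - Pi.single k 1)
      have he := energyLevel_add_single ω e₀ (α - Pi.single k 1) k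
      rw [tsub_add_cancel_of_le hle] at hc he
      rw [hc, map_smul, map_smul, ← hB.apply_eq, hU, he, smul_comm c, smul_smul, ← Complex.exp_add]
      congr 2
      push_cast
      ring
  have hraise : ∀ k, Complex.exp (Complex.I * τ * ω k) • U (ι (bd k (kv α)))
      = Complex.exp (-(Complex.I * τ) * energyLevel ω e₀ α) • ι (bd k (kv α)) := by
    intro k
    obtain ⟨c, hc⟩ := hB.raise k α
    rw [hc, map_smul, map_smul, ← hB.apply_eq, hU, energyLevel_add_single, smul_comm c, smul_smul,
      ← Complex.exp_add]
    congr 2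
    push_cast
    ring
  simp only [ladderComb_apply, map_sum, map_add, map_smul, Finset.smul_sum, smul_add, mul_smul,
    hlow, hraise]
  refine Finset.sum_congr rfl fun k _ => ?_
  rw [smul_comm _ (γ k), smul_comm _ (δ k)]

end IsFockBasis

end Ladder

/-! ### Summability of Gibbs weights. -/

section Summability

theorem summable_prod_pi {d : ℕ} {f : Fin d → ℕ → ℝ} (hf : ∀ k i, 0 ≤ f k i)
    (hs : ∀ k, Summable (f k)) : Summable fun α : Fin d → ℕ => ∏ k, f k (α k) := by
  induction d with
  | zero => exact Summable.of_finite
  | succ d ih =>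
    rw [← (Fin.consEquiv fun _ => ℕ).summable_iff]
    have h := (hs 0).mul_of_nonneg (ih (fun k => hf k.succ) fun k => hs k.succ) (hf 0)
      (fun α => Finset.prod_nonneg fun k _ => hf k.succ _)
    refine h.congr fun x => ?_
    simp [Fin.prod_univ_succ, Fin.consEquiv]

/-- The sum factorizes over modes into convergent one-dimensional series. The polynomial factor
leaves room for the growth of ladder operators on the basis. -/
theorem summable_exp_energyLevel {d : ℕ} {ω : Fin d → ℝ} (hω : ∀ k, 0 < ω k) (e₀ : ℝ) :
    Summable fun α : Fin d → ℕ => Real.exp (-energyLevel ω e₀ α) * ∏ k, ((α k : ℝ) + 1) := by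
  have h1 : ∀ k, Summable fun i : ℕ => ((i : ℝ) + 1) * Real.exp (-ω k * i) := by
    intro k
    have h2 := Real.summable_pow_mul_exp_neg_nat_mul 1 (hω k)
    have h3 := Real.summable_pow_mul_exp_neg_nat_mul 0 (hω k)
    refine (h2.add h3).congr fun i => ?_
    rw [pow_one, pow_zero]
    ring
  have h4 := (summable_prod_pi (fun k i => by positivity) h1).mul_left (Real.exp (-e₀))
  refine h4.congr fun α => ?_
  rw [Finset.prod_mul_distrib, ← Real.exp_sum, energyLevel, neg_add, Real.exp_add,
    ← Finset.sum_neg_distrib]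
  simp only [neg_mul]
  ring

end Summability

/-! ### Existence of nuclear operators. -/

section Nuclear

variable {E I : Type} [NormedAddCommGroup E] [InnerProductSpace ℂ E] [CompleteSpace E]

theorem exists_nuclear (a b : I → E) (hs : Summable fun i => ‖a i‖ * ‖b i‖) :
    ∃ T : E →L[ℂ] E, ∀ v, HasSum (fun i => ⟪a i, v⟫_ℂ • b i) (T v) := by
  have h : Summable fun i => (innerSL ℂ (a i)).smulRight (b i) := by
    refine Summable.of_norm (hs.congr fun i => ?_)
    rw [ContinuousLinearMap.norm_smulRight_apply, innerSL_apply_norm]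
  refine ⟨∑' i, (innerSL ℂ (a i)).smulRight (b i), fun v => ?_⟩
  have := h.hasSum.mapL (ContinuousLinearMap.apply ℂ E v)
  simpa using this

end Nuclear

/-! ### Graphs of conjugated operators. -/

section Conj

theorem sum_pair_mem {H K I : Type} [AddCommGroup H] [Module ℂ H] [AddCommGroup K] [Module ℂ K]
    {G : Submodule ℂ (H × K)} {s : Finset I} {f : I → H} {g : I → K}
    (h : ∀ i ∈ s, (f i, g i) ∈ G) : (∑ i ∈ s, f i, ∑ i ∈ s, g i) ∈ G := by
  have : (∑ i ∈ s, f i, ∑ i ∈ s, g i) = ∑ i ∈ s, (f i, g i) :=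
    Prod.ext (Prod.fst_sum (s := s) (f := fun i => (f i, g i))).symm
      (Prod.snd_sum (s := s) (f := fun i => (f i, g i))).symm
  rw [this]
  exact Submodule.sum_mem _ h

variable {H : Type} [NormedAddCommGroup H] [InnerProductSpace ℂ H]

/-- Membership is checked on the intertwined pair, before applying `V`, so that closures are taken
in the graph of `a` alone. -/
theorem mem_graph_conjOp {V U : H →L[ℂ] H} (hVU : V * U = 1) {a : H →ₗ.[ℂ] H} {x y : H}
    (h : (U x, U y) ∈ a.graph) : (x, y) ∈ (conjOp V a U).graph := by
  obtain ⟨z, hz1, hz2⟩ := a.mem_graph_iff.mp h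
  have hx : U x ∈ a.domain := by
    rw [show U x = (z : H) from hz1.symm]
    exact z.2
  have hy : a ⟨U x, hx⟩ = U y := by
    rw [← show a z = U y from hz2]
    exact congrArg a (Subtype.ext hz1.symm)
  rw [LinearPMap.mem_graph_iff]
  refine ⟨⟨x, hx⟩, rfl, ?_⟩
  have h1 : conjOp V a U ⟨x, hx⟩ = V (a ⟨U x, hx⟩) := rfl
  rw [h1, hy]
  exact congrArg (fun B : H →L[ℂ] H => B y) hVU

end Conj

/-! ### Gibbs averages of Heisenberg-evolved linear observables. -/

section Heisenberg

variable {n d : ℕ} {b bd : Fin d → Module.End ℂ 𝓢(Conf n, ℂ)} {kv : (Fin d → ℕ) → 𝓢(Conf n, ℂ)}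
  {u : HilbertBasis (Fin d → ℕ) ℂ (Hil n)}

theorem IsFockBasis.expOp_smul (hB : IsFockBasis (incl n) b bd kv u) (ω : Fin d → ℝ) (e₀ : ℝ)
    (z : ℂ) (hz : ∀ α, (z * energyLevel ω e₀ α).re ≤ 0) :
    ∃ hc, expOp (closedOp n (z • oscillator b bd ω e₀))
      = diagOp u (fun α => Complex.exp (z * energyLevel ω e₀ α)) hc := by
  have hc : ∀ α : Fin d → ℕ, ‖Complex.exp (z * energyLevel ω e₀ α)‖ ≤ 1 := by
    intro α
    rw [Complex.norm_exp, Real.exp_le_one_iff]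
    exact hz α
  refine ⟨hc, expOp_eq_diagOp u hB.apply_eq (lam := fun α => z * energyLevel ω e₀ α) ?_ ?_ hz hc⟩
  · intro α
    rw [LinearMap.smul_apply, hB.oscillator_apply, smul_smul]
  · intro α f
    rw [LinearMap.smul_apply, map_smul, inner_smul_right, hB.inner_oscillator, mul_assoc]

/-- The Heisenberg evolution of a linear combination of ladder operators, on the Schwartz space. -/
theorem IsFockBasis.closure_le_graph_conjOp (hB : IsFockBasis (incl n) b bd kv u) (ω : Fin d → ℝ)
    (e₀ τ : ℝ) (γ δ : Fin d → ℂ) {x : Hil n × Hil n}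
    (hx : x ∈ (schwartzOp n (ladderComb b bd (fun k => γ k * Complex.exp (-(Complex.I * τ) * ω k))
      (fun k => δ k * Complex.exp (Complex.I * τ * ω k)))).graph.topologicalClosure) :
    x ∈ (conjOp (expOp (closedOp n ((Complex.I * τ) • oscillator b bd ω e₀)))
      (closedOp n (ladderComb b bd γ δ))
      (expOp (closedOp n ((-(Complex.I * τ)) • oscillator b bd ω e₀)))).graph := by
  obtain ⟨hc, hV⟩ := hB.expOp_smul ω e₀ (Complex.I * τ) (by simp)
  obtain ⟨hc', hU⟩ := hB.expOp_smul ω e₀ (-(Complex.I * τ)) (by simp)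
  rw [hV, hU]
  have hVU : diagOp u _ hc * diagOp u _ hc' = 1 := by
    apply clm_ext_hilbertBasis u
    intro α
    change diagOp u _ hc (diagOp u _ hc' (u α)) = u α
    rw [diagOp_apply_basis, map_smul, diagOp_apply_basis, smul_smul, ← Complex.exp_add, neg_mul,
      neg_add_cancel, Complex.exp_zero, one_smul]
  have hg := graph_closedOp u (A := ladderComb b bd γ δ) _ (hB.inner_ladderComb γ δ)
  refine mem_graph_conjOp hVU ?_
  rw [hg]
  have hcl : IsClosed {x : Hil n × Hil n | (diagOp u _ hc' x.1, diagOp u _ hc' x.2) ∈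
      (schwartzOp n (ladderComb b bd γ δ)).graph.topologicalClosure} :=
    ((schwartzOp n (ladderComb b bd γ δ)).graph.isClosed_topologicalClosure).preimage (by fun_prop)
  refine (closure_minimal ?_ hcl) hx
  intro y hy
  obtain ⟨φ, rfl⟩ := mem_graph_schwartzOp.mp hy
  -- The intertwining relation is algebraic on basis vectors only; it reaches a general Schwartz
  -- function through truncations, which converge together with their images under the ladder
  -- combination.
  refine hcl.mem_of_tendsto ((hB.tendsto_truncation_self φ).prodMk_nhds
    (hB.tendsto_ladderComb_truncation _ _ φ)) (Eventually.of_forall fun s => ?_)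
  refine Submodule.le_topologicalClosure _ ?_
  simp only [map_sum, map_smul]
  refine sum_pair_mem fun α _ => ?_
  refine mem_graph_schwartzOp.mpr
    ⟨(⟪u α, incl n φ⟫_ℂ * Complex.exp (-(Complex.I * τ) * energyLevel ω e₀ α)) • kv α, ?_⟩
  rw [hB.phase_ladderComb ω e₀ τ (fun α => diagOp_apply_basis u _ hc' α), ← hB.apply_eq,
    diagOp_apply_basis, map_smul, map_smul, map_smul, ← hB.apply_eq, smul_smul, smul_smul]

variable {b' bd' : Fin d → Module.End ℂ 𝓢(Conf n, ℂ)} {kv' : (Fin d → ℕ) → 𝓢(Conf n, ℂ)}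
  {u' : HilbertBasis (Fin d → ℕ) ℂ (Hil n)}

/-- Two bases are involved: unprimed modes diagonalize the dynamics, primed modes the state. The
evolved observable times the state has a nuclear expansion over the primed basis with exponentially
small weights. Its ladder part has zero diagonal, so after normalization only the constant `M` is
left in the trace. -/
theorem gibbs_heisenberg_expectation (hB : IsFockBasis (incl n) b bd kv u) (ω : Fin d → ℝ)
    (e₀ : ℝ) (hB' : IsFockBasis (incl n) b' bd' kv' u') (ω' : Fin d → ℝ) (e₀' : ℝ)
    (hω' : ∀ k, 0 < ω' k) (he₀' : 0 ≤ e₀') (τ : ℝ) {A : Module.End ℂ 𝓢(Conf n, ℂ)}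
    (γ δ γ' δ' : Fin d → ℂ) (M : ℂ) (hA : A = ladderComb b bd γ δ)
    (hAτ : ladderComb b bd (fun k => γ k * Complex.exp (-(Complex.I * τ) * ω k))
      (fun k => δ k * Complex.exp (Complex.I * τ * ω k)) = M • 1 + ladderComb b' bd' γ' δ') :
    HasExpectation (gibbsState (closedOp n (-oscillator b' bd' ω' e₀')))
      (conjOp (expOp (closedOp n ((Complex.I * τ) • oscillator b bd ω e₀))) (closedOp n A)
        (expOp (closedOp n ((-(Complex.I * τ)) • oscillator b bd ω e₀)))) ∧
    expectation (gibbsState (closedOp n (-oscillator b' bd' ω' e₀')))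
      (conjOp (expOp (closedOp n ((Complex.I * τ) • oscillator b bd ω e₀))) (closedOp n A)
        (expOp (closedOp n ((-(Complex.I * τ)) • oscillator b bd ω e₀)))) = M := by
  set lam := energyLevel ω' e₀'
  have hlam : ∀ α, 0 ≤ lam α := energyLevel_nonneg (fun k => (hω' k).le) he₀'
  have hsum := summable_exp_energyLevel hω' e₀'
  obtain ⟨hc, hK⟩ := hB'.expOp_smul ω' e₀' (-1) (by simpa using hlam)
  rw [neg_one_smul] at hK
  set D := expOp (closedOp n (-oscillator b' bd' ω' e₀')) with hD
  set Aτ := ladderComb b bd (fun k => γ k * Complex.exp (-(Complex.I * τ) * ω k))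
      (fun k => δ k * Complex.exp (Complex.I * τ * ω k)) with hAτd
  have hexp : ∀ α, Complex.exp (-1 * lam α) = (Real.exp (-lam α) : ℂ) := by
    intro α
    push_cast
    rw [neg_one_mul]
  have hDsum : ∀ v, HasSum (fun α => ⟪u' α, v⟫_ℂ • ((Real.exp (-lam α) : ℂ) • u' α)) (D v) := by
    intro v
    rw [hK]
    have := diagOp_hasSum u' _ hc v
    convert this using 2 with α
    rw [smul_smul, mul_comm, ← hexp]
  have hone : ∀ α : Fin d → ℕ, (1 : ℝ) ≤ ∏ k, ((α k : ℝ) + 1) := by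
    intro α
    rw [← Finset.prod_const_one (s := (Finset.univ : Finset (Fin d)))]
    exact Finset.prod_le_prod (fun _ _ => zero_le_one) (fun j _ => by simp)
  have hsum0 : Summable fun α => Real.exp (-lam α) :=
    hsum.of_nonneg_of_le (fun _ => (Real.exp_pos _).le)
      fun α => le_mul_of_one_le_right (Real.exp_pos _).le (hone α)
  have hnu : ∀ α, ‖u' α‖ = 1 := u'.orthonormal.1
  have hZ : trace D = ((∑' α, Real.exp (-lam α) : ℝ) : ℂ) := by
    rw [trace_of_nuclear (fun α => u' α) (fun α => (Real.exp (-lam α) : ℂ) • u' α) ?_ hDsum,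
      Complex.ofReal_tsum]
    · refine tsum_congr fun α => ?_
      rw [inner_smul_right, inner_self_eq_norm_sq_to_K, hnu]
      simp
    · refine hsum0.congr fun α => ?_
      rw [hnu, norm_smul, hnu, Complex.norm_real, Real.norm_of_nonneg (Real.exp_pos _).le]
      ring
  set Z : ℝ := ∑' α, Real.exp (-lam α) with hZd
  have hZpos : 0 < Z := hsum0.tsum_pos (fun _ => (Real.exp_pos _).le) 0 (Real.exp_pos _)
  set C : ℝ := ‖M‖ + ∑ k, (‖γ' k‖ + ‖δ' k‖)
  have hbound : ∀ α, ‖incl n (Aτ (kv' α))‖ ≤ C * ∏ k, ((α k : ℝ) + 1) := by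
    intro α
    rw [hAτ, LinearMap.add_apply, LinearMap.smul_apply, Module.End.one_apply, map_add, map_smul,
      add_mul]
    refine (norm_add_le _ _).trans (add_le_add ?_ (hB'.norm_ladderComb_basis_le γ' δ' α))
    rw [norm_smul, hB'.norm_basis, mul_one]
    exact le_mul_of_one_le_right (norm_nonneg _) (hone α)
  have hnuc : Summable fun α => ‖u' α‖ * ‖((Z⁻¹ * Real.exp (-lam α) : ℝ) : ℂ) •
      incl n (Aτ (kv' α))‖ := by
    refine (hsum.mul_left (Z⁻¹ * C)).of_nonneg_of_le (fun _ => by positivity) fun α => ?_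
    rw [hnu, one_mul, norm_smul, Complex.norm_real, Real.norm_of_nonneg (by positivity)]
    calc Z⁻¹ * Real.exp (-lam α) * ‖incl n (Aτ (kv' α))‖
        ≤ Z⁻¹ * Real.exp (-lam α) * (C * ∏ k, ((α k : ℝ) + 1)) := by
          gcongr
          exact hbound α
      _ = _ := by ring
  obtain ⟨T, hT⟩ := exists_nuclear _ _ hnuc
  have hprod : IsTraceClassProduct (gibbsState (closedOp n (-oscillator b' bd' ω' e₀')))
      (conjOp (expOp (closedOp n ((Complex.I * τ) • oscillator b bd ω e₀))) (closedOp n A)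
        (expOp (closedOp n ((-(Complex.I * τ)) • oscillator b bd ω e₀)))) T := by
    refine ⟨isTraceClass_of_nuclear _ _ hnuc hT, fun v => ?_⟩
    rw [hA]
    refine hB.closure_le_graph_conjOp ω e₀ τ γ δ ?_
    rw [← hAτd]
    have h1 : HasSum (fun α => ((Z : ℂ)⁻¹) • (⟪u' α, v⟫_ℂ • ((Real.exp (-lam α) : ℂ) • u' α)))
        (gibbsState (closedOp n (-oscillator b' bd' ω' e₀')) v) := by
      rw [gibbsState, ← hD, hZ]
      exact (hDsum v).const_smul _
    -- Partial sums of the two expansions are pairs in the Schwartz graph, so their limit lies in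
    -- its closure; this makes the product everywhere defined.
    refine mem_closure_of_tendsto (h1.prodMk (hT v)) (Eventually.of_forall fun s => ?_)
    refine SetLike.mem_coe.mpr (Submodule.sum_mem _ fun α _ => ?_)
    refine mem_graph_schwartzOp.mpr
      ⟨(⟪u' α, v⟫_ℂ * ((Z⁻¹ * Real.exp (-lam α) : ℝ) : ℂ)) • kv' α, ?_⟩
    rw [map_smul, map_smul, map_smul, ← hB'.apply_eq, smul_smul, smul_smul, smul_smul]
    congr 2
    push_cast
    ring
  refine ⟨⟨T, hprod⟩, ?_⟩
  rw [expectation_eq_trace hprod, trace_of_nuclear _ _ hnuc hT]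
  have h2 : ∀ α, ⟪u' α, ((Z⁻¹ * Real.exp (-lam α) : ℝ) : ℂ) • incl n (Aτ (kv' α))⟫_ℂ
      = M * Z⁻¹ * ((Real.exp (-lam α) : ℝ) : ℂ) := by
    intro α
    rw [hAτ, LinearMap.add_apply, LinearMap.smul_apply, Module.End.one_apply, map_add, map_smul,
      inner_smul_right, inner_add_right, inner_smul_right, hB'.inner_ladderComb_basis,
      ← hB'.apply_eq, inner_self_eq_norm_sq_to_K, hnu]
    push_cast
    simp
    ring
  simp only [h2]
  rw [tsum_mul_left, ← Complex.ofReal_tsum, ← hZd, mul_assoc, Complex.ofReal_inv,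
    inv_mul_cancel₀ (by exact_mod_cast hZpos.ne'), mul_one]

end Heisenberg

/-! ### Coordinates and derivatives on the Schwartz space. -/

section SchwartzOps

variable {n : ℕ}

/-- Multiplication by the coordinate `ξ i`. -/
def posOp (i : Fin (n - 1)) : Module.End ℂ 𝓢(Conf n, ℂ) :=
  (SchwartzMap.smulLeftCLM ℂ (fun ξ : Conf n => ((ξ i : ℝ) : ℂ))).toLinearMap

/-- The partial derivative in the direction `i`. -/
def derOp (i : Fin (n - 1)) : Module.End ℂ 𝓢(Conf n, ℂ) :=
  (LineDeriv.lineDerivOpCLM ℂ 𝓢(Conf n, ℂ)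
    (EuclideanSpace.single i (1 : ℝ) : Conf n)).toLinearMap

theorem hasTemperateGrowth_coord (i : Fin (n - 1)) :
    (fun ξ : Conf n => ((ξ i : ℝ) : ℂ)).HasTemperateGrowth :=
  (Complex.ofRealCLM.comp (EuclideanSpace.proj i : Conf n →L[ℝ] ℝ)).hasTemperateGrowth

theorem posOp_apply (i : Fin (n - 1)) (f : 𝓢(Conf n, ℂ)) (ξ : Conf n) :
    posOp i f ξ = (ξ i : ℂ) * f ξ :=
  SchwartzMap.smulLeftCLM_apply_apply (hasTemperateGrowth_coord i) f ξ

theorem derOp_apply (i : Fin (n - 1)) (f : 𝓢(Conf n, ℂ)) (ξ : Conf n) :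
    derOp i f ξ = fderiv ℝ f ξ (EuclideanSpace.single i 1) := rfl

theorem commute_posOp (i j : Fin (n - 1)) : Commute (posOp i) (posOp (n := n) j) := by
  ext f ξ
  simp only [Module.End.mul_apply, posOp_apply]
  ring

theorem commute_derOp (i j : Fin (n - 1)) : Commute (derOp i) (derOp (n := n) j) := by
  have key : ∀ (i j : Fin (n - 1)) (f : 𝓢(Conf n, ℂ)) ξ, derOp i (derOp j f) ξ =
      fderiv ℝ (fderiv ℝ f) ξ (EuclideanSpace.single i 1) (EuclideanSpace.single j 1) := by
    intro i j f ξ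
    rw [derOp_apply]
    have h1 : (derOp j f : Conf n → ℂ) = fun ξ => fderiv ℝ f ξ (EuclideanSpace.single j 1) := rfl
    have h2 : DifferentiableAt ℝ (fderiv ℝ f) ξ :=
      ((f.smooth 2).fderiv_right (m := 1) (by norm_num)).differentiable (by norm_num) ξ
    rw [h1, fderiv_clm_apply h2 (by fun_prop)]
    simp
  ext f ξ
  simp only [Module.End.mul_apply, key]
  exact ((f.smooth 2).contDiffAt (x := ξ)).isSymmSndFDerivAt (by simp) _ _

theorem derOp_mul_posOp (i j : Fin (n - 1)) :
    derOp i * posOp j = posOp (n := n) j * derOp i + if i = j then 1 else 0 := by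
  ext f ξ
  have h1 : (posOp j f : Conf n → ℂ) = fun ξ => ((ξ j : ℝ) : ℂ) * f ξ :=
    funext fun ξ => posOp_apply j f ξ
  have hd : HasFDerivAt (fun ξ : Conf n => ((ξ j : ℝ) : ℂ))
      (Complex.ofRealCLM.comp (EuclideanSpace.proj j : Conf n →L[ℝ] ℝ)) ξ :=
    (Complex.ofRealCLM.comp (EuclideanSpace.proj j : Conf n →L[ℝ] ℝ)).hasFDerivAt
  have h2 : fderiv ℝ (fun ξ : Conf n => ((ξ j : ℝ) : ℂ) * f ξ) ξ = _ :=
    (hd.mul (f.hasFDerivAt ξ)).fderiv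
  simp only [Module.End.mul_apply, LinearMap.add_apply, _root_.add_apply, posOp_apply]
  rw [derOp_apply, h1, h2, derOp_apply]
  by_cases h : i = j
  · subst h
    simp
  · simp [h, Ne.symm h]

theorem inner_incl (f g : 𝓢(Conf n, ℂ)) :
    ⟪incl n f, incl n g⟫_ℂ = ∫ ξ, starRingEnd ℂ (f ξ) * g ξ := by
  have := SchwartzMap.inner_toL2_toL2_eq f g (volume : Measure (Conf n))
  refine this.trans ?_
  refine integral_congr_ae (Eventually.of_forall fun ξ => ?_)
  simp [mul_comm]

theorem inner_posOp (i : Fin (n - 1)) (f g : 𝓢(Conf n, ℂ)) :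
    ⟪incl n (posOp i f), incl n g⟫_ℂ = ⟪incl n f, incl n (posOp i g)⟫_ℂ := by
  rw [inner_incl, inner_incl]
  refine integral_congr_ae (Eventually.of_forall fun ξ => ?_)
  simp only [posOp_apply, map_mul, Complex.conj_ofReal]
  ring

theorem inner_derOp (i : Fin (n - 1)) (f g : 𝓢(Conf n, ℂ)) :
    ⟪incl n (derOp i f), incl n g⟫_ℂ = -⟪incl n f, incl n (derOp i g)⟫_ℂ := by
  rw [inner_incl, inner_incl]
  have h := SchwartzMap.integral_bilinear_lineDerivOp_right_eq_neg_left
    (μ := (volume : Measure (Conf n)))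
    (SchwartzMap.postcompCLM (𝕜 := ℝ) Complex.conjCLE.toContinuousLinearMap f) g
    (ContinuousLinearMap.mul ℝ ℂ) (EuclideanSpace.single i 1)
  have h1 : ∀ ξ, LineDeriv.lineDerivOp (EuclideanSpace.single i (1 : ℝ) : Conf n)
      (SchwartzMap.postcompCLM (𝕜 := ℝ) Complex.conjCLE.toContinuousLinearMap f) ξ
      = starRingEnd ℂ (derOp i f ξ) := by
    intro ξ
    have h2 : HasFDerivAt (SchwartzMap.postcompCLM (𝕜 := ℝ)
        Complex.conjCLE.toContinuousLinearMap f) _ ξ :=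
      (Complex.conjCLE.toContinuousLinearMap.hasFDerivAt).comp ξ (f.hasFDerivAt ξ)
    rw [SchwartzMap.lineDerivOp_apply_eq_fderiv, h2.fderiv]
    rfl
  simp only [h1] at h
  rw [← neg_eq_iff_eq_neg] at h
  exact h.symm

end SchwartzOps

/-! ### Gaussians as Schwartz functions. -/

section Gaussian

theorem hasTemperateGrowth_exp_mul_I :
    (fun x : ℝ => Complex.exp (x * Complex.I)).HasTemperateGrowth := by
  have hd : ∀ n : ℕ, iteratedDeriv n (fun x : ℝ => Complex.exp (x * Complex.I))
      = fun x : ℝ => Complex.I ^ n * Complex.exp (x * Complex.I) := by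
    intro n
    induction n with
    | zero => simp
    | succ n ih =>
      rw [iteratedDeriv_succ, ih]
      ext x
      have h := ((Complex.ofRealCLM.hasDerivAt (x := x)).mul_const Complex.I).cexp.const_mul
        (Complex.I ^ n)
      refine h.deriv.trans ?_
      simp
      ring
  refine ⟨(Complex.ofRealCLM.contDiff.mul contDiff_const).cexp, fun n => ⟨0, 1, fun x => ?_⟩⟩
  rw [norm_iteratedFDeriv_eq_norm_iteratedDeriv, hd, norm_mul, norm_pow, Complex.norm_I,
    Complex.norm_exp_ofReal_mul_I]
  simp

variable {V : Type} [NormedAddCommGroup V] [InnerProductSpace ℝ V]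

/-- Leibniz bound for the inner product of the identity with itself; the binomial coefficients add
up to `2 ^ k`. It feeds the chain-rule estimate for the Gaussian. -/
theorem norm_iteratedFDeriv_norm_sq_le (k : ℕ) (x : V) :
    ‖iteratedFDeriv ℝ k (fun y : V => ‖y‖ ^ 2) x‖ ≤ 2 ^ k * (1 + ‖x‖ ^ 2) := by
  have hid : ∀ i, ‖iteratedFDeriv ℝ i (fun y : V => y) x‖ ≤ max 1 ‖x‖ := by
    intro i
    match i with
    | 0 => simp
    | 1 =>
      rw [← norm_iteratedFDeriv_fderiv, norm_iteratedFDeriv_zero, fderiv_fun_id]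
      exact ContinuousLinearMap.norm_id_le.trans (le_max_left _ _)
    | i + 2 =>
      have h0 : fderiv ℝ (fun y : V => y) = fun _ => ContinuousLinearMap.id ℝ V := by
        ext1 y
        exact fderiv_fun_id
      rw [← norm_iteratedFDeriv_fderiv, h0, iteratedFDeriv_succ_const]
      simp
  have h := ContinuousLinearMap.norm_iteratedFDeriv_le_of_bilinear_of_le_one (innerSL ℝ (E := V))
    (f := fun y : V => y) (g := fun y => y) (N := ⊤) contDiff_id contDiff_id x (n := k) le_top
    (norm_innerSL_le ℝ)
  have he : (fun y : V => innerSL ℝ y y) = fun y => ‖y‖ ^ 2 := by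
    ext y
    rw [innerSL_apply_apply, real_inner_self_eq_norm_sq]
  rw [he] at h
  refine h.trans ?_
  have hm : max 1 ‖x‖ * max 1 ‖x‖ ≤ 1 + ‖x‖ ^ 2 := by
    rcases max_cases 1 ‖x‖ with ⟨h, -⟩ | ⟨h, -⟩ <;> rw [h] <;> nlinarith [sq_nonneg ‖x‖]
  calc ∑ i ∈ Finset.range (k + 1), (k.choose i : ℝ) * ‖iteratedFDeriv ℝ i (fun y : V => y) x‖ *
        ‖iteratedFDeriv ℝ (k - i) (fun y : V => y) x‖
      ≤ ∑ i ∈ Finset.range (k + 1), (k.choose i : ℝ) * (1 + ‖x‖ ^ 2) := by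
        refine Finset.sum_le_sum fun i _ => ?_
        rw [mul_assoc]
        refine mul_le_mul_of_nonneg_left ?_ (Nat.cast_nonneg _)
        exact (mul_le_mul (hid i) (hid _) (norm_nonneg _) (by positivity)).trans hm
    _ = 2 ^ k * (1 + ‖x‖ ^ 2) := by
        rw [← Finset.sum_mul]
        congr 1
        exact_mod_cast Nat.sum_range_choose k

/-- The standard Gaussian, as a Schwartz function. -/
def gaussianSchwartz (V : Type) [NormedAddCommGroup V] [InnerProductSpace ℝ V] : 𝓢(V, ℝ) where
  toFun x := Real.exp ((-1 / 2) * ‖x‖ ^ 2)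
  smooth' := by
    have := contDiff_norm_sq ℝ (E := V) (n := ((⊤ : ℕ∞) : WithTop ℕ∞))
    fun_prop
  decay' := by
    intro k n
    -- The chain-rule bound contributes `n! (2 s) ^ n`, and the remaining power of `s = 1 + ‖x‖ ^ 2`
    -- is absorbed by `exp (s / 2)` through one term of the exponential series.
    refine ⟨n.factorial * 2 ^ n * ((k + n).factorial * (2 ^ (k + n) * Real.exp (1 / 2))), fun x => ?_⟩
    set s := 1 + ‖x‖ ^ 2 with hs
    have hs1 : 1 ≤ s := by nlinarith [sq_nonneg ‖x‖]
    have hsn : ‖x‖ ≤ s := by nlinarith [sq_nonneg (‖x‖ - 1), sq_nonneg ‖x‖]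
    have h := norm_iteratedFDeriv_comp_le (𝕜 := ℝ) (g := fun u : ℝ => Real.exp ((-1 / 2) * u))
      (f := fun y : V => ‖y‖ ^ 2) (n := n) (N := ((⊤ : ℕ∞) : WithTop ℕ∞)) (by fun_prop)
      (contDiff_norm_sq ℝ) (by exact_mod_cast le_top) x
      (C := Real.exp ((-1 / 2) * ‖x‖ ^ 2)) (D := 2 * s) ?_ ?_
    · have h3 : s ^ (k + n) * Real.exp ((-1 / 2) * ‖x‖ ^ 2)
          ≤ (k + n).factorial * (2 ^ (k + n) * Real.exp (1 / 2)) := by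
        have h4 := Real.pow_div_factorial_le_exp (s / 2) (by linarith) (k + n)
        rw [div_le_iff₀ (by positivity), div_pow, div_le_iff₀ (by positivity)] at h4
        have h5 : Real.exp (s / 2) * Real.exp ((-1 / 2) * ‖x‖ ^ 2) = Real.exp (1 / 2) := by
          rw [← Real.exp_add]
          congr 1
          rw [hs]
          ring
        calc s ^ (k + n) * Real.exp ((-1 / 2) * ‖x‖ ^ 2)
            ≤ Real.exp (s / 2) * (k + n).factorial * 2 ^ (k + n) *
              Real.exp ((-1 / 2) * ‖x‖ ^ 2) := by gcongr
          _ = (k + n).factorial * (2 ^ (k + n) *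
              (Real.exp (s / 2) * Real.exp ((-1 / 2) * ‖x‖ ^ 2))) := by ring
          _ = _ := by rw [h5]
      calc ‖x‖ ^ k * ‖iteratedFDeriv ℝ n (fun x : V => Real.exp ((-1 / 2) * ‖x‖ ^ 2)) x‖
          ≤ s ^ k * (n.factorial * Real.exp ((-1 / 2) * ‖x‖ ^ 2) * (2 * s) ^ n) := by
            gcongr
            exact h
        _ = n.factorial * 2 ^ n * (s ^ (k + n) * Real.exp ((-1 / 2) * ‖x‖ ^ 2)) := by
            rw [mul_pow, pow_add]
            ring
        _ ≤ _ := by gcongr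
    · intro i _
      rw [norm_iteratedFDeriv_eq_norm_iteratedDeriv, iteratedDeriv_exp_const_mul, norm_mul,
        norm_pow, Real.norm_of_nonneg (Real.exp_pos _).le]
      refine mul_le_of_le_one_left (Real.exp_pos _).le (pow_le_one₀ (norm_nonneg _) ?_)
      norm_num
    · intro i hi _
      refine (norm_iteratedFDeriv_norm_sq_le i x).trans ?_
      rw [mul_pow]
      gcongr
      exact le_self_pow₀ hs1 (by omega)

end Gaussian

/-! ### Ladder operators of the normal modes and their vacuum. -/

section NormalModes

/-- The commutator of two operators. -/
def opComm {S : Type} [AddCommGroup S] [Module ℂ S] :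
    Module.End ℂ S →ₗ[ℂ] Module.End ℂ S →ₗ[ℂ] Module.End ℂ S :=
  LinearMap.mul ℂ (Module.End ℂ S) - (LinearMap.mul ℂ (Module.End ℂ S)).flip

theorem opComm_apply {S : Type} [AddCommGroup S] [Module ℂ S] (A B : Module.End ℂ S) :
    opComm A B = A * B - B * A := rfl

theorem opComm_one_left {S : Type} [AddCommGroup S] [Module ℂ S] (A : Module.End ℂ S) :
    opComm 1 A = 0 := by
  rw [opComm_apply, one_mul, mul_one, sub_self]

theorem opComm_one_right {S : Type} [AddCommGroup S] [Module ℂ S] (A : Module.End ℂ S) :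
    opComm A 1 = 0 := by
  rw [opComm_apply, one_mul, mul_one, sub_self]

theorem opComm_skew {S : Type} [AddCommGroup S] [Module ℂ S] (A B : Module.End ℂ S) :
    opComm A B = -opComm B A := by
  rw [opComm_apply, opComm_apply, neg_sub]

variable {n : ℕ}

/-- The momentum operator `-i ∂/∂ξ i`. -/
def momOp (i : Fin (n - 1)) : Module.End ℂ 𝓢(Conf n, ℂ) := (-Complex.I) • derOp i

theorem opComm_posOp_posOp (i j : Fin (n - 1)) : opComm (posOp (n := n) i) (posOp j) = 0 := by
  rw [opComm_apply, (commute_posOp i j).eq, sub_self]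

theorem opComm_momOp_momOp (i j : Fin (n - 1)) : opComm (momOp (n := n) i) (momOp j) = 0 := by
  simp only [momOp, map_smul, LinearMap.smul_apply]
  rw [opComm_apply, (commute_derOp i j).eq, sub_self, smul_zero,
    smul_zero]

theorem opComm_momOp_posOp (i j : Fin (n - 1)) :
    opComm (momOp (n := n) i) (posOp j) = if i = j then (-Complex.I) • 1 else 0 := by
  rw [momOp, map_smul, LinearMap.smul_apply, opComm_apply, derOp_mul_posOp, add_sub_cancel_left]
  split_ifs <;> simp

theorem opComm_posOp_momOp (i j : Fin (n - 1)) :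
    opComm (posOp (n := n) i) (momOp j) = if i = j then Complex.I • 1 else 0 := by
  rw [opComm_skew, opComm_momOp_posOp]
  by_cases h : i = j
  · simp [h]
  · simp [h, Ne.symm h]

theorem inner_momOp (i : Fin (n - 1)) (f g : 𝓢(Conf n, ℂ)) :
    ⟪incl n (momOp i f), incl n g⟫_ℂ = ⟪incl n f, incl n (momOp i g)⟫_ℂ := by
  simp only [momOp, LinearMap.smul_apply, map_smul, inner_smul_left, inner_smul_right, inner_derOp]
  simp

variable (X Y : Matrix (Fin (n - 1)) (Fin (n - 1)) ℝ) (c θ : Fin (n - 1) → ℝ)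

/-- The position operators of the normal modes. -/
def modePos (k : Fin (n - 1)) : Module.End ℂ 𝓢(Conf n, ℂ) :=
  ∑ i, (Y k i : ℂ) • (posOp i - (c i : ℂ) • 1)

/-- The momentum operators of the normal modes. -/
def modeMom (k : Fin (n - 1)) : Module.End ℂ 𝓢(Conf n, ℂ) :=
  ∑ i, (X i k : ℂ) • (momOp i - (θ i : ℂ) • 1)

/-- The annihilation operators of the normal modes. -/
def lowerOp (k : Fin (n - 1)) : Module.End ℂ 𝓢(Conf n, ℂ) :=
  (√2 : ℂ)⁻¹ • (modePos Y c k + Complex.I • modeMom X θ k)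

/-- The creation operators of the normal modes. -/
def raiseOp (k : Fin (n - 1)) : Module.End ℂ 𝓢(Conf n, ℂ) :=
  (√2 : ℂ)⁻¹ • (modePos Y c k - Complex.I • modeMom X θ k)

theorem opComm_modePos_modePos (j k : Fin (n - 1)) :
    opComm (modePos (n := n) Y c j) (modePos Y c k) = 0 := by
  simp only [modePos, map_sum, LinearMap.sum_apply, map_smul, LinearMap.smul_apply, map_sub, LinearMap.sub_apply, opComm_posOp_posOp,
    opComm_one_left, opComm_one_right]
  simp

theorem opComm_modeMom_modeMom (j k : Fin (n - 1)) :
    opComm (modeMom (n := n) X θ j) (modeMom X θ k) = 0 := by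
  simp only [modeMom, map_sum, LinearMap.sum_apply, map_smul, LinearMap.smul_apply, map_sub, LinearMap.sub_apply, opComm_momOp_momOp,
    opComm_one_left, opComm_one_right]
  simp

-- Positions transform by `Y` and momenta by the transpose of its inverse, so the change of
-- variables is symplectic and preserves the commutation relations.
variable {X Y} in
theorem opComm_modePos_modeMom (hYX : Y * X = 1) (j k : Fin (n - 1)) :
    opComm (modePos (n := n) Y c j) (modeMom X θ k) = if j = k then Complex.I • 1 else 0 := by
  simp only [modePos, modeMom, map_sum, LinearMap.sum_apply, map_smul, LinearMap.smul_apply,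
    map_sub, LinearMap.sub_apply, opComm_posOp_momOp, opComm_one_left, opComm_one_right, smul_zero,
    sub_zero, smul_ite, Finset.sum_ite_eq', Finset.mem_univ, if_true]
  have h2 := congrFun (congrFun hYX j) k
  rw [Matrix.mul_apply, Matrix.one_apply] at h2
  have h3 : ∑ i, (Y j i : ℂ) * (X i k : ℂ) = if j = k then 1 else 0 := by
    have := congrArg (fun x : ℝ => (x : ℂ)) h2
    push_cast at this
    rw [this]
    split_ifs <;> simp
  have h4 : ∑ i, (X i k : ℂ) * ((Y j i : ℂ) * Complex.I) = if j = k then Complex.I else 0 := by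
    rw [show (if j = k then Complex.I else 0) = (if j = k then 1 else 0) * Complex.I by
      split_ifs <;> simp, ← h3, Finset.sum_mul]
    exact Finset.sum_congr rfl fun i _ => by ring
  simp only [Finset.sum_const_zero, smul_zero, sub_zero, smul_smul]
  rw [← Finset.sum_smul, h4]
  split_ifs <;> simp

theorem inner_modePos (k : Fin (n - 1)) (f g : 𝓢(Conf n, ℂ)) :
    ⟪incl n (modePos Y c k f), incl n g⟫_ℂ = ⟪incl n f, incl n (modePos Y c k g)⟫_ℂ := by
  simp only [modePos, LinearMap.sum_apply, LinearMap.smul_apply, LinearMap.sub_apply,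
    Module.End.one_apply, map_sum, map_sub, map_smul, sum_inner, inner_sum, inner_smul_left,
    inner_smul_right, inner_sub_left, inner_sub_right, inner_posOp, Complex.conj_ofReal]

theorem inner_modeMom (k : Fin (n - 1)) (f g : 𝓢(Conf n, ℂ)) :
    ⟪incl n (modeMom X θ k f), incl n g⟫_ℂ = ⟪incl n f, incl n (modeMom X θ k g)⟫_ℂ := by
  simp only [modeMom, LinearMap.sum_apply, LinearMap.smul_apply, LinearMap.sub_apply,
    Module.End.one_apply, map_sum, map_sub, map_smul, sum_inner, inner_sum, inner_smul_left,
    inner_smul_right, inner_sub_left, inner_sub_right, inner_momOp, Complex.conj_ofReal]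

theorem inner_lowerOp (k : Fin (n - 1)) (f g : 𝓢(Conf n, ℂ)) :
    ⟪incl n (lowerOp X Y c θ k f), incl n g⟫_ℂ = ⟪incl n f, incl n (raiseOp X Y c θ k g)⟫_ℂ := by
  simp only [lowerOp, raiseOp, LinearMap.smul_apply, LinearMap.sub_apply, LinearMap.add_apply,
    map_add, map_sub, map_smul, inner_smul_left,
    inner_smul_right, inner_add_left, inner_sub_right, inner_modePos, inner_modeMom, map_inv₀,
    Complex.conj_ofReal, Complex.conj_I]
  ring

variable {X Y} in
theorem opComm_lowerOp_raiseOp (hYX : Y * X = 1) (j k : Fin (n - 1)) :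
    opComm (lowerOp (n := n) X Y c θ j) (raiseOp X Y c θ k) = if j = k then 1 else 0 := by
  have h2 : (√2 : ℂ)⁻¹ * (√2 : ℂ)⁻¹ = 1 / 2 := by
    rw [← mul_inv, ← Complex.ofReal_mul, Real.mul_self_sqrt (by norm_num)]
    norm_num
  have h1 : opComm (modeMom (n := n) X θ j) (modePos Y c k) = if j = k then (-Complex.I) • 1 else 0 := by
    rw [opComm_skew, opComm_modePos_modeMom c θ hYX]
    by_cases h : j = k
    · simp [h]
    · simp [h, Ne.symm h]
  simp only [lowerOp, raiseOp, map_smul, LinearMap.smul_apply, map_add, map_sub, LinearMap.add_apply, opComm_modePos_modePos,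
    opComm_modeMom_modeMom, opComm_modePos_modeMom c θ hYX, h1]
  by_cases h : j = k
  · simp only [h, if_true, smul_smul]
    match_scalars
    linear_combination 2 * h2 - 2 * (√2 : ℂ)⁻¹ ^ 2 * Complex.I_sq
  · simp [h]

variable {X Y} in
theorem commute_raiseOp (hYX : Y * X = 1) (j k : Fin (n - 1)) :
    Commute (raiseOp (n := n) X Y c θ j) (raiseOp X Y c θ k) := by
  have h1 : opComm (modeMom (n := n) X θ j) (modePos Y c k) = if j = k then (-Complex.I) • 1 else 0 := by
    rw [opComm_skew, opComm_modePos_modeMom c θ hYX]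
    by_cases h : j = k
    · simp [h]
    · simp [h, Ne.symm h]
  rw [Commute, SemiconjBy, ← sub_eq_zero, ← opComm_apply]
  simp only [raiseOp, map_smul, LinearMap.smul_apply, map_sub, LinearMap.sub_apply, opComm_modePos_modePos,
    opComm_modeMom_modeMom, opComm_modePos_modeMom c θ hYX, h1]
  by_cases h : j = k
  · simp only [h, if_true]
    module
  · simp [h]

theorem hasDerivAt_exp_line {J : Type} [Fintype J] (A a : ℝ) (B y : J → ℝ) :
    HasDerivAt (fun t : ℝ => Complex.exp ((A + t * a : ℝ) * Complex.I) *
      (Real.exp ((-1 / 2) * ∑ l, (B l + t * y l) ^ 2) : ℝ))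
      ((a * Complex.I - (∑ l, B l * y l : ℝ)) * (Complex.exp ((A : ℝ) * Complex.I) *
      (Real.exp ((-1 / 2) * ∑ l, B l ^ 2) : ℝ))) 0 := by
  have hd1 : HasDerivAt (fun t : ℝ => Complex.exp ((A + t * a : ℝ) * Complex.I))
      (Complex.exp ((A + (0 : ℝ) * a : ℝ) * Complex.I) * (((1 * a : ℝ) : ℂ) * Complex.I)) 0 :=
    ((((hasDerivAt_id (0 : ℝ)).mul_const a).const_add _).ofReal_comp.mul_const _).cexp
  have hd2 : HasDerivAt (fun t : ℝ => Real.exp ((-1 / 2) * ∑ l, (B l + t * y l) ^ 2))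
      (Real.exp ((-1 / 2) * ∑ l, (B l + 0 * y l) ^ 2) *
        ((-1 / 2) * ∑ l, (2 : ℕ) * (B l + 0 * y l) ^ (2 - 1) * (1 * y l))) 0 :=
    ((HasDerivAt.fun_sum fun l _ =>
      (((hasDerivAt_id (0 : ℝ)).mul_const (y l)).const_add (B l)).fun_pow 2).const_mul (-1 / 2)).exp
  refine (hd1.fun_mul hd2.ofReal_comp).congr_deriv ?_
  have h : (-1 / 2) * ∑ l, ((2 : ℕ) : ℝ) * (B l + 0 * y l) ^ (2 - 1) * (1 * y l)
      = -∑ l, B l * y l := by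
    rw [Finset.mul_sum, ← Finset.sum_neg_distrib]
    refine Finset.sum_congr rfl fun l _ => ?_
    push_cast
    ring
  rw [h]
  simp only [zero_mul, add_zero, one_mul]
  push_cast
  ring

-- The vacuum is a coherent state: a Gaussian centred at `c`, with shape given by `Y` and a
-- plane-wave phase of momentum `θ`. It is obtained from the standard Gaussian by operations
-- preserving the Schwartz space.
variable {X Y} in
theorem exists_vacuum (hYX : Y * X = 1) : ∃ vac : 𝓢(Conf n, ℂ), ∀ ξ, vac ξ =
    Complex.exp ((∑ i, θ i * ξ i : ℝ) * Complex.I) *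
      (Real.exp ((-1 / 2) * ∑ l, (∑ i, Y l i * (ξ i - c i)) ^ 2) : ℝ) := by
  have hXY : X * Y = 1 := mul_eq_one_comm.mp hYX
  let L : Conf n ≃ₗ[ℝ] Conf n := LinearEquiv.ofLinearMap (Matrix.toEuclideanLin Y)
    (Matrix.toEuclideanLin X)
    (by ext1 x; simp [Matrix.toLpLin_apply, hYX])
    (by ext1 x; simp [Matrix.toLpLin_apply, hXY])
  let Lθ : Conf n →L[ℝ] ℝ := ∑ i, θ i • EuclideanSpace.proj i
  have hLθ : ∀ ξ, Lθ ξ = ∑ i, θ i * ξ i := by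
    intro ξ
    simp [Lθ]
  have hg : (fun ξ : Conf n => Complex.exp ((Lθ ξ : ℝ) * Complex.I)).HasTemperateGrowth :=
    hasTemperateGrowth_exp_mul_I.comp Lθ.hasTemperateGrowth
  refine ⟨SchwartzMap.smulLeftCLM ℂ (fun ξ : Conf n => Complex.exp ((Lθ ξ : ℝ) * Complex.I))
    (SchwartzMap.postcompCLM (𝕜 := ℝ) Complex.ofRealCLM
      (SchwartzMap.compSubConstCLM ℝ (WithLp.toLp 2 c)
        (SchwartzMap.compCLMOfContinuousLinearEquiv ℝ L.toContinuousLinearEquiv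
          (gaussianSchwartz (Conf n))))), fun ξ => ?_⟩
  rw [SchwartzMap.smulLeftCLM_apply_apply hg, hLθ, smul_eq_mul]
  congr 1
  rw [SchwartzMap.postcompCLM_apply, SchwartzMap.compSubConstCLM_apply]
  change ((Real.exp ((-1 / 2) * ‖L (ξ - WithLp.toLp 2 c)‖ ^ 2) : ℝ) : ℂ) = _
  rw [EuclideanSpace.real_norm_sq_eq]
  congr 4

-- With `w = Y (ξ - c)`, the operator `-i ∂ - θ` multiplies the vacuum by `i Yᵀ w`. Contracting with
-- `X` gives `i w k`, so position plus `i` times momentum cancels.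
variable {X Y} in
theorem lowerOp_vacuum (hYX : Y * X = 1) {vac : 𝓢(Conf n, ℂ)} (hvac : ∀ ξ, vac ξ =
    Complex.exp ((∑ i, θ i * ξ i : ℝ) * Complex.I) *
      (Real.exp ((-1 / 2) * ∑ l, (∑ i, Y l i * (ξ i - c i)) ^ 2) : ℝ)) (k : Fin (n - 1)) :
    lowerOp X Y c θ k vac = 0 := by
  have hder : ∀ i ξ, derOp i vac ξ =
      (θ i * Complex.I - ∑ l, (∑ j, Y l j * (ξ j - c j) : ℝ) * Y l i) * vac ξ := by
    intro i ξ
    have h1 : derOp i vac ξ = lineDeriv ℝ vac ξ (EuclideanSpace.single i 1) :=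
      SchwartzMap.lineDerivOp_apply _ _ _
    rw [h1, lineDeriv]
    have hcoord : ∀ (t : ℝ) j, (ξ + t • (EuclideanSpace.single i (1 : ℝ) : Conf n)) j
        = ξ j + if j = i then t else 0 := by
      intro t j
      by_cases h : j = i
      · subst h
        simp
      · simp [h]
    have hA : ∀ t : ℝ, ∑ j, θ j * (ξ + t • (EuclideanSpace.single i (1 : ℝ) : Conf n)) j
        = ∑ j, θ j * ξ j + t * θ i := by
      intro t
      simp only [hcoord, mul_add, Finset.sum_add_distrib]
      simp [mul_comm]
    have hB : ∀ (t : ℝ) l, ∑ j, Y l j * ((ξ + t • (EuclideanSpace.single i (1 : ℝ) : Conf n)) j - c j)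
        = ∑ j, Y l j * (ξ j - c j) + t * Y l i := by
      intro t l
      simp only [hcoord, add_sub_right_comm, mul_add, Finset.sum_add_distrib]
      simp [mul_comm]
    have hf : (fun t : ℝ => vac (ξ + t • (EuclideanSpace.single i (1 : ℝ) : Conf n))) = fun t : ℝ =>
        Complex.exp ((∑ j, θ j * ξ j + t * θ i : ℝ) * Complex.I) *
        (Real.exp ((-1 / 2) * ∑ l, (∑ j, Y l j * (ξ j - c j) + t * Y l i) ^ 2) : ℝ) := by
      ext t
      rw [hvac, hA]
      simp only [hB]
    rw [hf, hvac, (hasDerivAt_exp_line _ _ _ _).deriv]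
  have hYX' : ∀ l, ∑ i, (Y l i : ℂ) * (X i k : ℂ) = if l = k then 1 else 0 := by
    intro l
    have := congrArg (fun x : ℝ => (x : ℂ)) (congrFun (congrFun hYX l) k)
    rw [Matrix.mul_apply, Matrix.one_apply] at this
    push_cast at this
    rw [this]
    split_ifs <;> simp
  ext ξ
  simp only [lowerOp, modePos, modeMom, momOp, LinearMap.smul_apply, LinearMap.add_apply,
    LinearMap.sum_apply, LinearMap.sub_apply, Module.End.one_apply, _root_.add_apply,
    _root_.sum_apply, _root_.sub_apply, _root_.smul_apply, posOp_apply, hder, smul_eq_mul,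
    _root_.zero_apply]
  have h1 : ∑ i, (X i k : ℂ) * (-Complex.I * ((θ i * Complex.I -
      (∑ l, (∑ j, Y l j * (ξ j - c j)) * Y l i : ℝ)) * vac ξ) - θ i * vac ξ)
      = Complex.I * ∑ i, (Y k i : ℂ) * ((ξ i : ℂ) * vac ξ - c i * vac ξ) := by
    have h2 : ∀ i, (X i k : ℂ) * (-Complex.I * ((θ i * Complex.I -
        (∑ l, (∑ j, Y l j * (ξ j - c j)) * Y l i : ℝ)) * vac ξ) - θ i * vac ξ)
        = ∑ l, Complex.I * vac ξ * (∑ j, Y l j * (ξ j - c j) : ℝ) * ((Y l i : ℂ) * X i k) := by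
      intro i
      rw [show (-Complex.I * ((θ i * Complex.I -
        (∑ l, (∑ j, Y l j * (ξ j - c j)) * Y l i : ℝ)) * vac ξ) - θ i * vac ξ)
        = Complex.I * vac ξ * (∑ l, (∑ j, Y l j * (ξ j - c j)) * Y l i : ℝ) by
          linear_combination -(θ i : ℂ) * vac ξ * Complex.I_sq]
      push_cast
      rw [Finset.mul_sum, Finset.mul_sum]
      exact Finset.sum_congr rfl fun l _ => by ring
    simp only [h2]
    rw [Finset.sum_comm]
    simp only [← Finset.mul_sum, hYX']
    simp only [mul_ite, mul_one, mul_zero, Finset.sum_ite_eq', Finset.mem_univ, if_true]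
    push_cast
    rw [Finset.mul_sum, Finset.mul_sum]
    exact Finset.sum_congr rfl fun l _ => by ring
  rw [h1]
  linear_combination (√2 : ℂ)⁻¹ * (∑ i, (Y k i : ℂ) * ((ξ i : ℂ) * vac ξ - c i * vac ξ)) *
    Complex.I_sq

end NormalModes

/-! ### Completeness of the number basis. -/

section Completeness

/-- A compactly supported test function is the Fourier transform of a Schwartz function, and the
duality formula moves the transform onto `g`. -/
theorem ae_eq_zero_of_fourier_eq_zero {V : Type} [NormedAddCommGroup V] [InnerProductSpace ℝ V]
    [FiniteDimensional ℝ V] [MeasurableSpace V] [BorelSpace V] {g : V → ℂ} (hg : Integrable g)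
    (h : ∀ w, FourierTransform.fourier g w = 0) : g =ᵐ[volume] 0 := by
  apply ae_eq_zero_of_integral_contDiff_smul_eq_zero hg.locallyIntegrable
  intro φ hφ hφc
  have hg₁ : HasCompactSupport (Complex.ofRealCLM ∘ φ) := hφc.comp_left rfl
  have hg₂ : ContDiff ℝ ((⊤ : ℕ∞) : WithTop ℕ∞) (Complex.ofRealCLM ∘ φ) :=
    Complex.ofRealCLM.contDiff.comp hφ
  set ψ : 𝓢(V, ℂ) := hg₁.toSchwartzMap hg₂ with hψ
  set ψ' : 𝓢(V, ℂ) := FourierTransformInv.fourierInv ψ with hψ'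
  have h1 : FourierTransform.fourier ψ' = ψ := FourierTransform.fourier_fourierInv_eq ψ
  have h2 : ∫ v, FourierTransform.fourier (ψ' : V → ℂ) v • g v
      = ∫ v, (ψ' : V → ℂ) v • FourierTransform.fourier g v := by
    simpa using! (VectorFourier.integral_fourierIntegral_smul_eq_flip (L := innerₗ V)
      Real.continuous_fourierChar continuous_inner ψ'.integrable hg)
  rw [← SchwartzMap.fourier_coe, h1] at h2
  simp only [h, smul_zero, integral_zero] at h2
  rw [← h2]
  congr 1

/-- If all moments of an exponentially integrable function vanish, then so do its exponential
integrals. -/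
theorem integral_exp_mul_eq_zero_of_moments {V : Type} [MeasurableSpace V] {ν : Measure V}
    {g : V → ℂ} {L : V → ℝ} (hg : AEStronglyMeasurable g ν) (hL : Measurable L)
    (hint : Integrable (fun v => Real.exp |L v| * ‖g v‖) ν)
    (hmom : ∀ k : ℕ, ∫ v, (L v : ℂ) ^ k * g v ∂ν = 0) :
    ∫ v, Complex.exp (Complex.I * L v) * g v ∂ν = 0 := by
  have hs : HasSum (fun k : ℕ => ∫ v, (Complex.I * L v) ^ k / (k.factorial : ℂ) * g v ∂ν)
      (∫ v, Complex.exp (Complex.I * L v) * g v ∂ν) := by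
    apply hasSum_integral_of_dominated_convergence
      (fun k v => |L v| ^ k / k.factorial * ‖g v‖)
    · intro k
      have : Measurable fun v => (Complex.I * L v) ^ k / (k.factorial : ℂ) := by fun_prop
      exact this.aestronglyMeasurable.mul hg
    · intro k
      refine Eventually.of_forall fun v => le_of_eq ?_
      simp
    · refine Eventually.of_forall fun v => ?_
      exact ((Real.summable_pow_div_factorial |L v|).mul_right _)
    · refine hint.congr (Eventually.of_forall fun v => ?_)
      simp only [tsum_mul_right]
      congr 1
      rw [Real.exp_eq_exp_ℝ, NormedSpace.exp_eq_tsum_div]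
    · refine Eventually.of_forall fun v => ?_
      have := NormedSpace.expSeries_div_hasSum_exp (𝔸 := ℂ) (Complex.I * L v)
      rw [← Complex.exp_eq_exp_ℂ] at this
      exact this.mul_right (g v)
  have h0 : ∀ k : ℕ, ∫ v, (Complex.I * L v) ^ k / (k.factorial : ℂ) * g v ∂ν = 0 := by
    intro k
    have : ∀ v, (Complex.I * L v) ^ k / (k.factorial : ℂ) * g v =
        Complex.I ^ k / (k.factorial : ℂ) * ((L v : ℂ) ^ k * g v) := fun v => by
      rw [mul_pow]; ring
    simp only [this]
    rw [integral_const_mul, hmom, mul_zero]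
  simp only [h0] at hs
  exact hs.unique hasSum_zero

variable {n : ℕ} {X Y : Matrix (Fin (n - 1)) (Fin (n - 1)) ℝ} (c θ : Fin (n - 1) → ℝ)

theorem norm_vacuum {f : 𝓢(Conf n, ℂ)} (hvac : ∀ ξ, f ξ =
    Complex.exp ((∑ i, θ i * ξ i : ℝ) * Complex.I) *
      (Real.exp ((-1 / 2) * ∑ l, (∑ i, Y l i * (ξ i - c i)) ^ 2) : ℝ)) (ξ : Conf n) :
    ‖f ξ‖ = Real.exp ((-1 / 2) * ∑ l, (∑ i, Y l i * (ξ i - c i)) ^ 2) := by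
  rw [hvac, norm_mul, Complex.norm_exp_ofReal_mul_I, one_mul, Complex.norm_real,
    Real.norm_of_nonneg (Real.exp_pos _).le]

/-- By Young's inequality the exponential weight costs at most half of the quadratic exponent. What
is left is the wider Gaussian obtained by dividing `Y` by `√2`. -/
theorem exists_exp_mul_vacuum_le (hYX : Y * X = 1) {vac : 𝓢(Conf n, ℂ)} (hvac : ∀ ξ, vac ξ =
    Complex.exp ((∑ i, θ i * ξ i : ℝ) * Complex.I) *
      (Real.exp ((-1 / 2) * ∑ l, (∑ i, Y l i * (ξ i - c i)) ^ 2) : ℝ)) (a : Fin (n - 1) → ℝ) :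
    ∃ (C : ℝ) (vac' : 𝓢(Conf n, ℂ)), ∀ ξ : Conf n,
      Real.exp |∑ i, a i * ξ i| * ‖vac ξ‖ ≤ C * ‖vac' ξ‖ := by
  have hXY : X * Y = 1 := mul_eq_one_comm.mp hYX
  have h2 : (√2)⁻¹ * √2 = 1 := inv_mul_cancel₀ (by positivity)
  have h2' : (√2)⁻¹ ^ 2 = 1 / 2 := by
    rw [inv_pow, Real.sq_sqrt (by norm_num)]
    norm_num
  have hYX' : ((√2)⁻¹ • Y) * ((√2) • X) = 1 := by
    rw [Matrix.smul_mul, Matrix.mul_smul, hYX, smul_smul, h2, one_smul]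
  obtain ⟨vac', hvac'⟩ := exists_vacuum c θ hYX'
  set z : Fin (n - 1) → ℝ := Matrix.vecMul a X with hz
  refine ⟨Real.exp (|∑ i, a i * c i| + ∑ l, z l ^ 2), vac', fun ξ => ?_⟩
  rw [norm_vacuum c θ hvac, norm_vacuum c θ hvac', ← Real.exp_add, ← Real.exp_add,
    Real.exp_le_exp]
  set w : Fin (n - 1) → ℝ := fun l => ∑ i, Y l i * (ξ i - c i) with hw
  have hw' : ∀ l, ∑ i, ((√2)⁻¹ • Y) l i * (ξ i - c i) = (√2)⁻¹ * w l := by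
    intro l
    rw [hw, Finset.mul_sum]
    exact Finset.sum_congr rfl fun i _ => by simp [mul_assoc]
  have hL : ∑ i, a i * ξ i = ∑ i, a i * c i + ∑ l, z l * w l := by
    have e1 : ∑ l, z l * w l = ∑ i, a i * (ξ i - c i) := by
      have : w = Matrix.mulVec Y (fun i => ξ i - c i) := rfl
      change z ⬝ᵥ w = a ⬝ᵥ (fun i => ξ i - c i)
      rw [hz, ← Matrix.dotProduct_mulVec, this, Matrix.mulVec_mulVec, hXY, Matrix.one_mulVec]
    rw [e1, ← Finset.sum_add_distrib]
    exact Finset.sum_congr rfl fun i _ => by ring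
  have hb : |∑ l, z l * w l| ≤ ∑ l, z l ^ 2 + (1 / 4) * ∑ l, w l ^ 2 := by
    refine (Finset.abs_sum_le_sum_abs _ _).trans ?_
    rw [Finset.mul_sum, ← Finset.sum_add_distrib]
    refine Finset.sum_le_sum fun l _ => ?_
    rw [abs_le]
    constructor <;> nlinarith [sq_nonneg (z l + w l / 2), sq_nonneg (z l - w l / 2)]
  have hL' := abs_add_le (∑ i, a i * c i) (∑ l, z l * w l)
  rw [← hL] at hL'
  simp only [hw', mul_pow, h2', ← Finset.mul_sum]
  change _ + (-1 / 2) * ∑ l, w l ^ 2 ≤ _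
  linarith

/-- The classical argument for Hermite functions: orthogonality to all polynomials times the vacuum
makes every moment of `conj vac * x` vanish. Exponential integrability then makes its Fourier
transform vanish, and the vacuum has no zeros. -/
theorem eq_zero_of_orthogonal_posOp_stable (hYX : Y * X = 1) {vac : 𝓢(Conf n, ℂ)}
    (hvac : ∀ ξ, vac ξ = Complex.exp ((∑ i, θ i * ξ i : ℝ) * Complex.I) *
      (Real.exp ((-1 / 2) * ∑ l, (∑ i, Y l i * (ξ i - c i)) ^ 2) : ℝ))
    {V : Submodule ℂ 𝓢(Conf n, ℂ)} (hV : vac ∈ V) (hpos : ∀ i, ∀ f ∈ V, posOp i f ∈ V)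
    {x : Hil n} (hx : ∀ f ∈ V, ⟪incl n f, x⟫_ℂ = 0) : x = 0 := by
  have hinner : ∀ f : 𝓢(Conf n, ℂ), ⟪incl n f, x⟫_ℂ = ∫ ξ, starRingEnd ℂ (f ξ) * x ξ := by
    intro f
    rw [L2.inner_def]
    apply integral_congr_ae
    filter_upwards [SchwartzMap.coeFn_toLp f 2 volume] with ξ hξ
    change ⟪(f.toLp 2 volume) ξ, _⟫_ℂ = _
    rw [hξ, RCLike.inner_apply, mul_comm]
  have hint : ∀ f : 𝓢(Conf n, ℂ), Integrable (fun ξ => starRingEnd ℂ (f ξ) * x ξ) := by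
    intro f
    exact (f.memLp 2 volume).star.integrable_mul (Lp.memLp x)
  set g : Conf n → ℂ := fun ξ => starRingEnd ℂ (vac ξ) * x ξ with hg
  have hg0 : g =ᵐ[volume] 0 := by
    apply ae_eq_zero_of_fourier_eq_zero (hint vac)
    intro w
    rw [Real.fourier_eq']
    set a : Fin (n - 1) → ℝ := fun i => -2 * Real.pi * w i with ha
    have hLa : ∀ ξ : Conf n, -2 * Real.pi * ⟪ξ, w⟫_ℝ = ∑ i, a i * ξ i := by
      intro ξ
      rw [PiLp.inner_apply, Finset.mul_sum]
      refine Finset.sum_congr rfl fun i _ => ?_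
      simp [ha]
      ring
    have key := integral_exp_mul_eq_zero_of_moments (ν := volume) (g := g)
      (L := fun ξ : Conf n => ∑ i, a i * ξ i) (hint vac).aestronglyMeasurable (by fun_prop) ?_ ?_
    · rw [← key]
      refine integral_congr_ae (Eventually.of_forall fun ξ => ?_)
      simp only [hLa, smul_eq_mul, mul_comm Complex.I]
      rfl
    · obtain ⟨C, vac', hC⟩ := exists_exp_mul_vacuum_le c θ hYX hvac a
      refine Integrable.mono' (((hint vac').norm).const_mul C) ?_ (Eventually.of_forall fun ξ => ?_)
      · exact (by fun_prop : Measurable fun ξ : Conf n =>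
          Real.exp |∑ i, a i * ξ i|).aestronglyMeasurable.mul (hint vac).aestronglyMeasurable.norm
      · rw [norm_mul, norm_norm, Real.norm_of_nonneg (Real.exp_pos _).le, hg]
        simp only [norm_mul, RCLike.norm_conj]
        rw [← mul_assoc, ← mul_assoc]
        exact mul_le_mul_of_nonneg_right (hC ξ) (norm_nonneg _)
    · intro k
      set A : Module.End ℂ 𝓢(Conf n, ℂ) := ∑ i, (a i : ℂ) • posOp i with hA
      have hAV : ∀ f ∈ V, A f ∈ V := by
        intro f hf
        rw [hA, LinearMap.sum_apply]
        exact V.sum_mem fun i _ => V.smul_mem _ (hpos i f hf)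
      have hAapp : ∀ (f : 𝓢(Conf n, ℂ)) (ξ : Conf n), A f ξ = ((∑ i, a i * ξ i : ℝ) : ℂ) * f ξ := by
        intro f ξ
        rw [hA, LinearMap.sum_apply, _root_.sum_apply]
        simp only [LinearMap.smul_apply, _root_.smul_apply, posOp_apply, smul_eq_mul]
        push_cast
        rw [Finset.sum_mul]
        exact Finset.sum_congr rfl fun i _ => by ring
      have hk : ∀ k : ℕ, (A ^ k) vac ∈ V ∧
          ∀ ξ : Conf n, (A ^ k) vac ξ = ((∑ i, a i * ξ i : ℝ) : ℂ) ^ k * vac ξ := by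
        intro k
        induction k with
        | zero => simpa using hV
        | succ k ih =>
          rw [pow_succ', Module.End.mul_apply]
          refine ⟨hAV _ ih.1, fun ξ => ?_⟩
          rw [hAapp, ih.2, pow_succ']
          ring
      have := hx _ (hk k).1
      rw [hinner] at this
      rw [← this]
      refine integral_congr_ae (Eventually.of_forall fun ξ => ?_)
      simp only [(hk k).2, map_mul, map_pow, Complex.conj_ofReal, hg]
      ring
  rw [Lp.eq_zero_iff_ae_eq_zero]
  filter_upwards [hg0] with ξ hξ
  have hne : vac ξ ≠ 0 := by
    rw [← norm_pos_iff, norm_vacuum c θ hvac]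
    exact Real.exp_pos _
  simpa [hg, hne] using hξ

theorem modePos_eq (k : Fin (n - 1)) : modePos (n := n) Y c k =
    (√2 : ℂ)⁻¹ • (lowerOp X Y c θ k + raiseOp X Y c θ k) := by
  have h2 : (√2 : ℂ)⁻¹ * (√2 : ℂ)⁻¹ = 1 / 2 := by
    rw [← mul_inv, ← Complex.ofReal_mul, Real.mul_self_sqrt (by norm_num)]
    norm_num
  rw [lowerOp, raiseOp]
  match_scalars
  · linear_combination -2 * h2
  · ring

theorem modeMom_eq (k : Fin (n - 1)) : modeMom (n := n) X θ k =
    (-Complex.I * (√2 : ℂ)⁻¹) • (lowerOp X Y c θ k - raiseOp X Y c θ k) := by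
  have h2 : (√2 : ℂ)⁻¹ * (√2 : ℂ)⁻¹ = 1 / 2 := by
    rw [← mul_inv, ← Complex.ofReal_mul, Real.mul_self_sqrt (by norm_num)]
    norm_num
  rw [lowerOp, raiseOp]
  match_scalars
  · linear_combination -2 * h2 + 2 * (√2 : ℂ)⁻¹ ^ 2 * Complex.I_sq
  · ring

theorem sum_mul_cast {X Y : Matrix (Fin (n - 1)) (Fin (n - 1)) ℝ} (hXY : X * Y = 1)
    (i j : Fin (n - 1)) : ∑ k, (X i k : ℂ) * (Y k j : ℂ) = if i = j then 1 else 0 := by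
  have := congrArg (fun x : ℝ => (x : ℂ)) (congrFun (congrFun hXY i) j)
  rw [Matrix.mul_apply, Matrix.one_apply] at this
  push_cast at this
  rw [this]
  split_ifs <;> simp

theorem posOp_eq (hYX : Y * X = 1) (i : Fin (n - 1)) :
    posOp (n := n) i = (c i : ℂ) • 1 + ∑ k, (X i k : ℂ) • modePos Y c k := by
  simp only [modePos, Finset.smul_sum, smul_smul]
  rw [Finset.sum_comm]
  simp only [← Finset.sum_smul, sum_mul_cast (mul_eq_one_comm.mp hYX)]
  simp

theorem momOp_eq (hYX : Y * X = 1) (i : Fin (n - 1)) :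
    momOp (n := n) i = (θ i : ℂ) • 1 + ∑ k, (Y k i : ℂ) • modeMom X θ k := by
  simp only [modeMom, Finset.smul_sum, smul_smul]
  rw [Finset.sum_comm]
  have : ∀ j, ∑ k, (Y k i : ℂ) * (X j k : ℂ) = if j = i then 1 else 0 := by
    intro j
    rw [← sum_mul_cast (mul_eq_one_comm.mp hYX)]
    exact Finset.sum_congr rfl fun k _ => mul_comm _ _
  simp only [← Finset.sum_smul, this]
  simp

theorem isFock_of_vacuum (hYX : Y * X = 1) {vac : 𝓢(Conf n, ℂ)}
    (hvac : ∀ ξ, vac ξ = Complex.exp ((∑ i, θ i * ξ i : ℝ) * Complex.I) *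
      (Real.exp ((-1 / 2) * ∑ l, (∑ i, Y l i * (ξ i - c i)) ^ 2) : ℝ)) :
    IsFock (incl n) (lowerOp X Y c θ) (raiseOp X Y c θ) vac where
  injective := incl_injective n
  comm j k := by
    have := opComm_lowerOp_raiseOp c θ hYX j k
    rw [opComm_apply, sub_eq_iff_eq_add'] at this
    exact this
  comm_bd := commute_raiseOp c θ hYX
  adj := inner_lowerOp X Y c θ
  b_vac := lowerOp_vacuum c θ hYX hvac
  vac_ne_zero h := by
    have h1 := norm_vacuum c θ hvac 0
    rw [h, _root_.zero_apply, norm_zero] at h1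
    exact (Real.exp_pos _).ne h1
  total V hV hb hbd x hx := by
    refine eq_zero_of_orthogonal_posOp_stable c θ hYX hvac hV (fun i f hf => ?_) hx
    rw [posOp_eq c hYX, LinearMap.add_apply, LinearMap.sum_apply]
    refine V.add_mem (V.smul_mem _ hf) (V.sum_mem fun k _ => V.smul_mem _ ?_)
    rw [modePos_eq (X := X) c θ]
    exact V.smul_mem _ (V.add_mem (hb k f hf) (hbd k f hf))

theorem exists_isFockBasis (hYX : Y * X = 1) :
    ∃ kv u, IsFockBasis (incl n) (lowerOp X Y c θ) (raiseOp X Y c θ) kv u := by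
  obtain ⟨vac, hvac⟩ := exists_vacuum c θ hYX
  exact (isFock_of_vacuum c θ hYX hvac).exists_basis

end Completeness

/-! ### The chain Hamiltonian as independent oscillators. -/

section NormalForm

open Matrix in
/-- Simultaneous diagonalization of a positive kinetic form and a positive diagonal potential by
a linear symplectic change of variables. -/
theorem exists_normalModes {J : Type} [Fintype J] [DecidableEq J] {A : Matrix J J ℝ}
    (hA : A.PosDef) {b : J → ℝ} (hb : ∀ i, 0 < b i) :
    ∃ (X Y : Matrix J J ℝ) (ω : J → ℝ), (∀ k, 0 < ω k) ∧ Y * X = 1 ∧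
      Y * A * Yᵀ = diagonal ω ∧ Xᵀ * diagonal b * X = diagonal ω := by
  set s : J → ℝ := fun i => √(b i) with hs
  have hs0 : ∀ i, 0 < s i := fun i => Real.sqrt_pos.mpr (hb i)
  have hss : ∀ i, s i * s i = b i := fun i => Real.mul_self_sqrt (hb i).le
  -- The eigenvalues of this symmetrized product are the squared frequencies.
  set C : Matrix J J ℝ := diagonal s * A * diagonal s with hC
  have hinj : Function.Injective (diagonal s).mulVec := by
    apply Matrix.mulVec_injective_of_isUnit
    rw [Matrix.isUnit_iff_isUnit_det, det_diagonal, isUnit_iff_ne_zero]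
    exact Finset.prod_ne_zero_iff.mpr fun i _ => (hs0 i).ne'
  have hCpd : C.PosDef := by
    have := hA.conjTranspose_mul_mul_same (B := diagonal s) hinj
    rwa [diagonal_conjTranspose, star_trivial] at this
  have hH := hCpd.1
  set U : Matrix J J ℝ := (hH.eigenvectorUnitary : Matrix J J ℝ) with hU
  have hUU : star U * U = 1 := Unitary.coe_star_mul_self hH.eigenvectorUnitary
  have hUU' : Uᵀ * U = 1 := by
    rw [← hUU, Matrix.star_eq_conjTranspose, conjTranspose_eq_transpose_of_trivial]
  set lam := hH.eigenvalues with hlam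
  have hlam0 : ∀ k, 0 < lam k := hCpd.eigenvalues_pos
  have hspec : Uᵀ * C * U = diagonal lam := by
    have h1 : C = U * diagonal lam * Uᵀ := by
      have := hH.spectral_theorem
      rw [Unitary.conjStarAlgAut_apply] at this
      rw [← conjTranspose_eq_transpose_of_trivial, ← Matrix.star_eq_conjTranspose]
      simpa using! this
    rw [h1]
    calc Uᵀ * (U * diagonal lam * Uᵀ) * U = (Uᵀ * U) * diagonal lam * (Uᵀ * U) := by
          simp only [Matrix.mul_assoc]
      _ = _ := by rw [hUU', one_mul, mul_one]
  set ω : J → ℝ := fun k => √(lam k) with hω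
  have hω0 : ∀ k, 0 < ω k := fun k => Real.sqrt_pos.mpr (hlam0 k)
  set v : J → ℝ := fun k => √(ω k) with hv
  have hv0 : ∀ k, 0 < v k := fun k => Real.sqrt_pos.mpr (hω0 k)
  have hvv : ∀ k, v k * v k = ω k := fun k => Real.mul_self_sqrt (hω0 k).le
  have hωω : ∀ k, ω k * ω k = lam k := fun k => Real.mul_self_sqrt (hlam0 k).le
  have hss' : diagonal s * diagonal (fun i => (s i)⁻¹) = (1 : Matrix J J ℝ) := by
    rw [diagonal_mul_diagonal, ← diagonal_one]
    congr 1
    ext i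
    exact mul_inv_cancel₀ (hs0 i).ne'
  have hvv' : diagonal (fun i => (v i)⁻¹) * diagonal v = (1 : Matrix J J ℝ) := by
    rw [diagonal_mul_diagonal, ← diagonal_one]
    congr 1
    ext i
    exact inv_mul_cancel₀ (hv0 i).ne'
  -- The orthogonal diagonalization is rescaled by `v = √ω`, which gives both quadratic forms the
  -- same diagonal `ω` instead of `ω²` and 1.
  refine ⟨diagonal (fun i => (s i)⁻¹) * U * diagonal v,
    diagonal (fun i => (v i)⁻¹) * Uᵀ * diagonal s, ω, hω0, ?_, ?_, ?_⟩
  · calc diagonal (fun i => (v i)⁻¹) * Uᵀ * diagonal s *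
          (diagonal (fun i => (s i)⁻¹) * U * diagonal v)
        = diagonal (fun i => (v i)⁻¹) * (Uᵀ * ((diagonal s * diagonal (fun i => (s i)⁻¹)) * U)) *
          diagonal v := by simp only [Matrix.mul_assoc]
      _ = 1 := by rw [hss', one_mul, hUU', mul_one, hvv']
  · simp only [transpose_mul, diagonal_transpose, transpose_transpose]
    calc diagonal (fun i => (v i)⁻¹) * Uᵀ * diagonal s * A *
          (diagonal s * (U * diagonal (fun i => (v i)⁻¹)))
        = diagonal (fun i => (v i)⁻¹) * (Uᵀ * C * U) * diagonal (fun i => (v i)⁻¹) := by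
          simp only [hC, Matrix.mul_assoc]
      _ = diagonal ω := by
        rw [hspec, diagonal_mul_diagonal, diagonal_mul_diagonal]
        congr 1
        ext i
        have := (hv0 i).ne'
        rw [← hωω, ← hvv]
        field_simp
  · simp only [transpose_mul, diagonal_transpose]
    have hb' : diagonal b = diagonal s * diagonal s := by
      rw [diagonal_mul_diagonal]
      congr 1
      ext i
      exact (hss i).symm
    have hss'' : diagonal (fun i => (s i)⁻¹) * diagonal s = (1 : Matrix J J ℝ) :=
      mul_eq_one_comm.mp hss'
    rw [hb']
    calc diagonal v * (Uᵀ * diagonal (fun i => (s i)⁻¹)) * (diagonal s * diagonal s) *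
          (diagonal (fun i => (s i)⁻¹) * U * diagonal v)
        = diagonal v * (Uᵀ * ((diagonal (fun i => (s i)⁻¹) * diagonal s) *
          ((diagonal s * diagonal (fun i => (s i)⁻¹)) * U))) * diagonal v := by
          simp only [Matrix.mul_assoc]
      _ = diagonal ω := by
        rw [hss', hss'', one_mul, one_mul, hUU', mul_one, diagonal_mul_diagonal]
        congr 1
        ext i
        exact hvv i

/-- The off-diagonal products carry zero coefficients, so the operators `P k` need not commute. -/
theorem sum_smul_sq_linComb {R I J : Type} [Ring R] [Algebra ℂ R] [Fintype J] [DecidableEq J]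
    (s : Finset I) (w : I → ℂ) (z : I → J → ℂ) (ω : J → ℂ) (P : J → R)
    (h : ∀ k l, ∑ x ∈ s, w x * (z x k * z x l) = if k = l then ω k else 0) :
    ∑ x ∈ s, w x • (∑ k, z x k • P k) ^ 2 = ∑ k, ω k • P k ^ 2 := by
  have h1 : ∀ x, w x • (∑ k, z x k • P k) ^ 2
      = ∑ k, ∑ l, (w x * (z x k * z x l)) • (P k * P l) := by
    intro x
    rw [sq, Finset.sum_mul_sum, Finset.smul_sum]
    refine Finset.sum_congr rfl fun k _ => ?_
    rw [Finset.smul_sum]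
    refine Finset.sum_congr rfl fun l _ => ?_
    rw [smul_mul_smul_comm, smul_smul]
  simp only [h1]
  rw [Finset.sum_comm]
  refine Finset.sum_congr rfl fun k _ => ?_
  rw [Finset.sum_comm]
  simp only [← Finset.sum_smul, h]
  simp [sq]

variable {n : ℕ}

/-- The coefficients of the momentum `p_x` in the momenta conjugate to the elongations. -/
def chainDiff (n x : ℕ) (i : Fin (n - 1)) : ℝ :=
  (if (i : ℕ) + 2 = x then 1 else 0) - (if (i : ℕ) + 1 = x then 1 else 0)

theorem elong_succ (i : Fin (n - 1)) : elong n (i + 1) = posOp i := by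
  have : 1 ≤ (i : ℕ) + 1 ∧ (i : ℕ) + 1 < n := ⟨by omega, by omega⟩
  rw [elong, dif_pos this]
  rfl

theorem partialDeriv_eq_sum (x : ℕ) :
    partialDeriv n x = ∑ i : Fin (n - 1), (if (i : ℕ) + 1 = x then (1 : ℂ) else 0) • derOp i := by
  by_cases h : 1 ≤ x ∧ x < n
  · rw [partialDeriv, dif_pos h, Finset.sum_eq_single (⟨x - 1, by omega⟩ : Fin (n - 1))]
    · rw [if_pos (by simp; omega), one_smul]
      rfl
    · intro i _ hi
      rw [if_neg, zero_smul]
      intro hx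
      exact hi (Fin.ext (by simp; omega))
    · simp
  · rw [partialDeriv, dif_neg h]
    symm
    refine Finset.sum_eq_zero fun i _ => ?_
    rw [if_neg, zero_smul]
    intro hx
    exact h ⟨by omega, by omega⟩

theorem momentum_eq_sum {x : ℕ} (hx : 1 ≤ x) :
    momentum n x = ∑ i, (chainDiff n x i : ℂ) • momOp i := by
  rw [momentum, partialDeriv_eq_sum, partialDeriv_eq_sum, ← Finset.sum_sub_distrib,
    Finset.smul_sum]
  refine Finset.sum_congr rfl fun i _ => ?_
  have : ((i : ℕ) + 1 = x - 1) ↔ ((i : ℕ) + 2 = x) := by omega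
  simp only [momOp, chainDiff, this]
  rw [← sub_smul, smul_comm]
  congr 1
  split_ifs <;> simp

theorem sum_Icc_eq_sum_fin {M : Type} [AddCommMonoid M] (hn : 1 ≤ n) (f : ℕ → M) :
    ∑ x ∈ Finset.Icc 1 n, f x = ∑ i : Fin (n - 1), f (i + 1) + f n := by
  obtain ⟨k, rfl⟩ : ∃ k, n = k + 1 := ⟨n - 1, by omega⟩
  rw [Finset.sum_Icc_succ_top (by omega)]
  congr 1
  rw [show k + 1 - 1 = k from rfl, Fin.sum_univ_eq_sum_range (fun i => f (i + 1)) k]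
  rw [Finset.range_eq_Ico, Finset.sum_Ico_add' f 0 k 1]
  rfl

/-- The kinetic matrix of the chain. -/
def chainMatrix (n : ℕ) (w : ℕ → ℝ) : Matrix (Fin (n - 1)) (Fin (n - 1)) ℝ :=
  fun i j => ∑ x ∈ Finset.Icc 1 n, w x * (chainDiff n x i * chainDiff n x j)

/-- `chainDiff` is a discrete gradient acting on functions that vanish at both ends of the chain;
`sum_mul_chainDiff` is its transpose. -/
theorem sum_chainDiff (v : ℕ → ℝ) (hv : v 0 = 0) (hvn : ∀ x, n ≤ x → v x = 0) {x : ℕ} (hx : 1 ≤ x) :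
    ∑ i : Fin (n - 1), chainDiff n x i * v (i + 1) = v (x - 1) - v x := by
  have key : ∀ y : ℕ, ∑ i : Fin (n - 1), (if (i : ℕ) + 1 = y then (1 : ℝ) else 0) * v (i + 1)
      = v y := by
    intro y
    by_cases h : 1 ≤ y ∧ y < n
    · rw [Finset.sum_eq_single (⟨y - 1, by omega⟩ : Fin (n - 1))]
      · rw [if_pos (by simp; omega), one_mul]
        congr 1
        simp
        omega
      · intro i _ hi
        rw [if_neg, zero_mul]
        intro hx
        exact hi (Fin.ext (by simp; omega))
      · simp
    · rw [Finset.sum_eq_zero]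
      · rcases Nat.eq_zero_or_pos y with rfl | h'
        · exact hv.symm
        · exact (hvn y (by omega)).symm
      · intro i _
        rw [if_neg, zero_mul]
        intro hx
        exact h ⟨by omega, by omega⟩
  rw [← key, ← key, ← Finset.sum_sub_distrib]
  refine Finset.sum_congr rfl fun i _ => ?_
  have : ((i : ℕ) + 1 = x - 1) ↔ ((i : ℕ) + 2 = x) := by omega
  simp only [chainDiff, this, sub_mul]

theorem sum_mul_chainDiff (p : ℕ → ℝ) (i : Fin (n - 1)) :
    ∑ x ∈ Finset.Icc 1 n, p x * chainDiff n x i = p (i + 2) - p (i + 1) := by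
  have hi := i.2
  simp only [chainDiff, mul_sub, Finset.sum_sub_distrib, mul_ite, mul_one, mul_zero]
  rw [Finset.sum_ite_eq, Finset.sum_ite_eq, if_pos (by rw [Finset.mem_Icc]; omega),
    if_pos (by rw [Finset.mem_Icc]; omega)]

/-- The extension by zero of a function on the inner bonds of the chain. -/
def extendZero (v : Fin (n - 1) → ℝ) (x : ℕ) : ℝ :=
  if h : 1 ≤ x ∧ x < n then v ⟨x - 1, by omega⟩ else 0

theorem extendZero_succ (v : Fin (n - 1) → ℝ) (i : Fin (n - 1)) :
    extendZero v (i + 1) = v i := by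
  rw [extendZero, dif_pos ⟨by omega, by omega⟩]
  rfl

theorem extendZero_zero (v : Fin (n - 1) → ℝ) : extendZero v 0 = 0 := by
  rw [extendZero, dif_neg (by omega)]

theorem extendZero_of_le (v : Fin (n - 1) → ℝ) {x : ℕ} (hx : n ≤ x) : extendZero v x = 0 := by
  rw [extendZero, dif_neg (by omega)]

theorem sum_chainDiff_fin (v : Fin (n - 1) → ℝ) {x : ℕ} (hx : 1 ≤ x) :
    ∑ i, chainDiff n x i * v i = extendZero v (x - 1) - extendZero v x := by
  rw [← sum_chainDiff (extendZero v) (extendZero_zero v) (fun _ h => extendZero_of_le v h) hx]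
  simp only [extendZero_succ]

theorem chainMatrix_mulVec (w : ℕ → ℝ) (v : Fin (n - 1) → ℝ) (i : Fin (n - 1)) :
    (chainMatrix n w).mulVec v i =
      ∑ x ∈ Finset.Icc 1 n, (w x * ∑ j, chainDiff n x j * v j) * chainDiff n x i := by
  simp only [Matrix.mulVec, dotProduct, chainMatrix, Finset.sum_mul, Finset.mul_sum]
  rw [Finset.sum_comm]
  refine Finset.sum_congr rfl fun x _ => Finset.sum_congr rfl fun j _ => by ring

/-- The form is a weighted sum of squared discrete gradients. A zero gradient together with the zero
value at the left end forces the function to vanish. -/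
theorem posDef_chainMatrix {w : ℕ → ℝ} (hw : ∀ x ∈ Finset.Icc 1 n, 0 < w x) :
    (chainMatrix n w).PosDef := by
  apply Matrix.PosDef.of_dotProduct_mulVec_pos
  · ext i j
    simp only [Matrix.conjTranspose_apply, star_trivial, chainMatrix]
    exact Finset.sum_congr rfl fun x _ => by ring
  · intro v hv
    have h1 : star v ⬝ᵥ (chainMatrix n w).mulVec v
        = ∑ x ∈ Finset.Icc 1 n, w x * (∑ j, chainDiff n x j * v j) ^ 2 := by
      have key : ∀ S : ℕ → ℝ, ∑ i, v i * ∑ x ∈ Finset.Icc 1 n, (w x * S x) * chainDiff n x i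
          = ∑ x ∈ Finset.Icc 1 n, w x * (S x * ∑ i, chainDiff n x i * v i) := by
        intro S
        simp only [Finset.mul_sum]
        rw [Finset.sum_comm]
        exact Finset.sum_congr rfl fun x _ => Finset.sum_congr rfl fun j _ => by ring
      simp only [star_trivial, dotProduct, chainMatrix_mulVec, sq]
      exact key _
    rw [h1]
    refine lt_of_le_of_ne (Finset.sum_nonneg fun x hx => mul_nonneg (hw x hx).le (sq_nonneg _)) ?_
    intro h0
    have h2 := (Finset.sum_eq_zero_iff_of_nonneg
      fun x hx => mul_nonneg (hw x hx).le (sq_nonneg _)).mp h0.symm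
    have h3 : ∀ x, x < n → extendZero v x = 0 := by
      intro x
      induction x with
      | zero => exact fun _ => extendZero_zero v
      | succ x ih =>
        intro hx
        have hmem : x + 1 ∈ Finset.Icc 1 n := by rw [Finset.mem_Icc]; omega
        have := h2 (x + 1) hmem
        rw [mul_eq_zero, or_iff_right (hw _ hmem).ne', sq_eq_zero_iff,
          sum_chainDiff_fin v (by omega), Nat.add_sub_cancel, ih (by omega), zero_sub,
          neg_eq_zero] at this
        exact this
    apply hv
    ext i
    rw [← extendZero_succ v i]
    exact h3 _ (by omega)

theorem raiseOp_mul_lowerOp {X Y : Matrix (Fin (n - 1)) (Fin (n - 1)) ℝ}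
    (c θ : Fin (n - 1) → ℝ) (hYX : Y * X = 1) (k : Fin (n - 1)) :
    raiseOp (n := n) X Y c θ k * lowerOp X Y c θ k =
      (1 / 2 : ℂ) • (modePos Y c k ^ 2 + modeMom X θ k ^ 2 - 1) := by
  have h2 : (√2 : ℂ)⁻¹ * (√2 : ℂ)⁻¹ = 1 / 2 := by
    rw [← mul_inv, ← Complex.ofReal_mul, Real.mul_self_sqrt (by norm_num)]
    norm_num
  have h1 := opComm_modePos_modeMom (n := n) c θ hYX k k
  rw [opComm_apply, if_pos rfl, sub_eq_iff_eq_add] at h1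
  rw [raiseOp, lowerOp, smul_mul_smul_comm, h2]
  congr 1
  rw [sub_mul, mul_add, mul_add, mul_smul_comm, h1, smul_mul_assoc, smul_mul_smul_comm,
    Complex.I_mul_I, smul_add, smul_smul, Complex.I_mul_I, sq, sq]
  simp only [neg_smul, one_smul]
  abel

/-- The quadratic Hamiltonian of a chain is a sum of independent oscillators. -/
theorem exists_chain_oscillator (hn : 1 ≤ n) {w b : ℕ → ℝ} (hw : ∀ x ∈ Finset.Icc 1 n, 0 < w x)
    (hb : ∀ x ∈ Finset.Icc 1 n, 0 < b x) :
    ∃ (X Y : Matrix (Fin (n - 1)) (Fin (n - 1)) ℝ) (ω : Fin (n - 1) → ℝ), (∀ k, 0 < ω k) ∧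
      Y * X = 1 ∧ Y * chainMatrix n w * Y.transpose = Matrix.diagonal ω ∧
      X.transpose * Matrix.diagonal (fun i : Fin (n - 1) => b (i + 1)) * X = Matrix.diagonal ω ∧
      ∀ (θ : Fin (n - 1) → ℝ) (R : ℕ → ℝ),
        (1 / 2 : ℂ) • ∑ x ∈ Finset.Icc 1 n,
          ((w x : ℂ) • (momentum n x - ((∑ i, chainDiff n x i * θ i : ℝ) : ℂ) • 1) ^ 2
            + (b x : ℂ) • (elong n x - (R x : ℂ) • 1) ^ 2) =
        oscillator (lowerOp X Y (fun i => R (i + 1)) θ) (raiseOp X Y (fun i => R (i + 1)) θ) ω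
          ((1 / 2) * ∑ k, ω k + (1 / 2) * (b n * R n ^ 2)) := by
  obtain ⟨X, Y, ω, hω, hYX, hA, hB⟩ := exists_normalModes (posDef_chainMatrix hw)
    (b := fun i : Fin (n - 1) => b (i + 1)) fun i => hb _ (by rw [Finset.mem_Icc]; omega)
  refine ⟨X, Y, ω, hω, hYX, hA, hB, fun θ R => ?_⟩
  set c : Fin (n - 1) → ℝ := fun i => R (i + 1) with hc
  have hmom : ∀ x ∈ Finset.Icc 1 n, (momentum n x - ((∑ i, chainDiff n x i * θ i : ℝ) : ℂ) • 1)
      = ∑ k, ((∑ i, chainDiff n x i * Y k i : ℝ) : ℂ) • modeMom X θ k := by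
    intro x hx
    rw [momentum_eq_sum (Finset.mem_Icc.mp hx).1]
    simp only [momOp_eq θ hYX, smul_add, Finset.sum_add_distrib, Finset.smul_sum, smul_smul]
    rw [← Finset.sum_smul]
    push_cast
    rw [add_sub_cancel_left, Finset.sum_comm]
    simp only [Finset.sum_smul]
  have hpos : ∀ i : Fin (n - 1), elong n (i + 1) - (R (i + 1) : ℂ) • 1
      = ∑ k, (X i k : ℂ) • modePos Y c k := by
    intro i
    rw [elong_succ, posOp_eq c hYX, add_sub_cancel_left]
  -- There is no bond at `x = n`, so that term is the scalar `b n * R n ^ 2`; it enters the constant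
  -- energy beside the zero-point energy.
  have hlast : elong n n = 0 := by
    rw [elong, dif_neg (by omega)]
  have hkin : ∑ x ∈ Finset.Icc 1 n,
      (w x : ℂ) • (momentum n x - ((∑ i, chainDiff n x i * θ i : ℝ) : ℂ) • 1) ^ 2
      = ∑ k, (ω k : ℂ) • modeMom X θ k ^ 2 := by
    rw [Finset.sum_congr rfl fun x hx => by rw [hmom x hx]]
    apply sum_smul_sq_linComb
    intro k l
    have h1 := congrFun (congrFun hA k) l
    have h2 : (Y * chainMatrix n w * Y.transpose) k l = ∑ x ∈ Finset.Icc 1 n,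
        w x * ((∑ i, chainDiff n x i * Y k i) * (∑ i, chainDiff n x i * Y l i)) := by
      simp only [Matrix.mul_apply, Matrix.transpose_apply, chainMatrix, Finset.sum_mul,
        Finset.mul_sum]
      rw [Finset.sum_congr rfl fun j _ => Finset.sum_comm, Finset.sum_comm]
      refine Finset.sum_congr rfl fun x _ => Finset.sum_congr rfl fun j _ =>
        Finset.sum_congr rfl fun i _ => by ring
    rw [h2, Matrix.diagonal_apply] at h1
    rw [show (if k = l then (ω k : ℂ) else 0) = ((if k = l then ω k else 0 : ℝ) : ℂ) by
      split_ifs <;> simp, ← h1]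
    push_cast
    rfl
  have hpot : ∑ x ∈ Finset.Icc 1 n, (b x : ℂ) • (elong n x - (R x : ℂ) • 1) ^ 2
      = ∑ k, (ω k : ℂ) • modePos Y c k ^ 2 + ((b n * R n ^ 2 : ℝ) : ℂ) • 1 := by
    rw [sum_Icc_eq_sum_fin hn, hlast]
    congr 1
    · simp only [hpos]
      apply sum_smul_sq_linComb
      intro k l
      have h1 := congrFun (congrFun hB k) l
      rw [Matrix.mul_apply, Matrix.diagonal_apply] at h1
      simp only [Matrix.mul_diagonal, Matrix.transpose_apply] at h1
      rw [show (if k = l then (ω k : ℂ) else 0) = ((if k = l then ω k else 0 : ℝ) : ℂ) by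
        split_ifs <;> simp, ← h1]
      push_cast
      exact Finset.sum_congr rfl fun i _ => by ring
    · rw [zero_sub, neg_sq, smul_pow, one_pow, smul_smul]
      push_cast
      rfl
  rw [Finset.sum_add_distrib, hkin, hpot, oscillator]
  simp only [raiseOp_mul_lowerOp c θ hYX]
  have h3 : ∀ k, (ω k : ℂ) • ((1 / 2 : ℂ) • (modePos Y c k ^ 2 + modeMom X θ k ^ 2 - 1))
      = (1 / 2 : ℂ) • ((ω k : ℂ) • modeMom X θ k ^ 2) + (1 / 2 : ℂ) • ((ω k : ℂ) • modePos Y c k ^ 2)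
        - (1 / 2 : ℂ) • ((ω k : ℂ) • (1 : Module.End ℂ 𝓢(Conf n, ℂ))) := fun k => by module
  simp only [h3, Finset.sum_add_distrib, Finset.sum_sub_distrib, ← Finset.smul_sum,
    ← Finset.sum_smul]
  push_cast
  module

end NormalForm

/-! ### Mean values of linear observables and their equations of motion. -/

section Means

variable {n : ℕ}

/-- A linear observable. -/
def linObs (a e : Fin (n - 1) → ℝ) : Module.End ℂ 𝓢(Conf n, ℂ) :=
  ∑ i, (a i : ℂ) • posOp i + ∑ i, (e i : ℂ) • momOp i

theorem sum_smul_expand {R J : Type} [AddCommGroup R] [Module ℂ R] [Fintype J] (a : J → ℂ) (o : R)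
    (c : J → ℂ) (X : J → J → ℂ) (q : J → R) :
    ∑ i, a i • (c i • o + ∑ k, X i k • q k)
      = (∑ i, a i * c i) • o + ∑ k, (∑ i, a i * X i k) • q k := by
  simp only [smul_add, Finset.sum_add_distrib, Finset.smul_sum, smul_smul, Finset.sum_smul]
  congr 1
  exact Finset.sum_comm

/-- The annihilation part of the linear observable with mode coefficients `α`, `η`. -/
def lowerCoeff (α η : ℝ) : ℂ := (√2 : ℂ)⁻¹ * (α - Complex.I * η)

/-- The creation part of the linear observable with mode coefficients `α`, `η`. -/
def raiseCoeff (α η : ℝ) : ℂ := (√2 : ℂ)⁻¹ * (α + Complex.I * η)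

variable {X Y : Matrix (Fin (n - 1)) (Fin (n - 1)) ℝ}

theorem linObs_eq_ladderComb (hYX : Y * X = 1) (c θ a e α η : Fin (n - 1) → ℝ)
    (hα : ∀ k, ∑ i, a i * X i k = α k) (hη : ∀ k, ∑ i, e i * Y k i = η k) :
    linObs a e = ((∑ i, a i * c i + ∑ i, e i * θ i : ℝ) : ℂ) • 1 +
      ladderComb (lowerOp X Y c θ) (raiseOp X Y c θ) (fun k => lowerCoeff (α k) (η k))
        (fun k => raiseCoeff (α k) (η k)) := by
  have hpos : ∑ i, (a i : ℂ) • posOp (n := n) i = (∑ i, (a i : ℂ) * c i) • 1 +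
      ∑ k, (α k : ℂ) • modePos Y c k := by
    simp only [posOp_eq c hYX]
    rw [sum_smul_expand (fun i => (a i : ℂ)) 1 (fun i => (c i : ℂ)) (fun i k => (X i k : ℂ))]
    simp only [← hα]
    push_cast
    rfl
  have hmom : ∑ i, (e i : ℂ) • momOp (n := n) i = (∑ i, (e i : ℂ) * θ i) • 1 +
      ∑ k, (η k : ℂ) • modeMom X θ k := by
    simp only [momOp_eq θ hYX]
    rw [sum_smul_expand (fun i => (e i : ℂ)) 1 (fun i => (θ i : ℂ)) (fun i k => (Y k i : ℂ))]
    simp only [← hη]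
    push_cast
    rfl
  have hk : ∀ k, (α k : ℂ) • modePos Y c k + (η k : ℂ) • modeMom X θ k =
      lowerCoeff (α k) (η k) • lowerOp X Y c θ k + raiseCoeff (α k) (η k) • raiseOp X Y c θ k := by
    intro k
    rw [modePos_eq (X := X) c θ, modeMom_eq (Y := Y) c θ, lowerCoeff, raiseCoeff]
    module
  rw [linObs, hpos, hmom, ladderComb, ← Finset.sum_congr rfl fun k _ => hk k,
    Finset.sum_add_distrib]
  push_cast
  module

/-- The complex phase of a ladder operator is a real rotation of the position and momentum
coefficients of its mode. -/
theorem lowerCoeff_mul_exp (α η s : ℝ) : lowerCoeff α η * Complex.exp (-(Complex.I * s)) =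
    lowerCoeff (α * Real.cos s - η * Real.sin s) (η * Real.cos s + α * Real.sin s) := by
  rw [lowerCoeff, lowerCoeff, show -(Complex.I * (s : ℂ)) = (-s : ℂ) * Complex.I by ring,
    Complex.exp_mul_I, Complex.cos_neg, Complex.sin_neg]
  push_cast
  linear_combination (√2 : ℂ)⁻¹ * η * Complex.sin s * Complex.I_sq

theorem raiseCoeff_mul_exp (α η s : ℝ) : raiseCoeff α η * Complex.exp (Complex.I * s) =
    raiseCoeff (α * Real.cos s - η * Real.sin s) (η * Real.cos s + α * Real.sin s) := by
  rw [raiseCoeff, raiseCoeff, mul_comm Complex.I (s : ℂ), Complex.exp_mul_I]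
  push_cast
  linear_combination (√2 : ℂ)⁻¹ * η * Complex.sin s * Complex.I_sq

variable (X Y) in
/-- The mean elongations at time `τ`. -/
def posMean (ω c θ : Fin (n - 1) → ℝ) (τ : ℝ) (i : Fin (n - 1)) : ℝ :=
  ∑ k, X i k * (Real.cos (ω k * τ) * ∑ j, Y k j * c j + Real.sin (ω k * τ) * ∑ j, X j k * θ j)

variable (X Y) in
/-- The mean conjugate momenta at time `τ`. -/
def momMean (ω c θ : Fin (n - 1) → ℝ) (τ : ℝ) (i : Fin (n - 1)) : ℝ :=
  ∑ k, Y k i * (Real.cos (ω k * τ) * ∑ j, X j k * θ j - Real.sin (ω k * τ) * ∑ j, Y k j * c j)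

/-- The observable is rotated in the modes of the dynamics, read again as a linear observable with
coefficients `a'` and `e'`, and expanded in the modes of the state. The constant term of that last
expansion is the classical mean. The constant `e₀` plays no role, its phases cancelling under
conjugation. -/
theorem linObs_mean_expectation (hYX : Y * X = 1) (ω : Fin (n - 1) → ℝ) (e₀ : ℝ)
    {X' Y' : Matrix (Fin (n - 1)) (Fin (n - 1)) ℝ} (hYX' : Y' * X' = 1) (ω' : Fin (n - 1) → ℝ)
    (hω' : ∀ k, 0 < ω' k) (c θ : Fin (n - 1) → ℝ) (e₀' : ℝ) (he₀' : 0 ≤ e₀') (τ : ℝ)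
    (a e : Fin (n - 1) → ℝ) :
    HasExpectation
      (gibbsState (closedOp n (-oscillator (lowerOp X' Y' c θ) (raiseOp X' Y' c θ) ω' e₀')))
      (conjOp (expOp (closedOp n ((Complex.I * τ) • oscillator (lowerOp X Y 0 0)
        (raiseOp X Y 0 0) ω e₀))) (closedOp n (linObs a e))
        (expOp (closedOp n ((-(Complex.I * τ)) • oscillator (lowerOp X Y 0 0)
          (raiseOp X Y 0 0) ω e₀)))) ∧
    expectation
      (gibbsState (closedOp n (-oscillator (lowerOp X' Y' c θ) (raiseOp X' Y' c θ) ω' e₀')))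
      (conjOp (expOp (closedOp n ((Complex.I * τ) • oscillator (lowerOp X Y 0 0)
        (raiseOp X Y 0 0) ω e₀))) (closedOp n (linObs a e))
        (expOp (closedOp n ((-(Complex.I * τ)) • oscillator (lowerOp X Y 0 0)
          (raiseOp X Y 0 0) ω e₀)))) =
      ((∑ i, a i * posMean X Y ω c θ τ i + ∑ i, e i * momMean X Y ω c θ τ i : ℝ) : ℂ) := by
  obtain ⟨kv, u, hB⟩ := exists_isFockBasis (n := n) 0 0 hYX
  obtain ⟨kv', u', hB'⟩ := exists_isFockBasis c θ hYX'
  set α : Fin (n - 1) → ℝ := fun k => ∑ i, a i * X i k with hα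
  set η : Fin (n - 1) → ℝ := fun k => ∑ i, e i * Y k i with hη
  set α' : Fin (n - 1) → ℝ := fun k => α k * Real.cos (ω k * τ) - η k * Real.sin (ω k * τ)
    with hα'
  set η' : Fin (n - 1) → ℝ := fun k => η k * Real.cos (ω k * τ) + α k * Real.sin (ω k * τ)
    with hη'
  set a' : Fin (n - 1) → ℝ := fun i => ∑ k, α' k * Y k i with ha'
  set e' : Fin (n - 1) → ℝ := fun i => ∑ k, η' k * X i k with he'
  have hid : ∀ k l, ∑ i, Y k i * X i l = if k = l then 1 else 0 := by
    intro k l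
    rw [← Matrix.mul_apply, hYX, Matrix.one_apply]
  have h1 := linObs_eq_ladderComb hYX (0 : Fin (n - 1) → ℝ) 0 a e α η (fun _ => rfl)
    (fun _ => rfl)
  have h2 := linObs_eq_ladderComb hYX (0 : Fin (n - 1) → ℝ) 0 a' e' α' η'
    (by
      intro k
      simp only [ha', Finset.sum_mul, mul_assoc]
      rw [Finset.sum_comm]
      simp only [← Finset.mul_sum, hid]
      simp)
    (by
      intro k
      simp only [he', Finset.sum_mul, mul_assoc]
      rw [Finset.sum_comm]
      have : ∀ l, ∑ i, X i l * Y k i = if k = l then 1 else 0 := fun l => by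
        rw [← hid]
        exact Finset.sum_congr rfl fun i _ => mul_comm _ _
      simp only [← Finset.mul_sum, this]
      simp)
  have h3 := linObs_eq_ladderComb hYX' c θ a' e' _ _ (fun _ => rfl) (fun _ => rfl)
  simp only [Pi.zero_apply, mul_zero, Finset.sum_const_zero, add_zero, Complex.ofReal_zero,
    zero_smul, zero_add] at h1 h2
  have hM : ∑ i, a' i * c i + ∑ i, e' i * θ i =
      ∑ i, a i * posMean X Y ω c θ τ i + ∑ i, e i * momMean X Y ω c θ τ i := by
    have e1 : ∑ i, a' i * c i = ∑ k, α' k * ∑ j, Y k j * c j := by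
      simp only [ha', Finset.sum_mul, Finset.mul_sum]
      rw [Finset.sum_comm]
      exact Finset.sum_congr rfl fun _ _ => Finset.sum_congr rfl fun _ _ => by ring
    have e2 : ∑ i, e' i * θ i = ∑ k, η' k * ∑ j, X j k * θ j := by
      simp only [he', Finset.sum_mul, Finset.mul_sum]
      rw [Finset.sum_comm]
      exact Finset.sum_congr rfl fun _ _ => Finset.sum_congr rfl fun _ _ => by ring
    have e3 : ∑ i, a i * posMean X Y ω c θ τ i = ∑ k, α k *
        (Real.cos (ω k * τ) * ∑ j, Y k j * c j + Real.sin (ω k * τ) * ∑ j, X j k * θ j) := by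
      simp only [posMean, hα]
      simp only [Finset.mul_sum (s := Finset.univ) (f := fun k => X _ k * _), Finset.sum_mul]
      rw [Finset.sum_comm]
      exact Finset.sum_congr rfl fun _ _ => Finset.sum_congr rfl fun _ _ => by ring
    have e4 : ∑ i, e i * momMean X Y ω c θ τ i = ∑ k, η k *
        (Real.cos (ω k * τ) * ∑ j, X j k * θ j - Real.sin (ω k * τ) * ∑ j, Y k j * c j) := by
      simp only [momMean, hη]
      simp only [Finset.mul_sum (s := Finset.univ) (f := fun k => Y k _ * _), Finset.sum_mul]
      rw [Finset.sum_comm]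
      exact Finset.sum_congr rfl fun _ _ => Finset.sum_congr rfl fun _ _ => by ring
    rw [e1, e2, e3, e4, ← Finset.sum_add_distrib, ← Finset.sum_add_distrib]
    exact Finset.sum_congr rfl fun k _ => by simp only [hα', hη']; ring
  rw [← hM]
  refine gibbs_heisenberg_expectation hB ω e₀ hB' ω' e₀' hω' he₀' τ _ _
    (fun k => lowerCoeff (∑ i, a' i * X' i k) (∑ i, e' i * Y' k i))
    (fun k => raiseCoeff (∑ i, a' i * X' i k) (∑ i, e' i * Y' k i)) _ h1 ?_
  rw [← h3, h2]
  congr 1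
  · ext k
    rw [show -(Complex.I * (τ : ℂ)) * (ω k : ℂ) = -(Complex.I * ((ω k * τ : ℝ) : ℂ)) by
      push_cast; ring, lowerCoeff_mul_exp]
  · ext k
    rw [show (Complex.I * (τ : ℂ)) * (ω k : ℂ) = (Complex.I * ((ω k * τ : ℝ) : ℂ)) by
      push_cast; ring, raiseCoeff_mul_exp]

theorem posMean_zero (hYX : Y * X = 1) (ω c θ : Fin (n - 1) → ℝ) (i : Fin (n - 1)) :
    posMean X Y ω c θ 0 i = c i := by
  simp only [posMean, mul_zero, Real.cos_zero, Real.sin_zero, zero_mul, add_zero, one_mul]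
  change (X.mulVec (Y.mulVec c)) i = _
  rw [Matrix.mulVec_mulVec, mul_eq_one_comm.mp hYX, Matrix.one_mulVec]

theorem momMean_zero (hYX : Y * X = 1) (ω c θ : Fin (n - 1) → ℝ) (i : Fin (n - 1)) :
    momMean X Y ω c θ 0 i = θ i := by
  simp only [momMean, mul_zero, Real.cos_zero, Real.sin_zero, zero_mul, sub_zero, one_mul]
  change (Y.transpose.mulVec (X.transpose.mulVec θ)) i = _
  rw [Matrix.mulVec_mulVec, ← Matrix.transpose_mul, mul_eq_one_comm.mp hYX, Matrix.transpose_one,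
    Matrix.one_mulVec]

/-- The identity `A Yᵀ = X diag ω` turns the rotation of modes back into Hamilton's equation in the
original coordinates, where the frequencies no longer appear. -/
theorem hasDerivAt_posMean (hYX : Y * X = 1) {ω : Fin (n - 1) → ℝ} (c θ : Fin (n - 1) → ℝ)
    {A : Matrix (Fin (n - 1)) (Fin (n - 1)) ℝ} (hA : Y * A * Y.transpose = Matrix.diagonal ω)
    (τ : ℝ) (i : Fin (n - 1)) :
    HasDerivAt (fun τ => posMean X Y ω c θ τ i) (A.mulVec (momMean X Y ω c θ τ) i) τ := by
  have hXY := mul_eq_one_comm.mp hYX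
  have hA' : A * Y.transpose = X * Matrix.diagonal ω := by
    rw [← hA, ← Matrix.mul_assoc, ← Matrix.mul_assoc, hXY, one_mul]
  set π : Fin (n - 1) → ℝ := fun k =>
    Real.cos (ω k * τ) * ∑ j, X j k * θ j - Real.sin (ω k * τ) * ∑ j, Y k j * c j with hπ
  have h1 : A.mulVec (momMean X Y ω c θ τ) i = ∑ k, X i k * (ω k * π k) := by
    change A.mulVec (Y.transpose.mulVec π) i = _
    rw [Matrix.mulVec_mulVec, hA', Matrix.mulVec, dotProduct]
    simp only [Matrix.mul_diagonal, mul_assoc]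
  rw [h1]
  refine HasDerivAt.fun_sum fun k _ => HasDerivAt.const_mul _ ?_
  have hl : HasDerivAt (fun τ => ω k * τ) (ω k) τ := by
    simpa using (hasDerivAt_id τ).const_mul (ω k)
  refine ((hl.cos.mul_const _).add (hl.sin.mul_const _)).congr_deriv ?_
  rw [hπ]
  ring

theorem hasDerivAt_momMean (hYX : Y * X = 1) {ω : Fin (n - 1) → ℝ} (c θ : Fin (n - 1) → ℝ)
    {B : Matrix (Fin (n - 1)) (Fin (n - 1)) ℝ} (hB : X.transpose * B * X = Matrix.diagonal ω)
    (τ : ℝ) (i : Fin (n - 1)) :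
    HasDerivAt (fun τ => momMean X Y ω c θ τ i) (-B.mulVec (posMean X Y ω c θ τ) i) τ := by
  have hXY : Y.transpose * X.transpose = 1 := by
    rw [← Matrix.transpose_mul, mul_eq_one_comm.mp hYX, Matrix.transpose_one]
  have hB' : B * X = Y.transpose * Matrix.diagonal ω := by
    rw [← hB, ← Matrix.mul_assoc, ← Matrix.mul_assoc, hXY, one_mul]
  set q : Fin (n - 1) → ℝ := fun k =>
    Real.cos (ω k * τ) * ∑ j, Y k j * c j + Real.sin (ω k * τ) * ∑ j, X j k * θ j with hq
  have h1 : B.mulVec (posMean X Y ω c θ τ) i = ∑ k, Y k i * (ω k * q k) := by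
    change B.mulVec (X.mulVec q) i = _
    rw [Matrix.mulVec_mulVec, hB', Matrix.mulVec, dotProduct]
    simp only [Matrix.mul_diagonal, mul_assoc, Matrix.transpose_apply]
  rw [h1, ← Finset.sum_neg_distrib]
  simp only [← mul_neg]
  refine HasDerivAt.fun_sum fun k _ => HasDerivAt.const_mul _ ?_
  have hl : HasDerivAt (fun τ => ω k * τ) (ω k) τ := by
    simpa using (hasDerivAt_id τ).const_mul (ω k)
  refine ((hl.cos.mul_const _).sub (hl.sin.mul_const _)).congr_deriv ?_
  rw [hq]
  ring

end Means

/-! ### The averages follow the classical chain. -/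

section Chain

variable {n : ℕ}

theorem elong_eq_linObs {x : ℕ} (h : 1 ≤ x ∧ x < n) :
    elong n x = linObs (fun i => if (i : ℕ) + 1 = x then 1 else 0) 0 := by
  obtain ⟨i, rfl⟩ : ∃ i : Fin (n - 1), x = i + 1 := ⟨⟨x - 1, by omega⟩, by simp; omega⟩
  rw [elong_succ, linObs, Finset.sum_eq_single i]
  · simp
  · intro j _ hj
    rw [if_neg, Complex.ofReal_zero, zero_smul]
    intro h'
    exact hj (Fin.ext (by omega))
  · simp

theorem elong_eq_zero {x : ℕ} (h : ¬(1 ≤ x ∧ x < n)) : elong n x = linObs 0 0 := by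
  rw [elong, dif_neg h]
  simp [linObs]

theorem momentum_eq_linObs {x : ℕ} (hx : 1 ≤ x) :
    momentum n x = linObs 0 (chainDiff n x) := by
  rw [momentum_eq_sum hx, linObs]
  simp

/-- Elongations only describe relative motion, so the centre of mass is at rest as an operator
identity. This forces the correction of the prescribed momenta. -/
theorem sum_momentum : ∑ x ∈ Finset.Icc 1 n, momentum n x = 0 := by
  rw [Finset.sum_congr rfl fun x hx => momentum_eq_sum (Finset.mem_Icc.mp hx).1, Finset.sum_comm]
  refine Finset.sum_eq_zero fun i _ => ?_
  rw [← Finset.sum_smul]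
  have := sum_mul_chainDiff (n := n) (fun _ => 1) i
  simp only [one_mul, sub_self] at this
  rw [← Complex.ofReal_sum, this, Complex.ofReal_zero, zero_smul]

theorem hamiltonian_eq (m : ℕ → ℝ) : hamiltonian n m =
    (1 / 2 : ℂ) • ∑ x ∈ Finset.Icc 1 n,
      (((1 / m x : ℝ) : ℂ) • (momentum n x - ((∑ i, chainDiff n x i * (0 : ℝ) : ℝ) : ℂ) • 1) ^ 2
        + ((1 : ℝ) : ℂ) • (elong n x - ((0 : ℝ) : ℂ) • 1) ^ 2) := by
  rw [hamiltonian]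
  congr 1
  refine Finset.sum_congr rfl fun x _ => ?_
  simp

theorem sub_smul_one_sq {R : Type} [Ring R] [Algebra ℂ R] (q : R) (s : ℂ) :
    (q - s • 1) ^ 2 = q ^ 2 - (2 * s) • q + (s ^ 2) • 1 := by
  rw [sq, sub_mul, mul_sub, mul_sub, smul_mul_assoc, one_mul, mul_smul_comm, mul_one,
    smul_mul_smul_comm, one_mul, ← sq q]
  module

/-- Since the total momentum vanishes, the mean momenta may be shifted so as to sum to zero. -/
theorem sum_smul_sq_momentum_shift {w μ p : ℕ → ℝ} {l : ℝ} (hp : ∑ x ∈ Finset.Icc 1 n, p x = 0)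
    (h : ∀ x ∈ Finset.Icc 1 n, w x * (μ x - p x) = l) :
    ∑ x ∈ Finset.Icc 1 n, (w x : ℂ) • (momentum n x - (μ x : ℂ) • 1) ^ 2 =
      ∑ x ∈ Finset.Icc 1 n, (w x : ℂ) • (momentum n x - (p x : ℂ) • 1) ^ 2 +
        ((∑ x ∈ Finset.Icc 1 n, w x * (μ x - p x) ^ 2 : ℝ) : ℂ) • 1 := by
  have h1 : ∀ x ∈ Finset.Icc 1 n, (w x : ℂ) • (momentum n x - (μ x : ℂ) • 1) ^ 2 =
      (w x : ℂ) • (momentum n x - (p x : ℂ) • 1) ^ 2 +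
        ((-2 * l : ℂ) • (momentum n x - (p x : ℂ) • 1) +
          ((w x * (μ x - p x) ^ 2 : ℝ) : ℂ) • 1) := by
    intro x hx
    have hl : (w x : ℂ) * (μ x - p x) = l := by
      rw [← h x hx]
      push_cast
      rfl
    set q := momentum n x - (p x : ℂ) • (1 : Module.End ℂ 𝓢(Conf n, ℂ)) with hq
    have e : momentum n x - (μ x : ℂ) • 1 =
        q - ((μ x : ℂ) - p x) • (1 : Module.End ℂ 𝓢(Conf n, ℂ)) := by
      rw [hq]
      module
    rw [e, sub_smul_one_sq, ← hl]
    push_cast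
    module
  rw [Finset.sum_congr rfl h1, Finset.sum_add_distrib, Finset.sum_add_distrib, ← Finset.smul_sum,
    Finset.sum_sub_distrib, sum_momentum, ← Finset.sum_smul, ← Finset.sum_smul]
  have h2 : ∑ x ∈ Finset.Icc 1 n, (p x : ℂ) = 0 := by
    rw [← Complex.ofReal_sum, hp, Complex.ofReal_zero]
  rw [h2]
  push_cast
  simp

/-- The momentum shift that makes the mean momenta of the locally Gibbs state sum to zero. -/
def momentumShift (n : ℕ) (m : ℕ → ℝ) (mbar : ℝ) (β pbar : ℝ → ℝ) : ℝ :=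
  (∑ x ∈ Finset.Icc 1 n, m x / mbar * pbar (x / n)) / ∑ x ∈ Finset.Icc 1 n, m x / β (x / n)

/-- The averages of the Heisenberg-evolved momenta and elongations in the locally Gibbs state are
well defined and solve the classical equations of motion. -/
theorem exists_mean_trajectory (hn : 1 ≤ n) {m : ℕ → ℝ} (hm : ∀ x ∈ Finset.Icc 1 n, 0 < m x)
    (mbar : ℝ) (β pbar rbar : ℝ → ℝ) (hβ : ∀ x ∈ Finset.Icc 1 n, 0 < β ((x : ℕ) / n)) :
    ∃ Rm Pm : ℕ → ℝ → ℝ,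
      (∀ x ∈ Finset.Icc 1 n, ∀ τ, HasDerivAt (Pm x) (Rm x τ - Rm (x - 1) τ) τ) ∧
      (∀ x, 1 ≤ x → x < n → ∀ τ,
        HasDerivAt (Rm x) (Pm (x + 1) τ / m (x + 1) - Pm x τ / m x) τ) ∧
      (∀ τ, Rm 0 τ = 0) ∧ (∀ τ, Rm n τ = 0) ∧
      (∀ x, 1 ≤ x → x < n → Rm x 0 = rbar (x / n)) ∧
      (∀ x ∈ Finset.Icc 1 n, Pm x 0 = m x / mbar * pbar (x / n) -
        momentumShift n m mbar β pbar * (m x / β (x / n))) ∧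
      ∀ x ∈ Finset.Icc 1 n, ∀ τ,
        (HasExpectation (localGibbs n m mbar β pbar rbar) (heisenberg n m τ (momentum n x)) ∧
          expectation (localGibbs n m mbar β pbar rbar) (heisenberg n m τ (momentum n x)) =
            (Pm x τ : ℂ)) ∧
        (HasExpectation (localGibbs n m mbar β pbar rbar) (heisenberg n m τ (elong n x)) ∧
          expectation (localGibbs n m mbar β pbar rbar) (heisenberg n m τ (elong n x)) =
            (Rm x τ : ℂ)) := by
  set l := momentumShift n m mbar β pbar with hl
  -- These are the prescribed momenta projected onto zero total momentum. The weighted deviation `β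
  -- / m * (prescribed - p)` equals `l` at every site, so the cross terms combine to a multiple of
  -- the total momentum and vanish.
  set p : ℕ → ℝ := fun x => m x / mbar * pbar (x / n) - l * (m x / β (x / n)) with hp
  have hden : 0 < ∑ x ∈ Finset.Icc 1 n, m x / β (x / n) :=
    Finset.sum_pos (fun x hx => div_pos (hm x hx) (hβ x hx)) ⟨1, by simp [hn]⟩
  have hpsum : ∑ x ∈ Finset.Icc 1 n, p x = 0 := by
    simp only [hp, Finset.sum_sub_distrib, ← Finset.mul_sum]
    rw [hl, momentumShift, div_mul_cancel₀ _ hden.ne', sub_self]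
  -- A discrete potential whose gradient is `p`; it vanishes at the right end precisely because `p`
  -- sums to zero.
  set v : ℕ → ℝ := fun x => if x < n then -∑ y ∈ Finset.Icc 1 x, p y else 0 with hv
  have hv' : ∀ x ≤ n, v x = -∑ y ∈ Finset.Icc 1 x, p y := by
    intro x hx
    rcases hx.lt_or_eq with h | rfl
    · simp only [hv, if_pos h]
    · simp only [hv, lt_irrefl, if_false, hpsum, neg_zero]
  set θ : Fin (n - 1) → ℝ := fun i => v (i + 1) with hθ
  have hpθ : ∀ x ∈ Finset.Icc 1 n, ∑ i, chainDiff n x i * θ i = p x := by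
    intro x hx
    rw [Finset.mem_Icc] at hx
    rw [sum_chainDiff v (by simp [hv]) (fun x hx => by simp only [hv, if_neg (not_lt.mpr hx)]) hx.1,
      hv' x hx.2, hv' (x - 1) (by omega)]
    obtain ⟨y, rfl⟩ : ∃ y, x = y + 1 := ⟨x - 1, by omega⟩
    rw [Finset.sum_Icc_succ_top (by omega), Nat.add_sub_cancel]
    ring
  obtain ⟨X, Y, ω, -, hYX, hA, hB, hH⟩ := exists_chain_oscillator hn (w := fun x => 1 / m x)
    (b := fun _ => 1) (fun x hx => one_div_pos.mpr (hm x hx)) (fun _ _ => one_pos)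
  obtain ⟨X', Y', ω', hω', hYX', -, -, hK⟩ := exists_chain_oscillator hn
    (w := fun x => β (x / n) / m x) (b := fun x => β (x / n))
    (fun x hx => div_pos (hβ x hx) (hm x hx)) hβ
  have hH' := (hamiltonian_eq m).trans (hH 0 (fun _ => 0))
  set c : Fin (n - 1) → ℝ := fun i => rbar (((i : ℕ) + 1 : ℕ) / n) with hc
  have hK' := hK θ (fun x => rbar (x / n))
  set e₁ : ℝ := (1 / 2) * ∑ k, ω' k + (1 / 2) * (β (n / n) * rbar (n / n) ^ 2) with he₁
  -- The constant left over when the prescribed momenta are replaced by `p`; it disappears in the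
  -- normalization of the state.
  set e₂ : ℝ := (1 / 2) * ∑ x ∈ Finset.Icc 1 n,
    β (x / n) / m x * (m x / mbar * pbar (x / n) - p x) ^ 2 with he₂
  have hpsd : pseudoHamiltonian n m mbar β pbar rbar =
      oscillator (lowerOp X' Y' c θ) (raiseOp X' Y' c θ) ω' (e₁ + e₂) := by
    have h1 : oscillator (lowerOp X' Y' c θ) (raiseOp X' Y' c θ) ω' (e₁ + e₂) =
        oscillator (lowerOp X' Y' c θ) (raiseOp X' Y' c θ) ω' e₁ + (e₂ : ℂ) • 1 := by
      rw [oscillator, oscillator]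
      push_cast
      module
    rw [h1, ← hK', pseudoHamiltonian, Finset.sum_add_distrib,
      sum_smul_sq_momentum_shift (p := p) (l := l) hpsum, Finset.sum_add_distrib,
      Finset.sum_congr rfl fun x hx => by rw [← hpθ x hx], he₂]
    · push_cast
      module
    · intro x hx
      have h1 := (hm x hx).ne'
      have h2 := (hβ x hx).ne'
      simp only [hp]
      field_simp
      ring
  have he : 0 ≤ e₁ + e₂ := by
    have h1 : 0 ≤ ∑ k, ω' k := Finset.sum_nonneg fun k _ => (hω' k).le
    have h2 : 0 < β (n / n) := hβ n (by simp [hn])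
    have h3 : 0 ≤ e₂ := mul_nonneg (by norm_num) (Finset.sum_nonneg fun x hx =>
      mul_nonneg (div_pos (hβ x hx) (hm x hx)).le (sq_nonneg _))
    positivity
  have key : ∀ (τ : ℝ) (a e : Fin (n - 1) → ℝ),
      HasExpectation (localGibbs n m mbar β pbar rbar) (heisenberg n m τ (linObs a e)) ∧
      expectation (localGibbs n m mbar β pbar rbar) (heisenberg n m τ (linObs a e)) =
        ((∑ i, a i * posMean X Y ω c θ τ i + ∑ i, e i * momMean X Y ω c θ τ i : ℝ) : ℂ) := by
    intro τ a e
    rw [localGibbs, heisenberg, hpsd, hH']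
    exact linObs_mean_expectation hYX ω _ hYX' ω' hω' c θ _ he τ a e
  set R : ℕ → ℝ → ℝ := fun x τ => extendZero (posMean X Y ω c θ τ) x with hR
  set Pm : ℕ → ℝ → ℝ := fun x τ => ∑ i, chainDiff n x i * momMean X Y ω c θ τ i with hPm
  refine ⟨R, Pm, ?_, ?_, fun τ => extendZero_zero _, fun τ => extendZero_of_le _ le_rfl, ?_, ?_,
    ?_⟩
  · intro x hx τ
    have h1 : R x τ - R (x - 1) τ = ∑ i, chainDiff n x i * -posMean X Y ω c θ τ i := by
      simp only [mul_neg, Finset.sum_neg_distrib]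
      rw [sum_chainDiff_fin _ (Finset.mem_Icc.mp hx).1]
      ring
    rw [h1]
    refine HasDerivAt.fun_sum fun i _ => HasDerivAt.const_mul _ ?_
    have h2 := hasDerivAt_momMean hYX c θ hB τ i
    rwa [Matrix.diagonal_one, Matrix.one_mulVec] at h2
  · intro x hx hxn τ
    obtain ⟨i, rfl⟩ : ∃ i : Fin (n - 1), x = i + 1 := ⟨⟨x - 1, by omega⟩, by simp; omega⟩
    have h1 := hasDerivAt_posMean hYX c θ hA τ i
    rw [chainMatrix_mulVec] at h1
    have h2 := sum_mul_chainDiff (n := n) (fun x => 1 / m x * Pm x τ) i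
    rw [h2] at h1
    have h3 : R (i + 1) = fun τ => posMean X Y ω c θ τ i := by
      ext τ
      exact extendZero_succ _ i
    rw [h3]
    refine h1.congr_deriv ?_
    ring
  · intro x hx hxn
    obtain ⟨i, rfl⟩ : ∃ i : Fin (n - 1), x = i + 1 := ⟨⟨x - 1, by omega⟩, by simp; omega⟩
    simp only [hR]
    rw [extendZero_succ, posMean_zero hYX]
  · intro x hx
    simp only [hPm, momMean_zero hYX]
    exact hpθ x hx
  · intro x hx τ
    rw [momentum_eq_linObs (Finset.mem_Icc.mp hx).1]
    refine ⟨⟨(key τ _ _).1, (key τ _ _).2.trans ?_⟩, ?_⟩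
    · simp [hPm]
    · by_cases h : 1 ≤ x ∧ x < n
      · rw [elong_eq_linObs h]
        refine ⟨(key τ _ _).1, (key τ _ _).2.trans ?_⟩
        obtain ⟨i, rfl⟩ : ∃ i : Fin (n - 1), x = i + 1 := ⟨⟨x - 1, by omega⟩, by simp; omega⟩
        simp only [hR, extendZero_succ]
        simp [Fin.val_inj]
      · rw [elong_eq_zero h]
        refine ⟨(key τ _ _).1, (key τ _ _).2.trans ?_⟩
        simp only [hR]
        rw [extendZero, dif_neg h]
        simp

end Chain

/-! ### Stability of flows with a skew generator. -/

section SkewFlow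

variable {E : Type} [NormedAddCommGroup E] [InnerProductSpace ℝ E] {A : E →L[ℝ] E}

theorem norm_eq_of_skew (hA : ∀ x y, ⟪A x, y⟫_ℝ = -⟪x, A y⟫_ℝ) {u : ℝ → E}
    (hu : ∀ s, HasDerivAt u (A (u s)) s) (s s' : ℝ) : ‖u s‖ = ‖u s'‖ := by
  have h0 : ∀ x, ⟪A x, x⟫_ℝ = 0 := fun x => by
    have := hA x x
    rw [real_inner_comm (A x) x] at this
    linarith
  have h1 : ∀ s, HasDerivAt (fun s => ⟪u s, u s⟫_ℝ) 0 s := fun s => by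
    refine ((hu s).inner ℝ (hu s)).congr_deriv ?_
    rw [real_inner_comm, h0, add_zero]
  have h2 := is_const_of_deriv_eq_zero (fun s => (h1 s).differentiableAt)
    (fun s => (h1 s).deriv) s s'
  simp only [real_inner_self_eq_norm_sq] at h2
  exact (sq_eq_sq₀ (norm_nonneg _) (norm_nonneg _)).mp h2

/-- The difference between the trajectory and its time shift solves the same linear equation, so its
norm is conserved. -/
theorem norm_sub_eq_of_skew (hA : ∀ x y, ⟪A x, y⟫_ℝ = -⟪x, A y⟫_ℝ) {u : ℝ → E}
    (hu : ∀ s, HasDerivAt u (A (u s)) s) (s t : ℝ) : ‖u s - u t‖ = ‖u (s - t) - u 0‖ := by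
  have h : ∀ σ, HasDerivAt (fun σ => u (σ + (s - t)) - u σ) (A (u (σ + (s - t)) - u σ)) σ := by
    intro σ
    rw [map_sub]
    exact ((hu _).comp_add_const σ (s - t)).sub (hu σ)
  have := norm_eq_of_skew hA h t 0
  simpa using this

/-- The norm of `A` grows with the chain, so `u` is not equicontinuous for free. Conservation of the
norm reduces the increment to an inner product with `u 0`, which is split into `w` and a small rest.
Against `w`, skewness moves the generator onto `w`, where it is bounded. -/
theorem norm_sub_sq_le_of_skew (hA : ∀ x y, ⟪A x, y⟫_ℝ = -⟪x, A y⟫_ℝ) {u : ℝ → E}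
    (hu : ∀ s, HasDerivAt u (A (u s)) s) (w : E) (h : ℝ) :
    ‖u h - u 0‖ ^ 2 ≤ 2 * |h| * (‖u 0‖ * ‖A w‖) + 4 * (‖u 0‖ * ‖u 0 - w‖) := by
  have hn : ∀ s, ‖u s‖ = ‖u 0‖ := fun s => norm_eq_of_skew hA hu s 0
  have h1 : |⟪u h, w⟫_ℝ - ⟪u 0, w⟫_ℝ| ≤ ‖u 0‖ * ‖A w‖ * |h - 0| := by
    have hd : ∀ s ∈ (univ : Set ℝ),
        HasDerivWithinAt (fun s => ⟪u s, w⟫_ℝ) (⟪A (u s), w⟫_ℝ) univ s := fun s _ => by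
      have := (hu s).inner ℝ (hasDerivAt_const s w)
      rw [inner_zero_right, zero_add] at this
      exact this.hasDerivWithinAt
    have hb : ∀ s ∈ (univ : Set ℝ), ‖⟪A (u s), w⟫_ℝ‖ ≤ ‖u 0‖ * ‖A w‖ := fun s _ => by
      rw [hA, norm_neg, ← hn s]
      exact norm_inner_le_norm _ _
    have := Convex.norm_image_sub_le_of_norm_hasDerivWithin_le hd hb convex_univ (mem_univ 0)
      (mem_univ h)
    rwa [Real.norm_eq_abs, Real.norm_eq_abs] at this
  rw [sub_zero] at h1
  have h2 : |⟪u h - u 0, u 0 - w⟫_ℝ| ≤ 2 * ‖u 0‖ * ‖u 0 - w‖ := by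
    refine (abs_real_inner_le_norm _ _).trans (mul_le_mul_of_nonneg_right ?_ (norm_nonneg _))
    refine (norm_sub_le _ _).trans ?_
    rw [hn h]
    linarith
  have h3 : ‖u h - u 0‖ ^ 2 = -2 * (⟪u h, w⟫_ℝ - ⟪u 0, w⟫_ℝ) - 2 * ⟪u h - u 0, u 0 - w⟫_ℝ := by
    rw [norm_sub_sq_real, hn h, inner_sub_right, inner_sub_left, inner_sub_left,
      real_inner_self_eq_norm_sq]
    ring
  rw [h3]
  have h4 := (abs_le.mp h1).1
  have h5 := (abs_le.mp h2).1
  nlinarith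

variable [CompleteSpace E]

/-- A time-integrated comparison of a unitary flow with a curve that solves its integrated
equation up to a small error. -/
theorem norm_integral_sub_sq_le (hA : ∀ x y, ⟪A x, y⟫_ℝ = -⟪x, A y⟫_ℝ) {u U W : ℝ → E}
    (hu : ∀ s, HasDerivAt u (A (u s)) s) (hW : ∀ s, HasDerivAt W (U s) s) (hW0 : W 0 = 0)
    {T ε : ℝ} (hρ : ∀ s ∈ Icc 0 T, ‖u 0 - U s + A (W s)‖ ≤ ε) :
    ∃ F : ℝ → E, (∀ s, HasDerivAt F (u s - U s) s) ∧
      ∀ s ∈ Icc 0 T, ‖F s‖ ^ 2 ≤ T * ε ^ 2 * Real.exp T := by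
  have huc : Continuous u := continuous_iff_continuousAt.mpr fun s => (hu s).continuousAt
  set J : ℝ → E := fun s => ∫ σ in (0 : ℝ)..s, u σ with hJ
  have hJd : ∀ s, HasDerivAt J (u s) s := fun s => (huc.integral_hasStrictDerivAt 0 s).hasDerivAt
  have hconst : ∀ s, u s - A (J s) = u 0 := by
    intro s
    have hd : ∀ s, HasDerivAt (fun s => u s - A (J s)) 0 s := fun s => by
      refine ((hu s).sub (A.hasFDerivAt.comp_hasDerivAt s (hJd s))).congr_deriv ?_
      rw [sub_self]
    have := is_const_of_deriv_eq_zero (fun s => (hd s).differentiableAt) (fun s => (hd s).deriv) s 0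
    rw [this]
    simp [hJ]
  have hFd : ∀ s, HasDerivAt (fun s => J s - W s) (u s - U s) s := fun s => (hJd s).sub (hW s)
  refine ⟨fun s => J s - W s, hFd, ?_⟩
  set F : ℝ → E := fun s => J s - W s with hF
  have h0 : ∀ x, ⟪A x, x⟫_ℝ = 0 := fun x => by
    have := hA x x
    rw [real_inner_comm (A x) x] at this
    linarith
  -- `u - U` is the residual plus `A (F s)`, and skewness makes the latter orthogonal to `F s`.
  -- Hence the size of `A` does not enter.
  have hinner : ∀ s, ⟪F s, u s - U s⟫_ℝ = ⟪F s, u 0 - U s + A (W s)⟫_ℝ := by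
    intro s
    have : u s - U s = (u 0 - U s + A (W s)) + A (F s) := by
      rw [← hconst s, hF]
      simp only [map_sub]
      abel
    rw [this, inner_add_right, real_inner_comm (A (F s)), h0, add_zero]
  -- Gronwall in differential form: Young's inequality gives `(‖F‖²)' ≤ ‖F‖² + ε²`, and the weight
  -- `exp (-s)` absorbs the first term.
  have hQ : ∀ s, HasDerivAt (fun s => Real.exp (-s) * ‖F s‖ ^ 2 - s * ε ^ 2)
      (Real.exp (-s) * (2 * ⟪F s, u 0 - U s + A (W s)⟫_ℝ - ‖F s‖ ^ 2) - ε ^ 2) s := by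
    intro s
    have h1 : HasDerivAt (fun s => ‖F s‖ ^ 2) (2 * ⟪F s, u s - U s⟫_ℝ) s := (hFd s).norm_sq
    have h2 : HasDerivAt (fun s => Real.exp (-s)) (Real.exp (-s) * -1) s :=
      (hasDerivAt_neg s).exp
    refine ((h2.fun_mul h1).sub ((hasDerivAt_id s).mul_const (ε ^ 2))).congr_deriv ?_
    rw [hinner]
    ring
  have hanti : AntitoneOn (fun s => Real.exp (-s) * ‖F s‖ ^ 2 - s * ε ^ 2) (Icc 0 T) := by
    refine antitoneOn_of_deriv_nonpos (convex_Icc 0 T)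
      (fun s _ => (hQ s).continuousAt.continuousWithinAt)
      (fun s _ => (hQ s).differentiableAt.differentiableWithinAt) fun s hs => ?_
    rw [interior_Icc] at hs
    rw [(hQ s).deriv]
    have h1 : ⟪F s, u 0 - U s + A (W s)⟫_ℝ ≤ ‖F s‖ * ε :=
      (real_inner_le_norm _ _).trans
        (mul_le_mul_of_nonneg_left (hρ s ⟨hs.1.le, hs.2.le⟩) (norm_nonneg _))
    have h2 : 2 * ⟪F s, u 0 - U s + A (W s)⟫_ℝ - ‖F s‖ ^ 2 ≤ ε ^ 2 := by
      nlinarith [sq_nonneg (‖F s‖ - ε)]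
    have h3 : Real.exp (-s) ≤ 1 := Real.exp_le_one_iff.mpr (by linarith [hs.1])
    have h4 := mul_le_mul_of_nonneg_left h2 (Real.exp_pos (-s)).le
    have h5 := mul_le_mul_of_nonneg_right h3 (sq_nonneg ε)
    linarith
  intro s hs
  have h1 := hanti ⟨le_rfl, hs.1.trans hs.2⟩ hs hs.1
  have hF0 : F 0 = 0 := by simp [hF, hJ, hW0]
  simp only [hF0, norm_zero] at h1
  have h2 : Real.exp (-s) * ‖F s‖ ^ 2 ≤ T * ε ^ 2 := by
    have := mul_le_mul_of_nonneg_right hs.2 (sq_nonneg ε)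
    nlinarith
  calc ‖F s‖ ^ 2 = (Real.exp (-s) * ‖F s‖ ^ 2) * Real.exp s := by
        rw [mul_right_comm, ← Real.exp_add]
        simp
    _ ≤ (T * ε ^ 2) * Real.exp T :=
        mul_le_mul h2 (Real.exp_le_exp.mpr hs.2) (Real.exp_pos _).le
          (mul_nonneg (hs.1.trans hs.2) (sq_nonneg _))

/-- Quantitative comparison of a unitary flow with a curve that solves its integrated equation up
to a small error. -/
theorem norm_sub_le_of_consistent (hA : ∀ x y, ⟪A x, y⟫_ℝ = -⟪x, A y⟫_ℝ) {u U W : ℝ → E}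
    (hu : ∀ s, HasDerivAt u (A (u s)) s) (hW : ∀ s, HasDerivAt W (U s) s) (hW0 : W 0 = 0)
    {T ε κ C h t : ℝ} (hρ : ∀ s ∈ Icc 0 T, ‖u 0 - U s + A (W s)‖ ≤ ε)
    (hC : ‖u 0‖ ≤ C) {w : E} (hAw : ‖A w‖ ≤ C) (hw : ‖u 0 - w‖ ≤ ε) (hh : 0 < h) (hhT : 2 * h ≤ T)
    (hU : ∀ s ∈ Icc 0 T, |s - t| ≤ h → ‖U s - U t‖ ≤ κ) (ht : t ∈ Icc 0 T) :
    h * ‖u t - U t‖ ≤ h * (κ + √(2 * h * (C * C) + 4 * (C * ε))) +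
      2 * √(T * ε ^ 2 * Real.exp T) := by
  obtain ⟨F, hF, hFb⟩ := norm_integral_sub_sq_le hA hu hW hW0 hρ
  have hC0 : 0 ≤ C := (norm_nonneg _).trans hC
  set η := κ + √(2 * h * (C * C) + 4 * (C * ε)) with hη
  -- A window of length `h` inside `[0, T]` that contains `t`, looking forward if possible and
  -- backward otherwise; `2 * h ≤ T` makes one of them fit.
  obtain ⟨a, ha0, haT, hat, hta⟩ : ∃ a, 0 ≤ a ∧ a + h ≤ T ∧ a ≤ t ∧ t ≤ a + h := by
    by_cases hc : t + h ≤ T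
    · exact ⟨t, ht.1, hc, le_rfl, by linarith⟩
    · exact ⟨t - h, by linarith, by linarith [ht.2], by linarith, by linarith⟩
  set δ := u t - U t with hδ
  have hinc : ∀ s, |s - t| ≤ h → ‖u s - u t‖ ≤ √(2 * h * (C * C) + 4 * (C * ε)) := by
    intro s hs
    rw [norm_sub_eq_of_skew hA hu]
    apply Real.le_sqrt_of_sq_le
    refine (norm_sub_sq_le_of_skew hA hu w (s - t)).trans ?_
    gcongr
  have hG : ∀ s ∈ Icc a (a + h),
      HasDerivWithinAt (fun s => F s - s • δ) (u s - U s - δ) (Icc a (a + h)) s := by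
    intro s _
    have := ((hF s).sub ((hasDerivAt_id s).smul_const δ)).hasDerivWithinAt (s := Icc a (a + h))
    rwa [one_smul] at this
  have hb : ∀ s ∈ Ico a (a + h), ‖u s - U s - δ‖ ≤ η := by
    intro s hs
    have hst : |s - t| ≤ h := by
      rw [abs_le]
      constructor <;> linarith [hs.1, hs.2]
    have h1 : u s - U s - δ = (u s - u t) - (U s - U t) := by
      rw [hδ]
      abel
    rw [h1, hη, add_comm κ]
    exact (norm_sub_le _ _).trans
      (add_le_add (hinc s hst) (hU s ⟨ha0.trans hs.1, hs.2.le.trans haT⟩ hst))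
  have h1 := norm_image_sub_le_of_norm_deriv_le_segment' hG hb (a + h)
    ⟨by linarith, le_rfl⟩
  -- On the window `u - U` is nearly the constant `δ`, so `h • δ` is close to the increment of `F`,
  -- already known to be small.
  have h2 : h • δ = (F (a + h) - F a) - ((F (a + h) - (a + h) • δ) - (F a - a • δ)) := by
    module
  have hFb' : ∀ s ∈ Icc 0 T, ‖F s‖ ≤ √(T * ε ^ 2 * Real.exp T) := fun s hs =>
    Real.le_sqrt_of_sq_le (hFb s hs)
  have h3 : ‖h • δ‖ ≤ 2 * √(T * ε ^ 2 * Real.exp T) + η * (a + h - a) := by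
    rw [h2]
    refine (norm_sub_le _ _).trans (add_le_add ?_ h1)
    refine (norm_sub_le _ _).trans ?_
    have := hFb' (a + h) ⟨by linarith, haT⟩
    have := hFb' a ⟨ha0, by linarith⟩
    linarith
  rw [norm_smul, Real.norm_of_nonneg hh.le] at h3
  linarith

end SkewFlow

/-! ### Mass coordinates, Riemann sums and the law of large numbers. -/

section MassCoordinates

/-- The total mass of the first `k` particles. -/
def massSum (m : ℕ → ℝ) (k : ℕ) : ℝ := ∑ x ∈ Finset.Icc 1 k, m x

/-- The fraction of the mass carried by the first `x` particles out of `n`. -/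
def massNode (m : ℕ → ℝ) (n x : ℕ) : ℝ := massSum m x / massSum m n

theorem massSum_zero (m : ℕ → ℝ) : massSum m 0 = 0 := by simp [massSum]

theorem massSum_succ (m : ℕ → ℝ) (k : ℕ) : massSum m (k + 1) = massSum m k + m (k + 1) :=
  Finset.sum_Icc_succ_top (by omega) m

theorem massNode_zero (m : ℕ → ℝ) (n : ℕ) : massNode m n 0 = 0 := by
  rw [massNode, massSum_zero, zero_div]

theorem sum_Icc_one_eq_sum_range {M : Type} [AddCommMonoid M] (f : ℕ → M) (n : ℕ) :
    ∑ x ∈ Finset.Icc 1 n, f x = ∑ i ∈ Finset.range n, f (i + 1) := by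
  rw [Finset.range_eq_Ico, Finset.sum_Ico_add' f 0 n 1]
  rfl

variable {m : ℕ → ℝ} {m0 : ℝ}

theorem le_massSum (hm : ∀ x, 1 ≤ x → m0 ≤ m x) (n : ℕ) : m0 * n ≤ massSum m n := by
  have : ∑ x ∈ Finset.Icc 1 n, m0 ≤ massSum m n :=
    Finset.sum_le_sum fun x hx => hm x (Finset.mem_Icc.mp hx).1
  simpa [mul_comm] using this

theorem massSum_pos (h0 : 0 < m0) (hm : ∀ x, 1 ≤ x → m0 ≤ m x) {n : ℕ} (hn : 1 ≤ n) :
    0 < massSum m n := by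
  have h1 : (0 : ℝ) < n := by exact_mod_cast hn
  exact (mul_pos h0 h1).trans_le (le_massSum hm n)

theorem massSum_mono (h0 : 0 < m0) (hm : ∀ x, 1 ≤ x → m0 ≤ m x) : Monotone (massSum m) :=
  monotone_nat_of_le_succ fun k => by
    rw [massSum_succ]
    linarith [hm (k + 1) (by omega)]

theorem massNode_self (h0 : 0 < m0) (hm : ∀ x, 1 ≤ x → m0 ≤ m x) {n : ℕ} (hn : 1 ≤ n) :
    massNode m n n = 1 := div_self (massSum_pos h0 hm hn).ne'

theorem massNode_mono (h0 : 0 < m0) (hm : ∀ x, 1 ≤ x → m0 ≤ m x) {n : ℕ} (hn : 1 ≤ n) :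
    Monotone (massNode m n) := fun _ _ h =>
  div_le_div_of_nonneg_right (massSum_mono h0 hm h) (massSum_pos h0 hm hn).le

theorem massNode_mem (h0 : 0 < m0) (hm : ∀ x, 1 ≤ x → m0 ≤ m x) {n : ℕ} (hn : 1 ≤ n) {x : ℕ}
    (hx : x ≤ n) : massNode m n x ∈ Icc (0 : ℝ) 1 := by
  rw [← massNode_zero m n, ← massNode_self h0 hm hn]
  exact ⟨massNode_mono h0 hm hn (Nat.zero_le x), massNode_mono h0 hm hn hx⟩

theorem massNode_succ_sub (m : ℕ → ℝ) (n x : ℕ) :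
    massNode m n (x + 1) - massNode m n x = m (x + 1) / massSum m n := by
  rw [massNode, massNode, massSum_succ]
  ring

theorem natCast_div_mem {n x : ℕ} (hx : x ≤ n) : (x / n : ℝ) ∈ Icc (0 : ℝ) 1 :=
  ⟨by positivity, div_le_one_of_le₀ (by exact_mod_cast hx) (Nat.cast_nonneg n)⟩

theorem eventually_forall_abs_le {a : ℕ → ℝ} (ha : Tendsto (fun k : ℕ => a k / k) atTop (𝓝 0))
    {ε : ℝ} (hε : 0 < ε) : ∀ᶠ n : ℕ in atTop, ∀ k ≤ n, |a k| ≤ ε * n := by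
  obtain ⟨N, hN⟩ := eventually_atTop.mp
    ((Metric.tendsto_nhds.mp ha ε hε).and (eventually_ge_atTop 1))
  -- The finitely many indices before the limit takes effect are bounded together and outweighed by
  -- large `n`.
  set D := ∑ k ∈ Finset.range N, |a k| with hD
  filter_upwards [eventually_ge_atTop ⌈D / ε⌉₊] with n hn k hk
  by_cases hkN : k < N
  · have h1 : |a k| ≤ D := Finset.single_le_sum (f := fun k => |a k|) (fun _ _ => abs_nonneg _)
      (Finset.mem_range.mpr hkN)
    have h2 : D / ε ≤ n := Nat.ceil_le.mp hn
    rw [div_le_iff₀ hε] at h2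
    linarith
  · obtain ⟨h1, h2⟩ := hN k (not_lt.mp hkN)
    have hk0 : (0 : ℝ) < k := by exact_mod_cast h2
    rw [Real.dist_eq, sub_zero, abs_div, abs_of_pos hk0, div_lt_iff₀ hk0] at h1
    have : (k : ℝ) ≤ n := by exact_mod_cast hk
    nlinarith

/-- The deviation `massSum m k - mbar * k` is `o(n)` uniformly in `k ≤ n`, and the total mass grows
at least linearly. -/
theorem eventually_massNode_sub_le (h0 : 0 < m0) (hm : ∀ x, 1 ≤ x → m0 ≤ m x) {mbar : ℝ}
    (hlim : Tendsto (fun n : ℕ => massSum m n / n) atTop (𝓝 mbar)) {ε : ℝ} (hε : 0 < ε) :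
    ∀ᶠ n : ℕ in atTop, ∀ x ≤ n, |massNode m n x - x / n| ≤ ε := by
  have h1 : Tendsto (fun k : ℕ => (massSum m k - mbar * k) / k) atTop (𝓝 0) := by
    have h2 : Tendsto (fun k : ℕ => massSum m k / k - mbar) atTop (𝓝 (mbar - mbar)) :=
      hlim.sub_const mbar
    rw [sub_self] at h2
    refine h2.congr' ?_
    filter_upwards [eventually_ge_atTop 1] with k hk
    have : (k : ℝ) ≠ 0 := by positivity
    field_simp
  filter_upwards [eventually_forall_abs_le h1 (ε := ε * m0 / 2) (by positivity),
    eventually_ge_atTop 1] with n hn hn1 x hx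
  have hS := massSum_pos h0 hm hn1
  have hn0 : (0 : ℝ) < n := by exact_mod_cast hn1
  have e : massNode m n x - x / n =
      ((massSum m x - mbar * x) - (x / n) * (massSum m n - mbar * n)) / massSum m n := by
    rw [massNode]
    field_simp
    ring
  rw [e, abs_div, abs_of_pos hS, div_le_iff₀ hS]
  have hxn := natCast_div_mem hx
  have h2 := hn x hx
  have h3 : |(x / n : ℝ) * (massSum m n - mbar * n)| ≤ ε * m0 / 2 * n := by
    rw [abs_mul, abs_of_nonneg hxn.1]
    exact (mul_le_of_le_one_left (abs_nonneg _) hxn.2).trans (hn n le_rfl)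
  have h4 := abs_sub (massSum m x - mbar * x) ((x / n : ℝ) * (massSum m n - mbar * n))
  have h5 := mul_le_mul_of_nonneg_left (le_massSum hm n) hε.le
  linarith

theorem exists_modulus {f : ℝ → ℝ} (hf : ContinuousOn f (Icc 0 1)) {ε : ℝ} (hε : 0 < ε) :
    ∃ δ > 0, ∀ y ∈ Icc (0 : ℝ) 1, ∀ z ∈ Icc (0 : ℝ) 1, |y - z| ≤ δ → |f y - f z| ≤ ε := by
  have := isCompact_Icc.uniformContinuousOn_of_continuous hf
  obtain ⟨δ, hδ, h⟩ := Metric.uniformContinuousOn_iff.mp this ε hε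
  refine ⟨δ / 2, half_pos hδ, fun y hy z hz hyz => ?_⟩
  exact (h y hy z hz (by rw [Real.dist_eq]; linarith)).le

/-- After division by the total mass, the weight of site `x` is exactly the length of its cell in
mass coordinates. The sum is then a Riemann sum with tags `x / n` uniformly close to the cells. -/
theorem tendsto_mass_riemann (h0 : 0 < m0) (hm : ∀ x, 1 ≤ x → m0 ≤ m x) {mbar : ℝ}
    (hlim : Tendsto (fun n : ℕ => massSum m n / n) atTop (𝓝 mbar)) {f : ℝ → ℝ}
    (hf : ContinuousOn f (Icc 0 1)) :
    Tendsto (fun n : ℕ => (1 / n : ℝ) * ∑ x ∈ Finset.Icc 1 n, m x * f (x / n)) atTop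
      (𝓝 (mbar * ∫ y in (0 : ℝ)..1, f y)) := by
  have key : Tendsto (fun n : ℕ => (∑ x ∈ Finset.Icc 1 n, m x * f (x / n)) / massSum m n) atTop
      (𝓝 (∫ y in (0 : ℝ)..1, f y)) := by
    rw [Metric.tendsto_nhds]
    intro ε hε
    obtain ⟨δ, hδ, hmod⟩ := exists_modulus hf (half_pos hε)
    have hinv : ∀ᶠ n : ℕ in atTop, (1 : ℝ) / n < δ / 2 :=
      (tendsto_one_div_atTop_nhds_zero_nat (𝕜 := ℝ)).eventually_lt_const (half_pos hδ)
    filter_upwards [eventually_massNode_sub_le h0 hm hlim (half_pos hδ), hinv,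
      eventually_ge_atTop 1] with n hn hn' hn1
    have hS := massSum_pos h0 hm hn1
    have hint : ∀ i < n, IntervalIntegrable f volume (massNode m n i) (massNode m n (i + 1)) := by
      intro i hi
      apply ContinuousOn.intervalIntegrable
      rw [uIcc_of_le (massNode_mono h0 hm hn1 (Nat.le_succ i))]
      exact hf.mono (Icc_subset_Icc (massNode_mem h0 hm hn1 hi.le).1
        (massNode_mem h0 hm hn1 (Nat.succ_le_of_lt hi)).2)
    have hsum := intervalIntegral.sum_integral_adjacent_intervals hint
    rw [massNode_zero, massNode_self h0 hm hn1] at hsum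
    rw [← hsum, Finset.sum_div, sum_Icc_one_eq_sum_range, Real.dist_eq, ← Finset.sum_sub_distrib]
    have hterm : ∀ i ∈ Finset.range n,
        |m (i + 1) * f ((i + 1 : ℕ) / n) / massSum m n -
          ∫ y in massNode m n i..massNode m n (i + 1), f y| ≤
        ε / 2 * (massNode m n (i + 1) - massNode m n i) := by
      intro i hi
      rw [Finset.mem_range] at hi
      have hle := massNode_mono h0 hm hn1 (Nat.le_succ i)
      have e1 : m (i + 1) * f ((i + 1 : ℕ) / n) / massSum m n =
          ∫ y in massNode m n i..massNode m n (i + 1), f ((i + 1 : ℕ) / n) := by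
        rw [intervalIntegral.integral_const, massNode_succ_sub, smul_eq_mul]
        ring
      rw [e1, ← intervalIntegral.integral_sub intervalIntegrable_const (hint i hi),
        ← Real.norm_eq_abs]
      have := intervalIntegral.norm_integral_le_of_norm_le_const
        (f := fun y => f ((i + 1 : ℕ) / n) - f y) (C := ε / 2)
        (a := massNode m n i) (b := massNode m n (i + 1)) ?_
      · rwa [abs_of_nonneg (sub_nonneg.mpr hle)] at this
      · intro y hy
        rw [uIoc_of_le hle] at hy
        have hi1 := abs_le.mp (hn i hi.le)
        have hi2 := abs_le.mp (hn (i + 1) hi)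
        refine hmod _ (natCast_div_mem hi) _
          ⟨(massNode_mem h0 hm hn1 hi.le).1.trans hy.1.le,
            hy.2.trans (massNode_mem h0 hm hn1 hi).2⟩ ?_
        have e2 : (((i + 1 : ℕ) : ℝ) / n) = i / n + 1 / n := by
          push_cast
          ring
        rw [abs_le]
        constructor <;> linarith [hy.1, hy.2]
    refine (Finset.abs_sum_le_sum_abs _ _).trans_lt ((Finset.sum_le_sum hterm).trans_lt ?_)
    rw [← Finset.mul_sum, Finset.sum_range_sub, massNode_zero, massNode_self h0 hm hn1]
    linarith
  refine (hlim.mul key).congr' ?_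
  filter_upwards [eventually_ge_atTop 1] with n hn
  have h1 := (massSum_pos h0 hm hn).ne'
  have h2 : (n : ℝ) ≠ 0 := by positivity
  field_simp

theorem tendsto_riemann {f : ℝ → ℝ} (hf : ContinuousOn f (Icc 0 1)) :
    Tendsto (fun n : ℕ => (1 / n : ℝ) * ∑ x ∈ Finset.Icc 1 n, f (x / n)) atTop
      (𝓝 (∫ y in (0 : ℝ)..1, f y)) := by
  have hlim : Tendsto (fun n : ℕ => massSum (fun _ => 1) n / n) atTop (𝓝 1) := by
    refine tendsto_const_nhds.congr' ?_
    filter_upwards [eventually_ge_atTop 1] with n hn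
    have h2 : (n : ℝ) ≠ 0 := by positivity
    simp [massSum, h2]
  have := tendsto_mass_riemann (m := fun _ => 1) one_pos (fun _ _ => le_rfl) hlim hf
  simpa only [one_mul] using this

/-- After division by `n`, the numerator tends to the integral of `pbar`, which is zero, and the
denominator to a positive limit. -/
theorem tendsto_momentumShift (h0 : 0 < m0) (hm : ∀ x, 1 ≤ x → m0 ≤ m x) {mbar : ℝ}
    (hmbar : 0 < mbar)
    (hlim : Tendsto (fun n : ℕ => massSum m n / n) atTop (𝓝 mbar)) {β pbar : ℝ → ℝ}
    (hpbar : ContinuousOn pbar (Icc 0 1)) (hint : ∫ y in (0 : ℝ)..1, pbar y = 0)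
    (hβ : ContinuousOn β (Icc 0 1)) (hβ0 : ∀ y ∈ Icc (0 : ℝ) 1, 0 < β y) :
    Tendsto (fun n => momentumShift n m mbar β pbar) atTop (𝓝 0) := by
  have h1 := tendsto_mass_riemann h0 hm hlim (hpbar.div_const mbar)
  have hβi : ContinuousOn (fun y => (β y)⁻¹) (Icc 0 1) := hβ.inv₀ fun y hy => (hβ0 y hy).ne'
  have h2 := tendsto_mass_riemann h0 hm hlim hβi
  have hpos : 0 < mbar * ∫ y in (0 : ℝ)..1, (β y)⁻¹ := by
    refine mul_pos hmbar (intervalIntegral.intervalIntegral_pos_of_pos_on ?_ ?_ one_pos)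
    · apply ContinuousOn.intervalIntegrable
      rwa [uIcc_of_le zero_le_one]
    · exact fun y hy => inv_pos.mpr (hβ0 y ⟨hy.1.le, hy.2.le⟩)
  have h3 := h1.div h2 hpos.ne'
  rw [intervalIntegral.integral_div, hint, zero_div, mul_zero, zero_div] at h3
  refine h3.congr' ?_
  filter_upwards [eventually_ge_atTop 1] with n hn
  have hn0 : (1 / n : ℝ) ≠ 0 := by positivity
  rw [momentumShift, Pi.div_apply, mul_div_mul_left _ _ hn0]
  congr 1
  · exact Finset.sum_congr rfl fun x _ => by ring

end MassCoordinates

/-! ### The classical chain in energy coordinates. -/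

section ChainFlow

/-- The phase space of the chain with the energy norm. -/
abbrev ChainSpace (n : ℕ) : Type := EuclideanSpace ℝ (Fin (n - 1) ⊕ Fin n)

/-- The coupling of velocities and elongations in energy coordinates. -/
def chainCoupling (n : ℕ) (m : ℕ → ℝ) : Matrix (Fin (n - 1)) (Fin n) ℝ :=
  fun i j => n * chainDiff n (j + 1) i / √(m (j + 1))

/-- The generator of the classical chain dynamics in energy coordinates. -/
def chainGen (n : ℕ) (m : ℕ → ℝ) : ChainSpace n →L[ℝ] ChainSpace n :=
  Matrix.toEuclideanCLM (𝕜 := ℝ)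
    (Matrix.fromBlocks 0 (chainCoupling n m) (-(chainCoupling n m).transpose) 0)

/-- The phase space point with elongations `r` and velocities `v`. -/
def chainVec (n : ℕ) (m r v : ℕ → ℝ) : ChainSpace n :=
  WithLp.toLp 2 (Sum.elim (fun i => r (i + 1) / √n) (fun j => √(m (j + 1)) / √n * v (j + 1)))

variable {n : ℕ} {m : ℕ → ℝ}

theorem chainGen_skew (x y : ChainSpace n) :
    ⟪chainGen n m x, y⟫_ℝ = -⟪x, chainGen n m y⟫_ℝ := by
  have h : ContinuousLinearMap.adjoint (chainGen n m) = -chainGen n m := by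
    rw [← ContinuousLinearMap.star_eq_adjoint, chainGen, ← map_star, ← map_neg,
      Matrix.star_eq_conjTranspose, Matrix.conjTranspose_eq_transpose_of_trivial,
      Matrix.fromBlocks_transpose, Matrix.fromBlocks_neg]
    simp
  rw [← ContinuousLinearMap.adjoint_inner_right, h, _root_.neg_apply, inner_neg_right]

theorem sum_fin_mul_chainDiff (v : ℕ → ℝ) (i : Fin (n - 1)) :
    ∑ j : Fin n, v (j + 1) * chainDiff n (j + 1) i = v (i + 2) - v (i + 1) := by
  rw [← sum_mul_chainDiff, sum_Icc_one_eq_sum_range,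
    Fin.sum_univ_eq_sum_range (fun j => v (j + 1) * chainDiff n (j + 1) i) n]

theorem sum_chainDiff_of_boundary {r : ℕ → ℝ} (h0 : r 0 = 0) (hn : r n = 0) {x : ℕ} (hx : 1 ≤ x)
    (hxn : x ≤ n) : ∑ i : Fin (n - 1), chainDiff n x i * r (i + 1) = r (x - 1) - r x := by
  have h1 := sum_chainDiff (n := n) (fun y => if y < n then r y else 0)
    (by by_cases h : 0 < n <;> simp [h, h0]) (fun y hy => by simp [not_lt.mpr hy]) hx
  have h2 : ∀ y ≤ n, (if y < n then r y else 0) = r y := by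
    intro y hy
    rcases hy.lt_or_eq with h | rfl
    · rw [if_pos h]
    · rw [if_neg (lt_irrefl _), hn]
  simp only [h2 x hxn, h2 (x - 1) (by omega)] at h1
  rw [← h1]
  exact Finset.sum_congr rfl fun i _ => by rw [if_pos (by omega)]

/-- The weights `√(m x)` make the generator skew while the variables remain elongation and velocity;
the factor `n` is the speed-up to macroscopic time. Both boundary values are needed for the velocity
rows at the ends. -/
theorem chainGen_chainVec (hn : 1 ≤ n) (hm : ∀ x, 1 ≤ x → 0 < m x) {r : ℕ → ℝ} (h0 : r 0 = 0)
    (hrn : r n = 0) (v : ℕ → ℝ) :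
    chainGen n m (chainVec n m r v) = chainVec n m (fun x => n * (v (x + 1) - v x))
      (fun x => n * (r x - r (x - 1)) / m x) := by
  have hn0 : (0 : ℝ) < n := by exact_mod_cast hn
  have hsn := Real.sqrt_pos.mpr hn0
  apply PiLp.ext
  rintro (i | j)
  · have h1 : chainGen n m (chainVec n m r v) (Sum.inl i) =
        ∑ j : Fin n, n * chainDiff n (j + 1) i / √(m (j + 1)) *
          (√(m (j + 1)) / √n * v (j + 1)) := by
      simp [chainGen, chainVec, Matrix.mulVec, dotProduct, chainCoupling]
    rw [h1]
    have h2 : ∀ j : Fin n, n * chainDiff n (j + 1) i / √(m (j + 1)) *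
        (√(m (j + 1)) / √n * v (j + 1)) = n / √n * (v (j + 1) * chainDiff n (j + 1) i) := by
      intro j
      have := (Real.sqrt_pos.mpr (hm (j + 1) (by omega))).ne'
      field_simp
    simp only [h2, ← Finset.mul_sum, sum_fin_mul_chainDiff]
    simp only [chainVec, Sum.elim_inl]
    ring
  · have h1 : chainGen n m (chainVec n m r v) (Sum.inr j) =
        -∑ i : Fin (n - 1), n * chainDiff n (j + 1) i / √(m (j + 1)) * (r (i + 1) / √n) := by
      simp [chainGen, chainVec, Matrix.mulVec, dotProduct, chainCoupling]
    rw [h1]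
    have h2 : ∀ i : Fin (n - 1), n * chainDiff n (j + 1) i / √(m (j + 1)) * (r (i + 1) / √n) =
        n / (√(m (j + 1)) * √n) * (chainDiff n (j + 1) i * r (i + 1)) := by
      intro i
      ring
    simp only [h2, ← Finset.mul_sum]
    rw [sum_chainDiff_of_boundary h0 hrn (by omega) (by omega)]
    simp only [chainVec, Sum.elim_inr]
    have h3 := hm (j + 1) (by omega)
    have h4 := Real.sqrt_pos.mpr h3
    have h5 := Real.sq_sqrt h3.le
    rw [Nat.add_sub_cancel]
    field_simp
    rw [h5]
    ring

theorem chainVec_add (r v r' v' : ℕ → ℝ) :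
    chainVec n m r v + chainVec n m r' v' =
      chainVec n m (fun x => r x + r' x) (fun x => v x + v' x) := by
  apply PiLp.ext
  rintro (i | j) <;> simp [chainVec] <;> ring

theorem chainVec_sub (r v r' v' : ℕ → ℝ) :
    chainVec n m r v - chainVec n m r' v' =
      chainVec n m (fun x => r x - r' x) (fun x => v x - v' x) := by
  apply PiLp.ext
  rintro (i | j) <;> simp [chainVec] <;> ring

theorem chainVec_zero : chainVec n m (fun _ => 0) (fun _ => 0) = 0 := by
  apply PiLp.ext
  rintro (i | j) <;> simp [chainVec]

theorem chainVec_congr {r v r' v' : ℕ → ℝ} (hr : ∀ x, 1 ≤ x → x < n → r x = r' x)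
    (hv : ∀ x, 1 ≤ x → x ≤ n → v x = v' x) : chainVec n m r v = chainVec n m r' v' := by
  apply PiLp.ext
  rintro (i | j)
  · simp only [chainVec, Sum.elim_inl]
    rw [hr _ (by omega) (by omega)]
  · simp only [chainVec, Sum.elim_inr]
    rw [hv _ (by omega) (by omega)]

theorem norm_chainVec_sq (hm : ∀ x, 1 ≤ x → 0 < m x) (r v : ℕ → ℝ) :
    ‖chainVec n m r v‖ ^ 2 = (∑ i : Fin (n - 1), r (i + 1) ^ 2 +
      ∑ j : Fin n, m (j + 1) * v (j + 1) ^ 2) / n := by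
  rw [EuclideanSpace.real_norm_sq_eq, Fintype.sum_sum_type, add_div, Finset.sum_div,
    Finset.sum_div]
  congr 1
  · refine Finset.sum_congr rfl fun i _ => ?_
    simp only [chainVec, Sum.elim_inl, div_pow, Real.sq_sqrt (Nat.cast_nonneg n)]
  · refine Finset.sum_congr rfl fun j _ => ?_
    simp only [chainVec, Sum.elim_inr, mul_pow, div_pow, Real.sq_sqrt (Nat.cast_nonneg n),
      Real.sq_sqrt (hm (j + 1) (by omega)).le]
    ring

theorem norm_chainVec_le (hn : 1 ≤ n) (hm : ∀ x, 1 ≤ x → 0 < m x) {m1 : ℝ}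
    (hm1 : ∀ x, 1 ≤ x → m x ≤ m1) {r v : ℕ → ℝ} {a : ℝ}
    (hr : ∀ x, 1 ≤ x → x < n → |r x| ≤ a) (hv : ∀ x, 1 ≤ x → x ≤ n → |v x| ≤ a) :
    ‖chainVec n m r v‖ ≤ √(1 + m1) * a := by
  have hn0 : (0 : ℝ) < n := by exact_mod_cast hn
  have ha : 0 ≤ a := (abs_nonneg _).trans (hv 1 le_rfl hn)
  have hm1' : 0 < m1 := (hm 1 le_rfl).trans_le (hm1 1 le_rfl)
  have h1 : ‖chainVec n m r v‖ ^ 2 ≤ (1 + m1) * a ^ 2 := by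
    rw [norm_chainVec_sq hm, div_le_iff₀ hn0]
    have e1 : ∑ i : Fin (n - 1), r (i + 1) ^ 2 ≤ ∑ _i : Fin (n - 1), a ^ 2 :=
      Finset.sum_le_sum fun i _ => sq_le_sq' (abs_le.mp (hr _ (by omega) (by omega))).1
        (abs_le.mp (hr _ (by omega) (by omega))).2
    have e2 : ∑ j : Fin n, m (j + 1) * v (j + 1) ^ 2 ≤ ∑ _j : Fin n, m1 * a ^ 2 :=
      Finset.sum_le_sum fun j _ => mul_le_mul (hm1 _ (by omega))
        (sq_le_sq' (abs_le.mp (hv _ (by omega) (by omega))).1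
          (abs_le.mp (hv _ (by omega) (by omega))).2) (sq_nonneg _) hm1'.le
    rw [Finset.sum_const, Finset.card_univ, Fintype.card_fin, nsmul_eq_mul] at e1 e2
    have e3 : ((n - 1 : ℕ) : ℝ) ≤ n := by exact_mod_cast Nat.sub_le n 1
    have e4 := mul_le_mul_of_nonneg_right e3 (sq_nonneg a)
    linarith
  rw [← abs_of_nonneg ha, ← Real.sqrt_sq_eq_abs, ← Real.sqrt_mul (by linarith)]
  exact Real.le_sqrt_of_sq_le h1

theorem hasDerivAt_chainVec {r v : ℕ → ℝ → ℝ} {r' v' : ℕ → ℝ} {s : ℝ}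
    (hr : ∀ x, 1 ≤ x → x < n → HasDerivAt (r x) (r' x) s)
    (hv : ∀ x, 1 ≤ x → x ≤ n → HasDerivAt (v x) (v' x) s) :
    HasDerivAt (fun s => chainVec n m (fun x => r x s) (fun x => v x s)) (chainVec n m r' v') s := by
  have h : HasDerivAt (fun s => (Sum.elim (fun i : Fin (n - 1) => r (i + 1) s / √n)
      (fun j : Fin n => √(m (j + 1)) / √n * v (j + 1) s) : Fin (n - 1) ⊕ Fin n → ℝ))
      (Sum.elim (fun i : Fin (n - 1) => r' (i + 1) / √n)
      (fun j : Fin n => √(m (j + 1)) / √n * v' (j + 1))) s := by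
    rw [hasDerivAt_pi]
    rintro (i | j)
    · exact (hr _ (by omega) (by omega)).div_const _
    · exact (hv _ (by omega) (by omega)).const_mul _
  exact (EuclideanSpace.equiv (Fin (n - 1) ⊕ Fin n) ℝ).symm.toContinuousLinearMap.hasFDerivAt
    |>.comp_hasDerivAt s h

/-- The weighted energy is a Lipschitz function of the phase space point. -/
theorem abs_energy_sub_le (hn : 1 ≤ n) (hm : ∀ x, 1 ≤ x → 0 < m x) {G : ℝ} {g : ℕ → ℝ}
    (hg : ∀ x, 1 ≤ x → x ≤ n → |g x| ≤ G) {r v r' v' : ℕ → ℝ} (hrn : r n = 0) (hrn' : r' n = 0) :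
    |(1 / n : ℝ) * ∑ x ∈ Finset.Icc 1 n, g x * (m x * v x ^ 2 / 2 + r x ^ 2 / 2) -
      (1 / n : ℝ) * ∑ x ∈ Finset.Icc 1 n, g x * (m x * v' x ^ 2 / 2 + r' x ^ 2 / 2)| ≤
      G / 2 * (‖chainVec n m r v - chainVec n m r' v'‖ *
        (‖chainVec n m r v‖ + ‖chainVec n m r' v'‖)) := by
  set γ : Fin (n - 1) ⊕ Fin n → ℝ := Sum.elim (fun i => g (i + 1)) (fun j => g (j + 1)) with hγ
  have hE : ∀ r v : ℕ → ℝ, r n = 0 →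
      (1 / n : ℝ) * ∑ x ∈ Finset.Icc 1 n, g x * (m x * v x ^ 2 / 2 + r x ^ 2 / 2) =
        ∑ k, γ k * (chainVec n m r v k) ^ 2 / 2 := by
    intro r v hr
    have h1 : ∑ x ∈ Finset.Icc 1 n, g x * (m x * v x ^ 2 / 2 + r x ^ 2 / 2) =
        ∑ x ∈ Finset.Icc 1 n, g x * (r x ^ 2 / 2) + ∑ x ∈ Finset.Icc 1 n, g x * (m x * v x ^ 2 / 2) := by
      rw [← Finset.sum_add_distrib]
      exact Finset.sum_congr rfl fun x _ => by ring
    rw [h1, sum_Icc_eq_sum_fin hn, hr, sum_Icc_one_eq_sum_range,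
      ← Fin.sum_univ_eq_sum_range (fun j => g (j + 1) * (m (j + 1) * v (j + 1) ^ 2 / 2)) n,
      Fintype.sum_sum_type, mul_add, mul_add, Finset.mul_sum, Finset.mul_sum]
    rw [show (1 / n : ℝ) * (g n * (0 ^ 2 / 2)) = 0 by ring, add_zero]
    congr 1
    · refine Finset.sum_congr rfl fun i _ => ?_
      simp only [hγ, chainVec, Sum.elim_inl, div_pow, Real.sq_sqrt (Nat.cast_nonneg n)]
      ring
    · refine Finset.sum_congr rfl fun j _ => ?_
      simp only [hγ, chainVec, Sum.elim_inr, mul_pow, div_pow, Real.sq_sqrt (Nat.cast_nonneg n),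
        Real.sq_sqrt (hm (j + 1) (by omega)).le]
      ring
  rw [hE r v hrn, hE r' v' hrn', ← Finset.sum_sub_distrib]
  set a := chainVec n m r v
  set b := chainVec n m r' v'
  have hγ' : ∀ k, |γ k| ≤ G := by
    rintro (i | j)
    · exact hg _ (by omega) (by omega)
    · exact hg _ (by omega) (by omega)
  have hG : 0 ≤ G := (abs_nonneg _).trans (hg 1 le_rfl hn)
  have h1 : |∑ k, (γ k * a k ^ 2 / 2 - γ k * b k ^ 2 / 2)| ≤
      G / 2 * ∑ k, |(a - b) k| * |(a + b) k| := by
    refine (Finset.abs_sum_le_sum_abs _ _).trans ?_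
    rw [Finset.mul_sum]
    refine Finset.sum_le_sum fun k _ => ?_
    have : γ k * a k ^ 2 / 2 - γ k * b k ^ 2 / 2 = γ k / 2 * ((a - b) k * (a + b) k) := by
      rw [PiLp.sub_apply, PiLp.add_apply]
      ring
    rw [this, abs_mul, abs_mul ((a - b) k), abs_div, abs_two]
    exact mul_le_mul_of_nonneg_right (by linarith [hγ' k]) (by positivity)
  have h2 : ∑ k, |(a - b) k| * |(a + b) k| ≤ ‖a - b‖ * ‖a + b‖ := by
    have := Real.sum_mul_le_sqrt_mul_sqrt Finset.univ (fun k => |(a - b) k|) (fun k => |(a + b) k|)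
    rw [EuclideanSpace.norm_eq (a - b), EuclideanSpace.norm_eq (a + b)]
    simpa only [Real.norm_eq_abs] using this
  refine h1.trans (mul_le_mul_of_nonneg_left (h2.trans ?_) (by linarith))
  exact mul_le_mul_of_nonneg_left (norm_add_le _ _) (norm_nonneg _)

end ChainFlow

/-! ### Consistency of the sampled macroscopic solution. -/

section Macro

/-- The projection of a time to `[0, T]`. -/
def clampTime (T s : ℝ) : ℝ := max 0 (min T s)

theorem clampTime_mem {T : ℝ} (hT : 0 ≤ T) (s : ℝ) : clampTime T s ∈ Icc 0 T :=
  ⟨le_max_left _ _, max_le hT (min_le_left _ _)⟩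

theorem clampTime_of_mem {T s : ℝ} (hs : s ∈ Icc 0 T) : clampTime T s = s := by
  rw [clampTime, min_eq_right hs.2, max_eq_right hs.1]

theorem continuous_clampTime (T : ℝ) : Continuous (clampTime T) :=
  continuous_const.max (continuous_const.min continuous_id)

/-- The time integral of `f y`, frozen outside `[0, T]`. -/
def timeInt (f : ℝ → ℝ → ℝ) (T y s : ℝ) : ℝ := ∫ σ in (0 : ℝ)..s, f y (clampTime T σ)

theorem timeInt_zero (f : ℝ → ℝ → ℝ) (T y : ℝ) : timeInt f T y 0 = 0 :=
  intervalIntegral.integral_same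

variable {T : ℝ} {f : ℝ → ℝ → ℝ}

theorem continuous_comp_clampTime (hT : 0 ≤ T)
    (hf : ContinuousOn (fun z : ℝ × ℝ => f z.1 z.2) (Icc 0 1 ×ˢ Icc 0 T)) {y : ℝ}
    (hy : y ∈ Icc (0 : ℝ) 1) : Continuous fun s => f y (clampTime T s) :=
  hf.comp_continuous (f := fun s => (y, clampTime T s))
    (continuous_const.prodMk (continuous_clampTime T)) fun s => ⟨hy, clampTime_mem hT s⟩

/-- Freezing the integrand outside `[0, T]` gives a derivative at every real time, as the abstract
comparison requires of `W`. -/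
theorem hasDerivAt_timeInt (hT : 0 ≤ T)
    (hf : ContinuousOn (fun z : ℝ × ℝ => f z.1 z.2) (Icc 0 1 ×ˢ Icc 0 T)) {y : ℝ}
    (hy : y ∈ Icc (0 : ℝ) 1) (s : ℝ) : HasDerivAt (timeInt f T y) (f y (clampTime T s)) s :=
  ((continuous_comp_clampTime hT hf hy).integral_hasStrictDerivAt 0 s).hasDerivAt

theorem timeInt_sub (hT : 0 ≤ T)
    (hf : ContinuousOn (fun z : ℝ × ℝ => f z.1 z.2) (Icc 0 1 ×ˢ Icc 0 T)) {a b s : ℝ}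
    (ha : a ∈ Icc (0 : ℝ) 1) (hb : b ∈ Icc (0 : ℝ) 1) (hs : s ∈ Icc 0 T) :
    timeInt f T b s - timeInt f T a s = ∫ σ in (0 : ℝ)..s, (f b σ - f a σ) := by
  rw [timeInt, timeInt, ← intervalIntegral.integral_sub
    ((continuous_comp_clampTime hT hf hb).intervalIntegrable _ _)
    ((continuous_comp_clampTime hT hf ha).intervalIntegrable _ _)]
  refine intervalIntegral.integral_congr fun σ hσ => ?_
  rw [uIcc_of_le hs.1] at hσ
  simp only [clampTime_of_mem ⟨hσ.1, hσ.2.trans hs.2⟩]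

theorem continuousOn_space
    (hf : ContinuousOn (fun z : ℝ × ℝ => f z.1 z.2) (Icc 0 1 ×ˢ Icc 0 T)) {s : ℝ}
    (hs : s ∈ Icc 0 T) : ContinuousOn (fun y => f y s) (Icc 0 1) :=
  hf.comp (f := fun y : ℝ => (y, s)) (by fun_prop) (fun _ hy => ⟨hy, hs⟩)

theorem exists_spacetime_modulus
    (hf : ContinuousOn (fun z : ℝ × ℝ => f z.1 z.2) (Icc 0 1 ×ˢ Icc 0 T)) {ε : ℝ} (hε : 0 < ε) :
    ∃ δ > 0, ∀ y ∈ Icc (0 : ℝ) 1, ∀ z ∈ Icc (0 : ℝ) 1, ∀ s ∈ Icc 0 T, ∀ s' ∈ Icc 0 T,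
      |y - z| ≤ δ → |s - s'| ≤ δ → |f y s - f z s'| ≤ ε := by
  have := (isCompact_Icc.prod isCompact_Icc).uniformContinuousOn_of_continuous hf
  obtain ⟨δ, hδ, h⟩ := Metric.uniformContinuousOn_iff.mp this ε hε
  refine ⟨δ / 2, half_pos hδ, fun y hy z hz s hs s' hs' hyz hss => ?_⟩
  refine (h (y, s) ⟨hy, hs⟩ (z, s') ⟨hz, hs'⟩ ?_).le
  rw [Prod.dist_eq, Real.dist_eq, Real.dist_eq]
  exact max_lt (by linarith) (by linarith)

theorem exists_spacetime_bound
    (hf : ContinuousOn (fun z : ℝ × ℝ => f z.1 z.2) (Icc 0 1 ×ˢ Icc 0 T)) :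
    ∃ M, 0 ≤ M ∧ ∀ y ∈ Icc (0 : ℝ) 1, ∀ s ∈ Icc 0 T, |f y s| ≤ M := by
  obtain ⟨M, hM⟩ := (isCompact_Icc.prod isCompact_Icc).exists_bound_of_continuousOn hf
  exact ⟨max M 0, le_max_right _ _, fun y hy s hs => (hM (y, s) ⟨hy, hs⟩).trans (le_max_left _ _)⟩

theorem abs_integral_sub_le_of_close {f : ℝ → ℝ} {a b c ε : ℝ} (hab : a ≤ b)
    (hf : ContinuousOn f (Icc a b)) (h : ∀ y ∈ Icc a b, |f y - c| ≤ ε) :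
    |(∫ y in a..b, f y) - (b - a) * c| ≤ ε * (b - a) := by
  have e1 : (b - a) * c = ∫ _ in a..b, c := by
    rw [intervalIntegral.integral_const, smul_eq_mul]
  have hi : IntervalIntegrable f volume a b := by
    apply ContinuousOn.intervalIntegrable
    rwa [uIcc_of_le hab]
  rw [e1, ← intervalIntegral.integral_sub hi intervalIntegrable_const, ← Real.norm_eq_abs]
  have := intervalIntegral.norm_integral_le_of_norm_le_const (f := fun y => f y - c) (C := ε)
    (a := a) (b := b) fun y hy => by
      rw [uIoc_of_le hab] at hy
      exact h y ⟨hy.1.le, hy.2⟩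
  rwa [abs_of_nonneg (sub_nonneg.mpr hab)] at this

variable {mbar : ℝ} {pbar rbar : ℝ → ℝ} {p r : ℝ → ℝ → ℝ}

/-- The elongation equation is consistent with the discrete one. -/
theorem consistency_elong (hT : 0 ≤ T) (hpr : IsMacroSolution T mbar pbar rbar p r) {n x : ℕ}
    (hx1 : 1 ≤ x) (hx : x < n) {s ε δ σ : ℝ} (hs : s ∈ Icc 0 T) (hσ : σ ∈ Icc (0 : ℝ) 1)
    (hmod : ∀ y ∈ Icc (0 : ℝ) 1, ∀ z ∈ Icc (0 : ℝ) 1, ∀ s ∈ Icc 0 T,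
      |y - z| ≤ δ → |r y s - r z s| ≤ ε)
    (hσx : |σ - x / n| ≤ δ / 2) (hn : (1 : ℝ) / n ≤ δ / 2) :
    |rbar (x / n) - r σ s +
      n * (timeInt p T ((x + 1 : ℕ) / n) s / mbar - timeInt p T (x / n) s / mbar)| ≤ 2 * ε := by
  have hn0 : (0 : ℝ) < n := by exact_mod_cast (by omega : 0 < n)
  have h0T : (0 : ℝ) ∈ Icc 0 T := ⟨le_rfl, hT⟩
  have ha := natCast_div_mem hx.le
  have hb := natCast_div_mem (Nat.succ_le_of_lt hx)
  have hba : (((x + 1 : ℕ) : ℝ) / n) - x / n = 1 / n := by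
    push_cast
    ring
  have hninv : (0 : ℝ) < 1 / n := by positivity
  set a : ℝ := x / n with hadef
  set b : ℝ := ((x + 1 : ℕ) : ℝ) / n with hbdef
  have hab : a ≤ b := by linarith
  have hsub : Icc a b ⊆ Icc (0 : ℝ) 1 := Icc_subset_Icc ha.1 hb.2
  have hcons := hpr.conservation_r a b s ha.1 hab hb.2 hs
  rw [intervalIntegral.integral_div, ← timeInt_sub hT hpr.continuousOn_p ha hb hs] at hcons
  have hσ' := abs_le.mp hσx
  have h1 := abs_integral_sub_le_of_close (c := r σ s) (ε := ε) hab
    ((continuousOn_space hpr.continuousOn_r hs).mono hsub) fun y hy =>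
      hmod y (hsub hy) σ hσ s hs (by rw [abs_le]; constructor <;> linarith [hy.1, hy.2])
  have h2 := abs_integral_sub_le_of_close (c := r a 0) (ε := ε) hab
    ((continuousOn_space hpr.continuousOn_r h0T).mono hsub) fun y hy =>
      hmod y (hsub hy) a ha 0 h0T (by rw [abs_le]; constructor <;> linarith [hy.1, hy.2])
  rw [← hpr.initial_r a ha, ← sub_div, ← hcons]
  rw [hba] at h1 h2
  -- The residual is `n` times the difference of two errors between a cell integral and its point
  -- value. Only uniform continuity in space is needed.
  have h3 : r a 0 - r σ s + n * ((∫ y in a..b, r y s) - ∫ y in a..b, r y 0) =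
      n * (((∫ y in a..b, r y s) - 1 / n * r σ s) - ((∫ y in a..b, r y 0) - 1 / n * r a 0)) := by
    field_simp
    ring
  rw [h3, abs_mul, abs_of_pos hn0]
  have h4 := (abs_sub _ _).trans (add_le_add h1 h2)
  calc n * _ ≤ n * (ε * (1 / n) + ε * (1 / n)) := mul_le_mul_of_nonneg_left h4 hn0.le
    _ = 2 * ε := by
      field_simp
      ring

variable {m : ℕ → ℝ} {m0 : ℝ}

/-- The momentum equation is consistent with the discrete one. -/
theorem consistency_velocity (hT : 0 ≤ T) (hpr : IsMacroSolution T mbar pbar rbar p r)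
    (h0 : 0 < m0) (hm : ∀ x, 1 ≤ x → m0 ≤ m x) {n x : ℕ} (hx1 : 1 ≤ x) (hx : x ≤ n)
    {s ε δ M e : ℝ} (hs : s ∈ Icc 0 T)
    (hmod : ∀ y ∈ Icc (0 : ℝ) 1, ∀ z ∈ Icc (0 : ℝ) 1, ∀ s ∈ Icc 0 T,
      |y - z| ≤ δ → |p y s - p z s| ≤ ε)
    (hM : ∀ y ∈ Icc (0 : ℝ) 1, ∀ s ∈ Icc 0 T, |p y s| ≤ M)
    (hnode : ∀ x ≤ n, |massNode m n x - x / n| ≤ δ / 2) (hn : (1 : ℝ) / n ≤ δ / 2)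
    (hκ : |n / massSum m n - 1 / mbar| ≤ ε) (he : |e| ≤ ε) (hε : 0 ≤ ε) :
    |pbar (x / n) / mbar - e - p (x / n) s / mbar +
      n * (timeInt r T (massNode m n x) s - timeInt r T (massNode m n (x - 1)) s) / m x| ≤
      ε * (1 + 2 * M + 2 / m0) := by
  have hn1 : 1 ≤ n := hx1.trans hx
  have hn0 : (0 : ℝ) < n := by exact_mod_cast hn1
  have h0T : (0 : ℝ) ∈ Icc 0 T := ⟨le_rfl, hT⟩
  obtain ⟨k, rfl⟩ : ∃ k, x = k + 1 := ⟨x - 1, by omega⟩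
  rw [Nat.add_sub_cancel]
  have hS := massSum_pos h0 hm hn1
  have hmx : 0 < m (k + 1) := h0.trans_le (hm _ hx1)
  have ha := massNode_mem h0 hm hn1 (by omega : k ≤ n)
  have hb := massNode_mem h0 hm hn1 hx
  have hab := massNode_mono h0 hm hn1 (Nat.le_succ k)
  have hba := massNode_succ_sub m n k
  have hia := abs_le.mp (hnode k (by omega))
  have hib := abs_le.mp (hnode (k + 1) hx)
  set a := massNode m n k
  set b := massNode m n (k + 1)
  have hy0 := natCast_div_mem hx
  have hyk : (((k + 1 : ℕ) : ℝ) / n) - k / n = 1 / n := by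
    push_cast
    ring
  set y0 : ℝ := ((k + 1 : ℕ) : ℝ) / n
  have hninv : (0 : ℝ) < 1 / n := by positivity
  have hsub : Icc a b ⊆ Icc (0 : ℝ) 1 := Icc_subset_Icc ha.1 hb.2
  have hcons := hpr.conservation_p a b s ha.1 hab hb.2 hs
  rw [← timeInt_sub hT hpr.continuousOn_r ha hb hs] at hcons
  have hclose : ∀ s ∈ Icc 0 T, |(∫ y in a..b, p y s) - (b - a) * p y0 s| ≤ ε * (b - a) :=
    fun s hs => abs_integral_sub_le_of_close hab
      ((continuousOn_space hpr.continuousOn_p hs).mono hsub) fun y hy =>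
        hmod y (hsub hy) y0 hy0 s hs (by rw [abs_le]; constructor <;> linarith [hy.1, hy.2])
  have h1 := hclose s hs
  have h2 := hclose 0 h0T
  rw [← hpr.initial_p y0 hy0, ← hcons]
  rw [hba] at h1 h2
  set I1 := ∫ y in a..b, p y s
  set I0 := ∫ y in a..b, p y 0
  set S := massSum m n
  -- Three errors: the momentum shift, the deviation of the total mass from its mean, and cell
  -- integrals against point values. The cell length `m (k + 1) / S` cancels the division by the
  -- mass.
  have e1 : p y0 0 / mbar - e - p y0 s / mbar + n * (I1 - I0) / m (k + 1) =
      -e + (n / S - 1 / mbar) * (p y0 s - p y0 0) +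
        n / m (k + 1) * ((I1 - m (k + 1) / S * p y0 s) - (I0 - m (k + 1) / S * p y0 0)) := by
    field_simp
    ring
  have h3 : |p y0 s - p y0 0| ≤ 2 * M :=
    (abs_sub _ _).trans (by linarith [hM y0 hy0 s hs, hM y0 hy0 0 h0T])
  have hM0 : 0 ≤ M := (abs_nonneg _).trans (hM y0 hy0 0 h0T)
  have h4 : |(n / S - 1 / mbar) * (p y0 s - p y0 0)| ≤ ε * (2 * M) := by
    rw [abs_mul]
    exact mul_le_mul hκ h3 (abs_nonneg _) hε
  have h5 : |n / m (k + 1) * ((I1 - m (k + 1) / S * p y0 s) - (I0 - m (k + 1) / S * p y0 0))| ≤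
      ε * (2 / m0) := by
    rw [abs_mul, abs_of_pos (div_pos hn0 hmx)]
    have h6 := (abs_sub _ _).trans (add_le_add h1 h2)
    calc n / m (k + 1) * _ ≤ n / m (k + 1) * (ε * (m (k + 1) / S) + ε * (m (k + 1) / S)) :=
          mul_le_mul_of_nonneg_left h6 (div_pos hn0 hmx).le
      _ = 2 * ε * (n / S) := by
          field_simp
          ring
      _ ≤ 2 * ε * (1 / m0) := by
          refine mul_le_mul_of_nonneg_left ?_ (by linarith)
          rw [div_le_div_iff₀ hS h0, one_mul, mul_comm]
          exact le_massSum hm n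
      _ = ε * (2 / m0) := by ring
  rw [e1]
  refine (abs_add_three _ _ _).trans ?_
  rw [abs_neg]
  linarith

end Macro

/-! ### Convergence of the mean trajectory in the energy norm. -/

section Limit

theorem exists_lipschitz_of_contDiffOn {f : ℝ → ℝ} (hf : ContDiffOn ℝ 1 f (Icc 0 1)) :
    ∃ L, 0 ≤ L ∧ ∀ y ∈ Icc (0 : ℝ) 1, ∀ z ∈ Icc (0 : ℝ) 1, |f y - f z| ≤ L * |y - z| := by
  have hc : ContinuousOn (derivWithin f (Icc 0 1)) (Icc 0 1) :=
    hf.continuousOn_derivWithin (uniqueDiffOn_Icc one_pos) le_rfl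
  obtain ⟨L, hL⟩ := isCompact_Icc.exists_bound_of_continuousOn hc
  refine ⟨max L 0, le_max_right _ _, fun y hy z hz => ?_⟩
  have := Convex.norm_image_sub_le_of_norm_derivWithin_le (hf.differentiableOn one_ne_zero)
    (fun x hx => (hL x hx).trans (le_max_left L 0)) (convex_Icc 0 1) hz hy
  simpa only [Real.norm_eq_abs] using this

/-- The parameters in `norm_sub_le_of_consistent` can be chosen so that the bound is small. -/
theorem exists_small_parameters {T C η δ : ℝ} (hη : 0 < η) (hT : 0 < T)
    (hδ : 0 < δ) : ∃ h > 0, 2 * h ≤ T ∧ h ≤ δ ∧ ∃ ε > 0,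
      h * (η / 2 + √(2 * h * (C * C) + 4 * (C * ε))) + 2 * √(T * ε ^ 2 * Real.exp T) < h * η := by
  -- The window `h` is fixed before `ε`, because the last term becomes of order `ε / h` once the
  -- inequality is divided by `h`.
  have h1 : ∀ᶠ h in 𝓝[>] (0 : ℝ), √(2 * h * (C * C)) < η / 2 := by
    have hc : Tendsto (fun h : ℝ => √(2 * h * (C * C))) (𝓝[>] 0) (𝓝 √(2 * 0 * (C * C))) :=
      (Continuous.tendsto (by fun_prop) 0).mono_left nhdsWithin_le_nhds
    simp only [mul_zero, zero_mul, Real.sqrt_zero] at hc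
    exact hc.eventually_lt_const (half_pos hη)
  have h2 : ∀ᶠ h in 𝓝[>] (0 : ℝ), h ≤ min (T / 2) δ :=
    (eventually_le_nhds (lt_min (half_pos hT) hδ)).filter_mono nhdsWithin_le_nhds
  obtain ⟨h, hh1, hh2, hh0⟩ := (h1.and (h2.and self_mem_nhdsWithin)).exists
  have hh0' : 0 < h := hh0
  refine ⟨h, hh0', by linarith [hh2.trans (min_le_left _ _)], hh2.trans (min_le_right _ _), ?_⟩
  have h3 : Tendsto (fun ε : ℝ => h * (η / 2 + √(2 * h * (C * C) + 4 * (C * ε))) +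
      2 * √(T * ε ^ 2 * Real.exp T)) (𝓝[>] 0) (𝓝 (h * (η / 2 + √(2 * h * (C * C) + 4 * (C * 0))) +
      2 * √(T * 0 ^ 2 * Real.exp T))) :=
    (Continuous.tendsto (by fun_prop) 0).mono_left nhdsWithin_le_nhds
  have h4 : h * (η / 2 + √(2 * h * (C * C) + 4 * (C * 0))) + 2 * √(T * 0 ^ 2 * Real.exp T) <
      h * η := by
    simp only [mul_zero, add_zero, ne_eq, OfNat.ofNat_ne_zero, not_false_eq_true, zero_pow,
      zero_mul, Real.sqrt_zero]
    exact mul_lt_mul_of_pos_left (by linarith) hh0'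
  obtain ⟨ε, hε, hε0⟩ := ((h3.eventually_lt_const h4).and self_mem_nhdsWithin).exists
  exact ⟨ε, hε0, hε⟩

variable {m : ℕ → ℝ} {m0 m1 mbar T : ℝ} {pbar rbar β : ℝ → ℝ} {p r : ℝ → ℝ → ℝ}

/-- The trajectory of the means, in energy coordinates and macroscopic time. -/
def microVec (m : ℕ → ℝ) (R Q : ℕ → ℕ → ℝ → ℝ) (n : ℕ) (s : ℝ) : ChainSpace n :=
  chainVec n m (fun x => R n x (n * s)) (fun x => Q n x (n * s) / m x)

/-- The macroscopic solution sampled along the chain, in energy coordinates. -/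
def macroVec (m : ℕ → ℝ) (mbar T : ℝ) (p r : ℝ → ℝ → ℝ) (n : ℕ) (s : ℝ) : ChainSpace n :=
  chainVec n m (fun x => r (massNode m n x) (clampTime T s))
    (fun x => p (x / n) (clampTime T s) / mbar)

/-- The classical equations of motion of the chain, with the mean initial data of the locally
Gibbs state. -/
structure IsMeanTrajectory (n : ℕ) (m : ℕ → ℝ) (mbar : ℝ) (β pbar rbar : ℝ → ℝ)
    (R Q : ℕ → ℝ → ℝ) : Prop where
  deriv_momentum : ∀ x ∈ Finset.Icc 1 n, ∀ τ, HasDerivAt (Q x) (R x τ - R (x - 1) τ) τ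
  deriv_elong : ∀ x, 1 ≤ x → x < n → ∀ τ,
    HasDerivAt (R x) (Q (x + 1) τ / m (x + 1) - Q x τ / m x) τ
  boundary_left : ∀ τ, R 0 τ = 0
  boundary_right : ∀ τ, R n τ = 0
  initial_elong : ∀ x, 1 ≤ x → x < n → R x 0 = rbar (x / n)
  initial_momentum : ∀ x ∈ Finset.Icc 1 n, Q x 0 = m x / mbar * pbar (x / n) -
    momentumShift n m mbar β pbar * (m x / β (x / n))

variable {R Q : ℕ → ℕ → ℝ → ℝ}

theorem hasDerivAt_microVec (hm : ∀ x, 1 ≤ x → 0 < m x) {n : ℕ} (hn : 1 ≤ n)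
    (htraj : IsMeanTrajectory n m mbar β pbar rbar (R n) (Q n)) (s : ℝ) :
    HasDerivAt (microVec m R Q n) (chainGen n m (microVec m R Q n s)) s := by
  have hl : HasDerivAt (fun s : ℝ => (n : ℝ) * s) n s := by
    simpa using (hasDerivAt_id s).const_mul (n : ℝ)
  rw [microVec, chainGen_chainVec hn hm (htraj.boundary_left _) (htraj.boundary_right _)]
  apply hasDerivAt_chainVec
  · intro x hx hxn
    refine ((htraj.deriv_elong x hx hxn (n * s)).comp s hl).congr_deriv ?_
    ring
  · intro x hx hxn
    have := htraj.deriv_momentum x (Finset.mem_Icc.mpr ⟨hx, hxn⟩) (n * s)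
    refine ((this.comp s hl).div_const (m x)).congr_deriv ?_
    ring

theorem norm_macroVec_le (h0 : 0 < m0) (hm : ∀ x, 1 ≤ x → m0 ≤ m x) (hm1 : ∀ x, 1 ≤ x → m x ≤ m1)
    (hmbar : 0 < mbar) (hT : 0 ≤ T) {M : ℝ}
    (hp : ∀ y ∈ Icc (0 : ℝ) 1, ∀ s ∈ Icc 0 T, |p y s| ≤ M)
    (hr : ∀ y ∈ Icc (0 : ℝ) 1, ∀ s ∈ Icc 0 T, |r y s| ≤ M) {n : ℕ} (hn : 1 ≤ n) (s : ℝ) :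
    ‖macroVec m mbar T p r n s‖ ≤ √(1 + m1) * (M + M / mbar) := by
  have hs := clampTime_mem hT s
  have hM : 0 ≤ M := (abs_nonneg _).trans (hp 0 ⟨le_rfl, zero_le_one⟩ _ hs)
  refine norm_chainVec_le hn (fun x hx => h0.trans_le (hm x hx)) hm1 (fun x hx hxn => ?_)
    fun x hx hxn => ?_
  · exact (hr _ (massNode_mem h0 hm hn hxn.le) _ hs).trans (le_add_of_nonneg_right (by positivity))
  · rw [abs_div, abs_of_pos hmbar]
    exact (div_le_div_of_nonneg_right (hp _ (natCast_div_mem hxn) _ hs) hmbar.le).trans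
      (le_add_of_nonneg_left hM)

theorem norm_macroVec_sub_le (h0 : 0 < m0) (hm : ∀ x, 1 ≤ x → m0 ≤ m x)
    (hm1 : ∀ x, 1 ≤ x → m x ≤ m1) (hmbar : 0 < mbar) {s t κ : ℝ} (hs : s ∈ Icc 0 T)
    (ht : t ∈ Icc 0 T) (hp : ∀ y ∈ Icc (0 : ℝ) 1, |p y s - p y t| ≤ κ)
    (hr : ∀ y ∈ Icc (0 : ℝ) 1, |r y s - r y t| ≤ κ) {n : ℕ} (hn : 1 ≤ n) :
    ‖macroVec m mbar T p r n s - macroVec m mbar T p r n t‖ ≤ √(1 + m1) * (κ + κ / mbar) := by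
  have hκ : 0 ≤ κ := (abs_nonneg _).trans (hp 0 ⟨le_rfl, zero_le_one⟩)
  rw [macroVec, macroVec, chainVec_sub, clampTime_of_mem hs, clampTime_of_mem ht]
  refine norm_chainVec_le hn (fun x hx => h0.trans_le (hm x hx)) hm1 (fun x hx hxn => ?_)
    fun x hx hxn => ?_
  · exact (hr _ (massNode_mem h0 hm hn hxn.le)).trans (le_add_of_nonneg_right (by positivity))
  · rw [← sub_div, abs_div, abs_of_pos hmbar]
    exact (div_le_div_of_nonneg_right (hp _ (natCast_div_mem hxn)) hmbar.le).trans
      (le_add_of_nonneg_left hκ)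

-- All hypotheses of `norm_sub_le_of_consistent` are verified with constants independent of `n`. The
-- choices are made in the order `η`, `κ`, `h`, `ε`, `ε'`, `δ`, and finally `n` large.
set_option maxHeartbeats 1000000 in
theorem tendsto_microVec_sub_macroVec (h0 : 0 < m0) (hm : ∀ x, 1 ≤ x → m0 ≤ m x)
    (hm1 : ∀ x, 1 ≤ x → m x ≤ m1) (hmbar : 0 < mbar)
    (hlim : Tendsto (fun n : ℕ => massSum m n / n) atTop (𝓝 mbar))
    (hpbar : ContDiffOn ℝ 1 pbar (Icc 0 1)) (hrbar : ContDiffOn ℝ 1 rbar (Icc 0 1))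
    (hrbar0 : rbar 0 = 0) (hrbar1 : rbar 1 = 0) (hpbar_int : ∫ y in (0 : ℝ)..1, pbar y = 0)
    (hβ : ContinuousOn β (Icc 0 1)) (hβ_pos : ∀ y ∈ Icc (0 : ℝ) 1, 0 < β y) (hT : 0 < T)
    (hpr : IsMacroSolution T mbar pbar rbar p r)
    (htraj : ∀ n, 1 ≤ n → IsMeanTrajectory n m mbar β pbar rbar (R n) (Q n))
    {t : ℝ} (ht : t ∈ Icc 0 T) :
    Tendsto (fun n => ‖microVec m R Q n t - macroVec m mbar T p r n t‖) atTop (𝓝 0) := by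
  have hm' : ∀ x, 1 ≤ x → 0 < m x := fun x hx => h0.trans_le (hm x hx)
  have h0T : (0 : ℝ) ∈ Icc 0 T := ⟨le_rfl, hT.le⟩
  obtain ⟨Lp, hLp0, hLp⟩ := exists_lipschitz_of_contDiffOn hpbar
  obtain ⟨Lr, hLr0, hLr⟩ := exists_lipschitz_of_contDiffOn hrbar
  obtain ⟨Mp, hMp0, hMp⟩ := exists_spacetime_bound hpr.continuousOn_p
  obtain ⟨Mr, hMr0, hMr⟩ := exists_spacetime_bound hpr.continuousOn_r
  obtain ⟨b, hb, hβb⟩ : ∃ b > 0, ∀ y ∈ Icc (0 : ℝ) 1, b ≤ β y := by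
    obtain ⟨y, hy, hmin⟩ := isCompact_Icc.exists_isMinOn ⟨0, by simp⟩ hβ
    exact ⟨β y, hβ_pos y hy, fun z hz => hmin hz⟩
  have hsq : 0 < √(1 + m1) := Real.sqrt_pos.mpr (by linarith [hm' 1 le_rfl, hm1 1 le_rfl])
  set D := √(1 + m1) with hD
  -- Covers the factors of both consistency estimates.
  set K := 2 + (1 + 2 * Mp + 2 / m0) with hK
  have hK2 : 2 ≤ K := by
    have : 0 ≤ 2 / m0 := by positivity
    linarith
  have hK1 : 1 ≤ K := by linarith
  -- Bounds the initial vector and the generator applied to its regular part at once; the summand 1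
  -- pays for the momentum shift, which is at most `ε' ≤ 1`.
  set C := D * (Mr + (Mp / mbar + 1) + (Lp / mbar + Lr / m0)) with hC
  rw [Metric.tendsto_nhds]
  intro η hη
  -- The oscillation allowed to `p` and `r` within time `h`, so that the sampled solution moves by
  -- at most `η / 2`.
  set κ := η / 2 / (D * (1 + 1 / mbar)) with hκ
  have hκ0 : 0 < κ := by positivity
  have hκ' : D * (κ + κ / mbar) = η / 2 := by
    rw [hκ]
    field_simp
  obtain ⟨δp, hδp, hmodp⟩ := exists_spacetime_modulus hpr.continuousOn_p hκ0
  obtain ⟨δr, hδr, hmodr⟩ := exists_spacetime_modulus hpr.continuousOn_r hκ0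
  obtain ⟨h, hh0, hhT, hhδ, ε, hε, hfin⟩ := exists_small_parameters (C := C) hη hT (lt_min hδp hδr)
  set ε' := min 1 (ε / (D * K)) with hε'
  have hK0 : 0 < K := by linarith
  have hε'0 : 0 < ε' := lt_min one_pos (by positivity)
  have hε'1 : ε' ≤ 1 := min_le_left _ _
  have hε'ε : D * (ε' * K) ≤ ε := by
    have : ε' ≤ ε / (D * K) := min_le_right _ _
    rw [le_div_iff₀ (by positivity)] at this
    linarith
  obtain ⟨δ1, hδ1, hmod1⟩ := exists_spacetime_modulus hpr.continuousOn_p hε'0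
  obtain ⟨δ2, hδ2, hmod2⟩ := exists_spacetime_modulus hpr.continuousOn_r hε'0
  set δ := min δ1 δ2 with hδ
  have hδ0 : 0 < δ := lt_min hδ1 hδ2
  have hmod1' : ∀ y ∈ Icc (0 : ℝ) 1, ∀ z ∈ Icc (0 : ℝ) 1, ∀ s ∈ Icc 0 T,
      |y - z| ≤ δ → |p y s - p z s| ≤ ε' := fun y hy z hz s hs hyz =>
    hmod1 y hy z hz s hs s hs (hyz.trans (min_le_left _ _)) (by simpa using hδ1.le)
  have hmod2' : ∀ y ∈ Icc (0 : ℝ) 1, ∀ z ∈ Icc (0 : ℝ) 1, ∀ s ∈ Icc 0 T,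
      |y - z| ≤ δ → |r y s - r z s| ≤ ε' := fun y hy z hz s hs hyz =>
    hmod2 y hy z hz s hs s hs (hyz.trans (min_le_right _ _)) (by simpa using hδ2.le)
  have hinv : ∀ᶠ n : ℕ in atTop, (1 : ℝ) / n < δ / 2 :=
    (tendsto_one_div_atTop_nhds_zero_nat (𝕜 := ℝ)).eventually_lt_const (half_pos hδ0)
  have hκlim : ∀ᶠ n : ℕ in atTop, |n / massSum m n - 1 / mbar| < ε' := by
    have h1 : Tendsto (fun n : ℕ => n / massSum m n) atTop (𝓝 (1 / mbar)) := by
      have := hlim.inv₀ hmbar.ne'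
      rw [one_div]
      exact this.congr fun n => inv_div _ _
    exact Metric.tendsto_nhds.mp h1 ε' hε'0
  have hshift : ∀ᶠ n : ℕ in atTop, |momentumShift n m mbar β pbar| < ε' * b := by
    have h1 := tendsto_momentumShift h0 hm hmbar hlim hpbar.continuousOn hpbar_int hβ hβ_pos
    have h2 := Metric.tendsto_nhds.mp h1 (ε' * b) (by positivity)
    simpa only [Real.dist_eq, sub_zero] using h2
  filter_upwards [eventually_massNode_sub_le h0 hm hlim (half_pos hδ0), hinv, hκlim, hshift,
    eventually_ge_atTop 1] with n hnode hinv hκn hshift hn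
  have hn0 : (0 : ℝ) < n := by exact_mod_cast hn
  have hu := hasDerivAt_microVec hm' hn (htraj n hn)
  have htr := htraj n hn
  set W : ℝ → ChainSpace n := fun s => chainVec n m (fun x => timeInt r T (massNode m n x) s)
    (fun x => timeInt p T (x / n) s / mbar) with hW
  -- The initial data without the momentum shift. The shift involves `β`, which is only continuous,
  -- so its difference quotients need not be bounded; those of `rbar` and `pbar` are.
  set w : ChainSpace n := chainVec n m (fun x => rbar (x / n)) (fun x => pbar (x / n) / mbar)
    with hw
  have hWd : ∀ s, HasDerivAt W (macroVec m mbar T p r n s) s := fun s =>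
    hasDerivAt_chainVec
      (fun x _ hxn => hasDerivAt_timeInt hT.le hpr.continuousOn_r (massNode_mem h0 hm hn hxn.le) s)
      (fun x _ hxn => (hasDerivAt_timeInt hT.le hpr.continuousOn_p (natCast_div_mem hxn) s).div_const
        mbar)
  have hW0 : W 0 = 0 := by
    simp only [hW, timeInt_zero, zero_div]
    exact chainVec_zero
  -- The end nodes are exactly 0 and 1, so `W` inherits the boundary conditions that
  -- `chainGen_chainVec` needs.
  have hr0 : ∀ s, timeInt r T 0 s = 0 := fun s => by
    simp only [timeInt, hpr.boundary_left _ (clampTime_mem hT.le _), intervalIntegral.integral_zero]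
  have hr1 : ∀ s, timeInt r T 1 s = 0 := fun s => by
    simp only [timeInt, hpr.boundary_right _ (clampTime_mem hT.le _),
      intervalIntegral.integral_zero]
  have hshift' : ∀ x ≤ n, |momentumShift n m mbar β pbar / β (x / n)| ≤ ε' := by
    intro x hx
    have hβx := hβb _ (natCast_div_mem hx)
    rw [abs_div, abs_of_pos (hb.trans_le hβx), div_le_iff₀ (hb.trans_le hβx)]
    exact hshift.le.trans (mul_le_mul_of_nonneg_left hβx hε'0.le)
  have hu0 : microVec m R Q n 0 = chainVec n m (fun x => rbar (x / n))
      (fun x => pbar (x / n) / mbar - momentumShift n m mbar β pbar / β (x / n)) := by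
    apply chainVec_congr
    · intro x hx hxn
      rw [mul_zero]
      exact htr.initial_elong x hx hxn
    · intro x hx hxn
      rw [mul_zero, htr.initial_momentum x (Finset.mem_Icc.mpr ⟨hx, hxn⟩)]
      have := (hm' x hx).ne'
      field_simp
  have hρ : ∀ s ∈ Icc 0 T,
      ‖microVec m R Q n 0 - macroVec m mbar T p r n s + chainGen n m (W s)‖ ≤ ε := by
    intro s hs
    rw [hu0, macroVec, clampTime_of_mem hs, hW, chainGen_chainVec hn hm'
      (by rw [massNode_zero, hr0]) (by rw [massNode_self h0 hm hn, hr1]), chainVec_sub, chainVec_add]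
    refine (norm_chainVec_le hn hm' hm1 (a := ε' * K) (fun x hx hxn => ?_)
      fun x hx hxn => ?_).trans hε'ε
    · refine (consistency_elong hT.le hpr hx hxn hs (massNode_mem h0 hm hn hxn.le) hmod2'
        (hnode x hxn.le) hinv.le).trans ?_
      rw [mul_comm 2 ε']
      exact mul_le_mul_of_nonneg_left hK2 hε'0.le
    · refine (consistency_velocity hT.le hpr h0 hm hx hxn hs hmod1' hMp hnode hinv.le hκn.le
        (hshift' x hxn) hε'0.le).trans ?_
      exact mul_le_mul_of_nonneg_left (by rw [hK]; linarith) hε'0.le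
  have hpart : 0 ≤ Mr ∧ 0 ≤ Mp / mbar ∧ 0 ≤ Lp / mbar ∧ 0 ≤ Lr / m0 :=
    ⟨hMr0, by positivity, by positivity, by positivity⟩
  have hCu : ‖microVec m R Q n 0‖ ≤ C := by
    rw [hu0]
    refine norm_chainVec_le hn hm' hm1 (fun x hx hxn => ?_) fun x hx hxn => ?_
    · rw [← hpr.initial_r _ (natCast_div_mem hxn.le)]
      linarith [hMr _ (natCast_div_mem hxn.le) 0 h0T]
    · have h1 := abs_sub (pbar (x / n) / mbar) (momentumShift n m mbar β pbar / β (x / n))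
      have h2 : |pbar (x / n) / mbar| ≤ Mp / mbar := by
        rw [← hpr.initial_p _ (natCast_div_mem hxn), abs_div, abs_of_pos hmbar]
        exact div_le_div_of_nonneg_right (hMp _ (natCast_div_mem hxn) 0 h0T) hmbar.le
      linarith [hshift' x hxn]
  have hAw : ‖chainGen n m w‖ ≤ C := by
    rw [hw, chainGen_chainVec hn hm' (by simpa using hrbar0)
      (by rw [div_self hn0.ne']; exact hrbar1)]
    refine norm_chainVec_le hn hm' hm1 (fun x hx hxn => ?_) fun x hx hxn => ?_
    · have h1 := hLp _ (natCast_div_mem (Nat.succ_le_of_lt hxn)) _ (natCast_div_mem hxn.le)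
      have h2 : (((x + 1 : ℕ) : ℝ) / n) - x / n = 1 / n := by
        push_cast
        ring
      rw [h2, abs_of_pos (by positivity : (0 : ℝ) < 1 / n)] at h1
      rw [← sub_div, abs_mul, abs_div, abs_of_pos hn0, abs_of_pos hmbar]
      have h3 : n * (|pbar (((x + 1 : ℕ) : ℝ) / n) - pbar (x / n)| / mbar) ≤ Lp / mbar := by
        rw [← mul_div_assoc]
        refine div_le_div_of_nonneg_right ?_ hmbar.le
        calc n * _ ≤ n * (Lp * (1 / n)) := mul_le_mul_of_nonneg_left h1 hn0.le
          _ = Lp := by field_simp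
      linarith
    · have h1 := hLr _ (natCast_div_mem hxn) _ (natCast_div_mem ((Nat.sub_le x 1).trans hxn))
      have h2 : ((x : ℝ) / n) - ((x - 1 : ℕ) : ℝ) / n = 1 / n := by
        rw [Nat.cast_sub hx]
        push_cast
        ring
      rw [h2, abs_of_pos (by positivity : (0 : ℝ) < 1 / n)] at h1
      rw [abs_div, abs_mul, abs_of_pos hn0, abs_of_pos (hm' x hx)]
      have h3 : n * |rbar (x / n) - rbar (((x - 1 : ℕ) : ℝ) / n)| / m x ≤ Lr / m0 := by
        refine div_le_div₀ hLr0 ?_ h0 (hm x hx)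
        calc n * _ ≤ n * (Lr * (1 / n)) := mul_le_mul_of_nonneg_left h1 hn0.le
          _ = Lr := by field_simp
      linarith
  have huw : ‖microVec m R Q n 0 - w‖ ≤ ε := by
    rw [hu0, hw, chainVec_sub]
    refine (norm_chainVec_le hn hm' hm1 (a := ε' * K) (fun x hx hxn => ?_)
      fun x hx hxn => ?_).trans hε'ε
    · rw [sub_self, abs_zero]
      positivity
    · rw [sub_sub_cancel_left, abs_neg]
      exact (hshift' x hxn).trans (le_mul_of_one_le_right hε'0.le hK1)
  have hUmod : ∀ s ∈ Icc 0 T, |s - t| ≤ h →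
      ‖macroVec m mbar T p r n s - macroVec m mbar T p r n t‖ ≤ η / 2 := by
    intro s hs hst
    rw [← hκ']
    have hst' := hst.trans hhδ
    refine norm_macroVec_sub_le h0 hm hm1 hmbar hs ht (fun y hy => ?_) (fun y hy => ?_) hn
    · exact hmodp y hy y hy s hs t ht (by simpa using hδp.le) (hst'.trans (min_le_left _ _))
    · exact hmodr y hy y hy s hs t ht (by simpa using hδr.le) (hst'.trans (min_le_right _ _))
  have hfinal := norm_sub_le_of_consistent chainGen_skew hu hWd hW0 hρ hCu hAw huw hh0 hhT hUmod ht
  rw [Real.dist_eq, sub_zero, abs_norm]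
  exact lt_of_mul_lt_mul_left (hfinal.trans_lt hfin) hh0.le

end Limit

/-! ### Convergence of the mechanical energy. -/

section Energy

variable {m : ℕ → ℝ} {m0 m1 mbar T : ℝ} {pbar rbar β : ℝ → ℝ} {p r : ℝ → ℝ → ℝ}
  {R Q : ℕ → ℕ → ℝ → ℝ}

theorem exists_abs_bound {g : ℝ → ℝ} (hg : ContinuousOn g (Icc 0 1)) :
    ∃ G, 0 < G ∧ ∀ y ∈ Icc (0 : ℝ) 1, |g y| ≤ G := by
  obtain ⟨G, hG⟩ := isCompact_Icc.exists_bound_of_continuousOn hg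
  exact ⟨max G 1, lt_max_of_lt_right one_pos, fun y hy => (hG y hy).trans (le_max_left _ _)⟩

theorem tendsto_riemann_massNode (h0 : 0 < m0) (hm : ∀ x, 1 ≤ x → m0 ≤ m x)
    (hlim : Tendsto (fun n : ℕ => massSum m n / n) atTop (𝓝 mbar)) {g f : ℝ → ℝ}
    (hg : ContinuousOn g (Icc 0 1)) (hf : ContinuousOn f (Icc 0 1)) :
    Tendsto (fun n : ℕ => (1 / n : ℝ) * ∑ x ∈ Finset.Icc 1 n, g (x / n) * f (massNode m n x)) atTop
      (𝓝 (∫ y in (0 : ℝ)..1, g y * f y)) := by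
  obtain ⟨G, hG0, hG⟩ := exists_abs_bound hg
  have h1 := tendsto_riemann (hg.mul hf)
  have h2 : Tendsto (fun n : ℕ => (1 / n : ℝ) * ∑ x ∈ Finset.Icc 1 n,
      g (x / n) * (f (massNode m n x) - f (x / n))) atTop (𝓝 0) := by
    rw [Metric.tendsto_nhds]
    intro ε hε
    obtain ⟨δ, hδ, hmod⟩ := exists_modulus hf (ε := ε / (2 * G)) (by positivity)
    filter_upwards [eventually_massNode_sub_le h0 hm hlim hδ, eventually_ge_atTop 1] with n hn hn1
    have hn0 : (0 : ℝ) < n := by exact_mod_cast hn1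
    rw [Real.dist_eq, sub_zero, abs_mul, abs_of_pos (by positivity : (0 : ℝ) < 1 / n)]
    have h3 : |∑ x ∈ Finset.Icc 1 n, g (x / n) * (f (massNode m n x) - f (x / n))| ≤
        ∑ _x ∈ Finset.Icc 1 n, ε / 2 := by
      refine (Finset.abs_sum_le_sum_abs _ _).trans (Finset.sum_le_sum fun x hx => ?_)
      rw [Finset.mem_Icc] at hx
      have hy := natCast_div_mem hx.2
      rw [abs_mul]
      calc |g (x / n)| * |f (massNode m n x) - f (x / n)| ≤ G * (ε / (2 * G)) :=
            mul_le_mul (hG _ hy) (hmod _ (massNode_mem h0 hm hn1 hx.2) _ hy (hn x hx.2))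
              (abs_nonneg _) hG0.le
        _ = ε / 2 := by field_simp
    rw [Finset.sum_const, Nat.card_Icc, Nat.add_sub_cancel, nsmul_eq_mul] at h3
    calc 1 / (n : ℝ) * _ ≤ 1 / n * (n * (ε / 2)) := mul_le_mul_of_nonneg_left h3 (by positivity)
      _ = ε / 2 := by field_simp
      _ < ε := half_lt_self hε
  have h3 := h1.add h2
  rw [add_zero] at h3
  refine h3.congr fun n => ?_
  rw [← mul_add, ← Finset.sum_add_distrib]
  congr 1
  exact Finset.sum_congr rfl fun x _ => by simp only [Pi.mul_apply]; ring

/-- The mechanical energy of the means converges to the macroscopic one. -/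
theorem tendsto_mechanical_energy (h0 : 0 < m0) (hm : ∀ x, 1 ≤ x → m0 ≤ m x)
    (hm1 : ∀ x, 1 ≤ x → m x ≤ m1) (hmbar : 0 < mbar)
    (hlim : Tendsto (fun n : ℕ => massSum m n / n) atTop (𝓝 mbar))
    (hpbar : ContDiffOn ℝ 1 pbar (Icc 0 1)) (hrbar : ContDiffOn ℝ 1 rbar (Icc 0 1))
    (hrbar0 : rbar 0 = 0) (hrbar1 : rbar 1 = 0) (hpbar_int : ∫ y in (0 : ℝ)..1, pbar y = 0)
    (hβ : ContinuousOn β (Icc 0 1)) (hβ_pos : ∀ y ∈ Icc (0 : ℝ) 1, 0 < β y) (hT : 0 < T)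
    (hpr : IsMacroSolution T mbar pbar rbar p r)
    (htraj : ∀ n, 1 ≤ n → IsMeanTrajectory n m mbar β pbar rbar (R n) (Q n))
    {g : ℝ → ℝ} (hg : ContinuousOn g (Icc 0 1)) {t : ℝ} (ht : t ∈ Icc 0 T) :
    Tendsto (fun n : ℕ => (1 / n : ℝ) * ∑ x ∈ Finset.Icc 1 n,
        g (x / n) * (Q n x (n * t) ^ 2 / (2 * m x) + R n x (n * t) ^ 2 / 2)) atTop
      (𝓝 (∫ y in (0 : ℝ)..1, g y * (p y t ^ 2 / (2 * mbar) + r y t ^ 2 / 2))) := by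
  have hm' : ∀ x, 1 ≤ x → 0 < m x := fun x hx => h0.trans_le (hm x hx)
  obtain ⟨G, hG0, hG⟩ := exists_abs_bound hg
  obtain ⟨Mp, hMp0, hMp⟩ := exists_spacetime_bound hpr.continuousOn_p
  obtain ⟨Mr, hMr0, hMr⟩ := exists_spacetime_bound hpr.continuousOn_r
  have hdiff := tendsto_microVec_sub_macroVec h0 hm hm1 hmbar hlim hpbar hrbar hrbar0 hrbar1
    hpbar_int hβ hβ_pos hT hpr htraj ht
  have hpt := continuousOn_space hpr.continuousOn_p ht
  have hrt := continuousOn_space hpr.continuousOn_r ht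
  have hsample : Tendsto (fun n : ℕ => (1 / n : ℝ) * ∑ x ∈ Finset.Icc 1 n,
      g (x / n) * (m x * (p (x / n) t / mbar) ^ 2 / 2 + r (massNode m n x) t ^ 2 / 2)) atTop
      (𝓝 (∫ y in (0 : ℝ)..1, g y * (p y t ^ 2 / (2 * mbar) + r y t ^ 2 / 2))) := by
    -- The kinetic part is a mass-weighted Riemann sum: the masses average to `mbar`, which leaves
    -- `p ^ 2 / mbar`. The elastic part is sampled at mass nodes and needs no weight.
    have hf1 : ContinuousOn (fun y => g y * ((p y t / mbar) ^ 2 / 2)) (Icc 0 1) :=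
      hg.mul (((hpt.div_const mbar).pow 2).div_const 2)
    have hf2 : ContinuousOn (fun y => r y t ^ 2 / 2) (Icc 0 1) := (hrt.pow 2).div_const 2
    have h1 := (tendsto_mass_riemann h0 hm hlim hf1).add
      (tendsto_riemann_massNode h0 hm hlim hg hf2)
    have hi1 : IntervalIntegrable (fun y => mbar * (g y * ((p y t / mbar) ^ 2 / 2))) volume 0 1 := by
      apply ContinuousOn.intervalIntegrable
      rw [uIcc_of_le zero_le_one]
      exact continuousOn_const.mul hf1
    have hi2 : IntervalIntegrable (fun y => g y * (r y t ^ 2 / 2)) volume 0 1 := by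
      apply ContinuousOn.intervalIntegrable
      rw [uIcc_of_le zero_le_one]
      exact hg.mul hf2
    rw [← intervalIntegral.integral_const_mul, ← intervalIntegral.integral_add hi1 hi2] at h1
    refine (h1.congr fun n => ?_).trans (le_of_eq ?_)
    · rw [← mul_add, ← Finset.sum_add_distrib]
      congr 1
      exact Finset.sum_congr rfl fun x _ => by ring
    · congr 1
      refine intervalIntegral.integral_congr fun y _ => ?_
      have := hmbar.ne'
      field_simp
  have hzero : Tendsto (fun n : ℕ => (1 / n : ℝ) * ∑ x ∈ Finset.Icc 1 n,
        g (x / n) * (m x * (Q n x (n * t) / m x) ^ 2 / 2 + R n x (n * t) ^ 2 / 2) -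
      (1 / n : ℝ) * ∑ x ∈ Finset.Icc 1 n,
        g (x / n) * (m x * (p (x / n) t / mbar) ^ 2 / 2 + r (massNode m n x) t ^ 2 / 2)) atTop
      (𝓝 0) := by
    set B := √(1 + m1) * (max Mp Mr + max Mp Mr / mbar) with hB
    have hbound : Tendsto (fun n => G / 2 * (‖microVec m R Q n t - macroVec m mbar T p r n t‖ *
        (‖microVec m R Q n t - macroVec m mbar T p r n t‖ + 2 * B))) atTop (𝓝 0) := by
      have := (hdiff.mul (hdiff.add_const (2 * B))).const_mul (G / 2)
      rwa [zero_mul, mul_zero] at this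
    refine squeeze_zero_norm' ?_ hbound
    filter_upwards [eventually_ge_atTop 1] with n hn
    have h1 := abs_energy_sub_le hn hm' (G := G) (g := fun x => g (x / n))
      (fun x _ hx => hG _ (natCast_div_mem hx)) (r := fun x => R n x (n * t))
      (v := fun x => Q n x (n * t) / m x) (r' := fun x => r (massNode m n x) t)
      (v' := fun x => p (x / n) t / mbar) ((htraj n hn).boundary_right _)
      (by rw [massNode_self h0 hm hn, hpr.boundary_right t ht])
    have h2 : macroVec m mbar T p r n t =
        chainVec n m (fun x => r (massNode m n x) t) (fun x => p (x / n) t / mbar) := by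
      rw [macroVec, clampTime_of_mem ht]
    rw [← microVec, ← h2] at h1
    refine h1.trans (mul_le_mul_of_nonneg_left (mul_le_mul_of_nonneg_left ?_ (norm_nonneg _))
      (by linarith))
    have h3 := norm_macroVec_le h0 hm hm1 hmbar hT.le (M := max Mp Mr)
      (fun y hy s hs => (hMp y hy s hs).trans (le_max_left _ _))
      (fun y hy s hs => (hMr y hy s hs).trans (le_max_right _ _)) hn t
    have h4 := norm_le_norm_sub_add (microVec m R Q n t) (macroVec m mbar T p r n t)
    linarith
  have hadd := hzero.add hsample
  rw [zero_add] at hadd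
  refine hadd.congr fun n => ?_
  rw [sub_add_cancel]
  congr 1
  refine Finset.sum_congr rfl fun x hx => ?_
  have := (hm' x (Finset.mem_Icc.mp hx).1).ne'
  field_simp

end Energy

/-! ### Almost sure properties of the masses. -/

section RandomMasses

variable {Ω : Type*} [MeasurableSpace Ω] {P : Measure Ω} {m : ℕ → Ω → ℝ} {μ : ℝ → ℝ}
  {mmin mmax : ℝ}

theorem ae_mem_of_density {X : Ω → ℝ} (hX : Measurable X)
    (hlaw : P.map X = volume.withDensity (fun s => ENNReal.ofReal (μ s)))
    (hμ : Function.support μ ⊆ Icc mmin mmax) : ∀ᵐ ω ∂P, X ω ∈ Icc mmin mmax := by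
  have hs : MeasurableSet (Icc mmin mmax)ᶜ := measurableSet_Icc.compl
  have h1 : P.map X (Icc mmin mmax)ᶜ = 0 := by
    rw [hlaw, withDensity_apply _ hs]
    refine setLIntegral_eq_zero hs fun s hs' => ?_
    have : μ s = 0 := by
      by_contra h
      exact hs' (hμ h)
    simp [this]
  rw [Measure.map_apply hX hs] at h1
  exact h1

theorem ae_tendsto_massSum [IsProbabilityMeasure P]
    (hm_meas : ∀ x, 1 ≤ x → Measurable (m x))
    (hm_indep : iIndepFun (fun k : ℕ => m (k + 1)) P)
    (hm_law : ∀ x, 1 ≤ x → P.map (m x) = volume.withDensity (fun s => ENNReal.ofReal (μ s)))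
    (hm_mem : ∀ᵐ ω ∂P, m 1 ω ∈ Icc mmin mmax) :
    ∀ᵐ ω ∂P, Tendsto (fun n : ℕ => massSum (fun k => m k ω) n / n) atTop
      (𝓝 (∫ ω, m 1 ω ∂P)) := by
  have hint : Integrable (m 1) P := by
    refine Integrable.of_bound (hm_meas 1 le_rfl).aestronglyMeasurable (max |mmin| |mmax|) ?_
    filter_upwards [hm_mem] with ω hω
    exact abs_le_max_abs_abs hω.1 hω.2
  have h := strong_law_ae_real (fun k : ℕ => m (k + 1)) hint
    (fun i j hij => hm_indep.indepFun hij) fun i =>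
      ⟨(hm_meas (i + 1) (by omega)).aemeasurable, (hm_meas 1 le_rfl).aemeasurable, by
        rw [hm_law (i + 1) (by omega), hm_law 1 le_rfl]⟩
  filter_upwards [h] with ω hω
  simp only [massSum, sum_Icc_one_eq_sum_range]
  exact hω

end RandomMasses

end QuantumChain

end

/-! ### Assembly. -/

theorem mainTheorem6
    {Ω : Type*} [MeasurableSpace Ω] (P : MeasureTheory.Measure Ω)
    [MeasureTheory.IsProbabilityMeasure P]
    (m : ℕ → Ω → ℝ) (μ : ℝ → ℝ) (mmin mmax mbar : ℝ)
    (hm_meas : ∀ x, 1 ≤ x → Measurable (m x))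
    (hm_indep : ProbabilityTheory.iIndepFun (fun k : ℕ => m (k + 1)) P)
    (hm_law : ∀ x, 1 ≤ x →
      P.map (m x) = MeasureTheory.volume.withDensity (fun s => ENNReal.ofReal (μ s)))
    (hμ_smooth : ContDiff ℝ ((⊤ : ℕ∞) : WithTop ℕ∞) μ) (hμ_nonneg : ∀ s, 0 ≤ μ s)
    (hmmin : 0 < mmin) (hμ_supp : Function.support μ ⊆ Set.Icc mmin mmax)
    (hmbar : mbar = ∫ ω, m 1 ω ∂P)
    (pbar rbar β : ℝ → ℝ)
    (hpbar : ContDiffOn ℝ 1 pbar (Set.Icc 0 1)) (hrbar : ContDiffOn ℝ 1 rbar (Set.Icc 0 1))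
    (hrbar0 : rbar 0 = 0) (hrbar1 : rbar 1 = 0)
    (hpbar_int : ∫ y in (0 : ℝ)..1, pbar y = 0)
    (hβ : ContinuousOn β (Set.Icc 0 1)) (hβ_pos : ∀ y ∈ Set.Icc (0 : ℝ) 1, 0 < β y)
    (T : ℝ) (hT : 0 < T) (p r : ℝ → ℝ → ℝ)
    (hpr : QuantumChain.IsMacroSolution T mbar pbar rbar p r)
    (g : ℝ → ℝ) (hg : ContinuousOn g (Set.Icc 0 1)) (t : ℝ) (ht : t ∈ Set.Icc 0 T) :
    ∀ᵐ ω ∂P,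
      (∀ n : ℕ, ∀ x ∈ Finset.Icc 1 n,
        QuantumChain.HasExpectation
          (QuantumChain.localGibbs n (fun k => m k ω) mbar β pbar rbar)
          (QuantumChain.heisenberg n (fun k => m k ω) (n * t) (QuantumChain.momentum n x)) ∧
        QuantumChain.HasExpectation
          (QuantumChain.localGibbs n (fun k => m k ω) mbar β pbar rbar)
          (QuantumChain.heisenberg n (fun k => m k ω) (n * t) (QuantumChain.elong n x))) ∧
      Tendsto
        (fun n : ℕ => (1 / n : ℂ) * ∑ x ∈ Finset.Icc 1 n, (g (x / n) : ℂ) *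
          (QuantumChain.expectation
              (QuantumChain.localGibbs n (fun k => m k ω) mbar β pbar rbar)
              (QuantumChain.heisenberg n (fun k => m k ω) (n * t) (QuantumChain.momentum n x)) ^ 2
            / (2 * m x ω) +
          QuantumChain.expectation
              (QuantumChain.localGibbs n (fun k => m k ω) mbar β pbar rbar)
              (QuantumChain.heisenberg n (fun k => m k ω) (n * t) (QuantumChain.elong n x)) ^ 2
            / 2))
        atTop
        (𝓝 ((∫ y in (0 : ℝ)..1, g y * (p y t ^ 2 / (2 * mbar) + r y t ^ 2 / 2) : ℝ) : ℂ)) := by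
  have hmem : ∀ᵐ ω ∂P, ∀ x, 1 ≤ x → m x ω ∈ Icc mmin mmax := by
    rw [ae_all_iff]
    intro x
    by_cases hx : 1 ≤ x
    · filter_upwards [QuantumChain.ae_mem_of_density (hm_meas x hx) (hm_law x hx) hμ_supp] with ω hω
      exact fun _ => hω
    · exact Eventually.of_forall fun ω h => absurd h hx
  have hmem1 : ∀ᵐ ω ∂P, m 1 ω ∈ Icc mmin mmax := hmem.mono fun ω h => h 1 le_rfl
  have hmbar_pos : 0 < mbar := by
    rw [hmbar]
    have hint : Integrable (m 1) P := by
      refine Integrable.of_bound (hm_meas 1 le_rfl).aestronglyMeasurable (max |mmin| |mmax|) ?_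
      filter_upwards [hmem1] with ω hω
      exact abs_le_max_abs_abs hω.1 hω.2
    have h1 : ∫ _, mmin ∂P ≤ ∫ ω, m 1 ω ∂P :=
      integral_mono_ae (integrable_const _) hint (hmem1.mono fun ω h => h.1)
    rw [integral_const, probReal_univ, one_smul] at h1
    exact hmmin.trans_le h1
  -- The exceptional null set depends on the masses alone; everything below is deterministic.
  filter_upwards [hmem,
    QuantumChain.ae_tendsto_massSum hm_meas hm_indep hm_law hmem1] with ω hω hlim
  rw [← hmbar] at hlim
  have hpos : ∀ x, 1 ≤ x → 0 < m x ω := fun x hx => hmmin.trans_le (hω x hx).1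
  -- The condition `1 ≤ n` sits inside the existential so that `choose` gives trajectories for every
  -- `n`; the empty chain receives the zero functions.
  have htraj : ∀ n : ℕ, ∃ R Q : ℕ → ℝ → ℝ, 1 ≤ n →
      QuantumChain.IsMeanTrajectory n (fun k => m k ω) mbar β pbar rbar R Q ∧
      ∀ x ∈ Finset.Icc 1 n, ∀ τ,
        (QuantumChain.HasExpectation
            (QuantumChain.localGibbs n (fun k => m k ω) mbar β pbar rbar)
            (QuantumChain.heisenberg n (fun k => m k ω) τ (QuantumChain.momentum n x)) ∧
          QuantumChain.expectation
            (QuantumChain.localGibbs n (fun k => m k ω) mbar β pbar rbar)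
            (QuantumChain.heisenberg n (fun k => m k ω) τ (QuantumChain.momentum n x)) =
            (Q x τ : ℂ)) ∧
        (QuantumChain.HasExpectation
            (QuantumChain.localGibbs n (fun k => m k ω) mbar β pbar rbar)
            (QuantumChain.heisenberg n (fun k => m k ω) τ (QuantumChain.elong n x)) ∧
          QuantumChain.expectation
            (QuantumChain.localGibbs n (fun k => m k ω) mbar β pbar rbar)
            (QuantumChain.heisenberg n (fun k => m k ω) τ (QuantumChain.elong n x)) =
            (R x τ : ℂ)) := by
    intro n
    by_cases hn : 1 ≤ n
    · obtain ⟨R, Q, h1, h2, h3, h4, h5, h6, h7⟩ := QuantumChain.exists_mean_trajectory hn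
        (m := fun k => m k ω) (fun x hx => hpos x (Finset.mem_Icc.mp hx).1) mbar β pbar rbar
        (fun x hx => hβ_pos _ (QuantumChain.natCast_div_mem (Finset.mem_Icc.mp hx).2))
      exact ⟨R, Q, fun _ => ⟨⟨h1, h2, h3, h4, h5, h6⟩, h7⟩⟩
    · exact ⟨0, 0, fun h => absurd h hn⟩
  choose R Q hRQ using htraj
  refine ⟨fun n x hx => ?_, ?_⟩
  · have hn : 1 ≤ n := (Finset.mem_Icc.mp hx).1.trans (Finset.mem_Icc.mp hx).2
    have h := (hRQ n hn).2 x hx (n * t)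
    exact ⟨h.1.1, h.2.1⟩
  · have hE := QuantumChain.tendsto_mechanical_energy hmmin (fun x hx => (hω x hx).1)
      (fun x hx => (hω x hx).2) hmbar_pos hlim hpbar hrbar hrbar0 hrbar1 hpbar_int hβ hβ_pos hT hpr
      (fun n hn => (hRQ n hn).1) hg ht
    refine ((Complex.continuous_ofReal.tendsto _).comp hE).congr fun n => ?_
    simp only [Function.comp_apply]
    push_cast
    congr 1
    refine Finset.sum_congr rfl fun x hx => ?_
    have hn : 1 ≤ n := (Finset.mem_Icc.mp hx).1.trans (Finset.mem_Icc.mp hx).2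
    have h := (hRQ n hn).2 x hx (n * t)
    rw [h.1.2, h.2.2]
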